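/- Let $M$ be a connected topological manifold (possibly with boundary, not necessarily compact), $\pi=\pi_1(M)$, with universal covering $\widetilde M$. Let $\psi\colon\pi\to\Gamma$ be an epimorphism onto a free abelian group and let $\xi\in H^1(M;\mathbb Z)=\operatorname{Hom}(\pi,\mathbb Z)$ factor through $\psi$; the induced homomorphism $\Gamma\to\mathbb Z\subset\mathbb R$ is again denoted by $\xi$. Let $S$ be a (commutative) domain and $\alpha\colon\pi\to\operatorname{GL}(k,S)$ a representation. For $0\ne p=\sum_\gamma n_\gamma\gamma\in S[\Gamma]$ let $t_\xi(p)$ be the sum of those $n_\gamma\gamma$ for which $\xi(\gamma)$ is the maximum of $\xi$ on the support of $p$. Let $T_\xi S[\Gamma]$ be the multiplicative set of all $p\neq 0$ such that $t_\xi(p)=s\gamma$ with $s\in S$ a unit and $\gamma\in\Gamma$, and let $\mathcal R_\xi S[\Gamma]=(T_\xi S[\Gamma])^{-1}S[\Gamma]$. Let $\pi$ act from the right on row vectors $v\in\mathcal R_\xi S[\Gamma]^k$ by $v\cdot g=\psi(g)\,v\,\alpha(g)$, and let $H_i^\alpha(M;\mathcal R_\xi S[\Gamma]^k)$ be the $i$-th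 homology of the complex $\mathcal R_\xi S[\Gamma]^k\otimes_{\mathbb Z[\pi]}C_*(\widetilde M)$, where $C_*(\widetilde M)$ is the singular chain complex of $\widetilde M$ with the left $\pi$-action by deck transformations. Suppose that $\xi$ is fibered, i.e. there is a locally trivial bundle $p\colon M\to S^1$ with $p_*=\xi\colon\pi_1(M)\to\pi_1(S^1)=\mathbb Z$, and that the fiber of $p$ is homotopy equivalent to a finite CW complex. Then $H_i^\alpha(M;\mathcal R_\xi S[\Gamma]^k)=0$ for all $i$. -/

import Mathlib

open CategoryTheory

universe t u v w z

noncomputable section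

namespace Novikov

/-! ### Manifolds, fundamental groups, fibered classes -/

/-- Topological manifolds (Hausdorff, second countable, locally Euclidean), possibly with boundary,
not necessarily compact. -/
class TopManifold (M : Type u) [TopologicalSpace M] : Prop
    extends T2Space M, SecondCountableTopology M where
  exists_charts : ∃ n : ℕ, Nonempty (ChartedSpace (EuclideanSpace ℝ (Fin n)) M) ∨
    Nonempty (ChartedSpace (EuclideanHalfSpace (n + 1)) M)

instance TopManifold.locallyPathConnectedSpace (M : Type u) [TopologicalSpace M]
    [h : TopManifold M] : LocallyPathConnectedSpace M := by
  obtain ⟨n, ⟨⟨c⟩⟩ | ⟨⟨c⟩⟩⟩ := h.exists_charts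
  · exact ChartedSpace.locallyPathConnectedSpace (EuclideanSpace ℝ (Fin n)) M
  · exact ChartedSpace.locallyPathConnectedSpace (EuclideanHalfSpace (n + 1)) M

/-- The fundamental group with the usual convention: `g * h` is "first `g`, then `h`".
(The product of Mathlib's `FundamentalGroup` is the opposite one.) -/
abbrev Pi1 (X : Type u) [TopologicalSpace X] (x₀ : X) : Type u := (FundamentalGroup X x₀)ᵐᵒᵖ

/-- The class of a loop in the fundamental group. -/
def loopClass {X : Type u} [TopologicalSpace X] {x₀ : X} (γ : Path x₀ x₀) : Pi1 X x₀ :=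
  MulOpposite.op (FundamentalGroup.fromPath (Path.Homotopic.Quotient.mk γ))

theorem loopClass_trans {X : Type u} [TopologicalSpace X] {x₀ : X} (γ δ : Path x₀ x₀) :
    loopClass (γ.trans δ) = loopClass γ * loopClass δ := rfl

/-- The loop `γ` in the circle `S¹ = ℝ/ℤ` represents `n` under the identification
`π₁(S¹) = ℤ`: a lift of `γ` to `ℝ` advances by `n`. -/
def HasWindingNumber {b : UnitAddCircle} (γ : Path b b) (n : ℤ) : Prop :=
  ∃ θ : C(unitInterval, ℝ), (∀ t, (θ t : UnitAddCircle) = γ t) ∧ θ 1 - θ 0 = n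

/-- `p : E → B` is (the projection of) a locally trivial bundle with fiber `F`. -/
def IsBundleWithFiber {E : Type u} {B : Type w} [TopologicalSpace E] [TopologicalSpace B]
    (F : Type v) [TopologicalSpace F] (p : C(E, B)) : Prop :=
  ∀ b : B, ∃ e : Bundle.Trivialization F p, b ∈ e.baseSet

/-- The class `ξ ∈ H¹(M;ℤ) = Hom(π₁(M), ℤ)` is fibered, with fiber `F`: there is a bundle map
`p : M → S¹` with fiber `F` and `p_* = ξ : π₁(M) → ℤ`. -/
def IsFibered {M : Type u} [TopologicalSpace M] {x₀ : M} (F : Type v) [TopologicalSpace F]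
    (ξ : Pi1 M x₀ →* Multiplicative ℤ) : Prop :=
  ∃ p : C(M, UnitAddCircle), IsBundleWithFiber F p ∧
    ∀ γ : Path x₀ x₀, HasWindingNumber (γ.map p.continuous) (Multiplicative.toAdd (ξ (loopClass γ)))

/-- `F` is homotopy equivalent to a finite CW complex. -/
def HasFiniteCWType (F : Type v) [TopologicalSpace F] : Prop :=
  ∃ (Y : Type v) (_ : TopologicalSpace Y) (_ : T2Space Y)
    (_ : Topology.CWComplex (Set.univ : Set Y)),
    Topology.RelCWComplex.Finite (Set.univ : Set Y) ∧ Nonempty (ContinuousMap.HomotopyEquiv F Y)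

/-! ### The universal covering and the action of the fundamental group -/

/-- A (pointed) universal covering of `(X, x₀)`. -/
structure UniversalCover (X : Type u) [TopologicalSpace X] (x₀ : X) where
  /-- the total space -/
  Total : Type v
  [top : TopologicalSpace Total]
  [simplyConnected : SimplyConnectedSpace Total]
  /-- the covering projection -/
  proj : Total → X
  isCoveringMap : IsCoveringMap proj
  /-- the base point above `x₀` -/
  base : Total
  proj_base : proj base = x₀

namespace UniversalCover

variable {X : Type u} [TopologicalSpace X] {x₀ : X} (U : UniversalCover.{u, v} X x₀)

instance : TopologicalSpace U.Total := U.top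

instance : SimplyConnectedSpace U.Total := U.simplyConnected

instance [LocallyPathConnectedSpace X] : LocallyPathConnectedSpace U.Total := by
  refine LocallyPathConnectedSpace.of_bases (p := fun x s => s ∈ nhds x ∧ IsPathConnected s)
    (s := fun _ s => s) (fun x => ?_) (fun x s hs => hs.2)
  refine Filter.hasBasis_self.2 fun s hs => ?_
  obtain ⟨e, hxe, -⟩ := U.isCoveringMap.isLocalHomeomorph x
  have : LocallyPathConnectedSpace e.source :=
    have := e.open_target.locallyPathConnectedSpace
    e.toHomeomorphSourceTarget.isOpenEmbedding.locallyPathConnectedSpace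
  obtain ⟨t, ⟨ht, htc⟩, hts⟩ := (path_connected_basis (⟨x, hxe⟩ : e.source)).mem_iff.1
    (continuous_subtype_val.continuousAt.preimage_mem_nhds hs)
  exact ⟨Subtype.val '' t, (e.open_source.isOpenMap_subtype_val).image_mem_nhds ht,
    htc.image continuous_subtype_val, by rintro _ ⟨y, hy, rfl⟩; exact hts hy⟩

/-- The base point as a point of the fiber above `x₀`. -/
def basePt : U.proj ⁻¹' {x₀} := ⟨U.base, U.proj_base⟩

/-- The end point of the lift, starting at the base point, of a loop in the class `g`. -/
def endPt (g : Pi1 X x₀) : U.proj ⁻¹' {x₀} :=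
  U.isCoveringMap.monodromy (FundamentalGroup.toPath g.unop) U.basePt

variable [LocallyPathConnectedSpace X]

theorem existsUnique_deck (g : Pi1 X x₀) :
    ∃! D : C(U.Total, U.Total), D U.base = (U.endPt g).1 ∧ U.proj ∘ D = U.proj :=
  U.isCoveringMap.existsUnique_continuousMap_lifts ⟨U.proj, U.isCoveringMap.continuous⟩ U.base
    (U.endPt g).1 ((U.endPt g).2.trans U.proj_base.symm)

/-- The deck transformation through which `g ∈ π₁(X, x₀)` acts (from the left) on the universal
covering: the one taking the base point to the end point of the lift of `g`. -/
def deck (g : Pi1 X x₀) : C(U.Total, U.Total) := (U.existsUnique_deck g).exists.choose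

theorem deck_base (g : Pi1 X x₀) : U.deck g U.base = (U.endPt g).1 :=
  (U.existsUnique_deck g).exists.choose_spec.1

theorem proj_comp_deck (g : Pi1 X x₀) : U.proj ∘ U.deck g = U.proj :=
  (U.existsUnique_deck g).exists.choose_spec.2

theorem deck_one : U.deck 1 = ContinuousMap.id U.Total := by
  refine (U.existsUnique_deck 1).unique ⟨U.deck_base 1, U.proj_comp_deck 1⟩ ⟨?_, rfl⟩
  exact congrArg Subtype.val
    (congrFun (U.isCoveringMap.monodromy_refl (x := x₀)) U.basePt).symm

theorem deck_mul (g h : Pi1 X x₀) : U.deck (g * h) = (U.deck g).comp (U.deck h) := by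
  refine (U.existsUnique_deck (g * h)).unique ⟨U.deck_base _, U.proj_comp_deck _⟩ ⟨?_, ?_⟩
  · have hmul : U.endPt (g * h) =
        U.isCoveringMap.monodromy (FundamentalGroup.toPath h.unop) (U.endPt g) :=
      U.isCoveringMap.monodromy_trans_apply ..
    rw [hmul, ContinuousMap.comp_apply, deck_base]
    obtain ⟨δ, hδ⟩ := Quotient.exists_rep (FundamentalGroup.toPath h.unop)
    have h0 : δ 0 = U.proj U.base := δ.source.trans U.proj_base.symm
    have h0' : δ 0 = U.proj (U.endPt g).1 := δ.source.trans (U.endPt g).2.symm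
    have e1 : (U.endPt h).1 = U.isCoveringMap.liftPath δ U.base h0 1 := by
      rw [endPt, ← hδ]; rfl
    have e2 : (U.isCoveringMap.monodromy (FundamentalGroup.toPath h.unop) (U.endPt g)).1 =
        U.isCoveringMap.liftPath δ (U.endPt g).1 h0' 1 := by
      rw [← hδ]; rfl
    have e3 : (U.deck g).comp (U.isCoveringMap.liftPath δ U.base h0) =
        U.isCoveringMap.liftPath δ (U.endPt g).1 h0' := by
      refine (U.isCoveringMap.eq_liftPath_iff' h0').2 ⟨?_, ?_⟩
      · rw [ContinuousMap.coe_comp, ← Function.comp_assoc, U.proj_comp_deck]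
        exact U.isCoveringMap.liftPath_lifts _ _ _
      · rw [ContinuousMap.comp_apply, U.isCoveringMap.liftPath_zero, deck_base]
    rw [e1, e2, ← e3]; rfl
  · rw [ContinuousMap.coe_comp, ← Function.comp_assoc, U.proj_comp_deck, U.proj_comp_deck]

/-- The left action of `π₁(X, x₀)` on the universal covering. -/
def deckHom : Pi1 X x₀ →* End (TopCat.of U.Total) where
  toFun g := TopCat.ofHom (U.deck g)
  map_one' := by rw [deck_one]; rfl
  map_mul' g h := by rw [deck_mul]; rfl

end UniversalCover

/-! ### Singular chains, and tensor products over a group ring -/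

/-- The free abelian group functor. -/
def freeAb : Type v ⥤ ModuleCat.{v} ℤ where
  obj X := ModuleCat.of ℤ (X →₀ ℤ)
  map f := ModuleCat.ofHom (Finsupp.lmapDomain ℤ ℤ f)

/-- The singular chain complex `C_*(X)`, with integral coefficients; `C_n(X)` is the free abelian
group on the singular `n`-simplices of `X`. -/
def singularChains : TopCat.{v} ⥤ ChainComplex (ModuleCat.{v} ℤ) ℕ :=
  TopCat.toSSet ⋙ (SimplicialObject.whiskering _ _).obj freeAb ⋙
    AlgebraicTopology.alternatingFaceMapComplex (ModuleCat.{v} ℤ)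

/-- The left `ℤ[π₁(X)]`-module structure on the singular chain complex of the universal covering. -/
def UniversalCover.chainAction {X : Type u} [TopologicalSpace X] [LocallyPathConnectedSpace X]
    {x₀ : X} (U : UniversalCover.{u, v} X x₀) :
    Pi1 X x₀ →* End (singularChains.obj (TopCat.of U.Total)) :=
  (singularChains.mapEnd _).comp U.deckHom

section Tensor

open scoped TensorProduct

variable {π : Type u} [Group π] {R : Type w} [CommRing R] {V : Type w} [AddCommGroup V] [Module R V]
  (ρ : πᵐᵒᵖ →* Module.End R V) {K : ChainComplex (ModuleCat.{v} ℤ) ℕ} (a : π →* End K)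

/-- The relations `v g ⊗ c = v ⊗ g c` that turn `V ⊗_ℤ K_n` into `V ⊗_{ℤ[π]} K_n`. -/
def tensorRelations (n : ℕ) : Submodule R (V ⊗[ℤ] K.X n) :=
  Submodule.span R {x | ∃ (g : π) (v : V) (c : K.X n),
    x = ρ (MulOpposite.op g) v ⊗ₜ[ℤ] c - v ⊗ₜ[ℤ] ((a g).f n).hom c}

theorem tensorRelations_le (i j : ℕ) : tensorRelations ρ a i ≤ (tensorRelations ρ a j).comap
    (TensorProduct.AlgebraTensorModule.map LinearMap.id (K.d i j).hom) := by
  refine Submodule.span_le.2 ?_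
  rintro _ ⟨g, v, c, rfl⟩
  refine Submodule.subset_span ⟨g, v, (K.d i j).hom c, ?_⟩
  have h : (K.d i j).hom (((a g).f i).hom c) = ((a g).f j).hom ((K.d i j).hom c) :=
    congrArg (fun f => f.hom c) ((a g).comm i j)
  simp [h]

/-- The chain complex `V ⊗_{ℤ[π]} K` of `R`-modules, for an `R`-module `V` with an `R`-linear right
action `ρ` of `π` and a chain complex `K` of left `ℤ[π]`-modules. -/
def tensorComplex : ChainComplex (ModuleCat.{max v w} R) ℕ where
  X n := ModuleCat.of R ((V ⊗[ℤ] K.X n) ⧸ tensorRelations ρ a n)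
  d i j := ModuleCat.ofHom (Submodule.mapQ _ _
    (TensorProduct.AlgebraTensorModule.map LinearMap.id (K.d i j).hom) (tensorRelations_le ρ a i j))
  shape i j h := by
    refine ModuleCat.hom_ext (Submodule.linearMap_qext _ ?_)
    have h0 : (K.d i j).hom = 0 := by rw [K.shape i j h]; rfl
    refine LinearMap.ext fun x => ?_
    induction x using TensorProduct.induction_on with
    | zero => simp
    | tmul v c => simp [h0]
    | add x y hx hy => rw [map_add, hx, hy, map_add]
  d_comp_d' i j k _ _ := by
    refine ModuleCat.hom_ext (Submodule.linearMap_qext _ ?_)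
    have h0 (c : K.X i) : (K.d j k).hom ((K.d i j).hom c) = 0 :=
      congrArg (fun f => f.hom c) (K.d_comp_d i j k)
    refine LinearMap.ext fun x => ?_
    induction x using TensorProduct.induction_on with
    | zero => simp
    | tmul v c => simp [h0]
    | add x y hx hy => rw [map_add, hx, hy, map_add]

end Tensor

/-! ### The rational Novikov completion -/

section Ring

variable {Γ : Type u} [AddCommGroup Γ] (ξ : Γ →+ ℝ) (S : Type w) [CommRing S]

variable {S} in
/-- The leading part `t_ξ(p)` of `p = ∑ n_γ γ`: the sum of those `n_γ γ` for which `ξ(γ)` is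
the maximum of `ξ` on the support of `p`. -/
def leadingPart (p : AddMonoidAlgebra S Γ) : AddMonoidAlgebra S Γ :=
  open scoped Classical in
  AddMonoidAlgebra.ofCoeff (p.coeff.filter fun γ => ∀ δ ∈ p.coeff.support, ξ δ ≤ ξ γ)

variable {S} in
/-- A monomial of `S[Γ]`: an element `s γ` with `γ ∈ Γ` and `s` a unit of `S`. -/
def IsMonomial (p : AddMonoidAlgebra S Γ) : Prop :=
  ∃ (γ : Γ) (s : S), IsUnit s ∧ p = AddMonoidAlgebra.single γ s

variable {S} in
theorem leadingPart_isMonomial_iff [Nontrivial S] (p : AddMonoidAlgebra S Γ) :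
    (p ≠ 0 ∧ IsMonomial (leadingPart ξ p)) ↔
      ∃ γ, IsUnit (p.coeff γ) ∧ ∀ δ ∈ p.coeff.support, δ ≠ γ → ξ δ < ξ γ := by
  classical
  constructor
  · rintro ⟨-, γ, s, hs, h⟩
    have hc (δ : Γ) := congrArg (fun q => q.coeff δ) h
    simp only [leadingPart, Finsupp.filter_apply, AddMonoidAlgebra.coeff_single] at hc
    have hγ := hc γ
    rw [Finsupp.single_eq_same] at hγ
    split_ifs at hγ with hmax
    · refine ⟨γ, hγ ▸ hs, fun δ hδ hne => lt_of_le_of_ne (hmax δ hδ) fun heq => ?_⟩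
      have h2 := hc δ
      rw [Finsupp.single_eq_of_ne hne, if_pos (by simpa [heq] using hmax)] at h2
      exact (Finsupp.mem_support_iff.1 hδ) h2
    · exact absurd hγ.symm hs.ne_zero
  · rintro ⟨γ, hu, hlt⟩
    have hγ : γ ∈ p.coeff.support := Finsupp.mem_support_iff.2 hu.ne_zero
    refine ⟨fun h => hu.ne_zero (by simp [h]), γ, p.coeff γ, hu, ?_⟩
    ext δ
    simp only [leadingPart, Finsupp.filter_apply, AddMonoidAlgebra.coeff_single]
    by_cases hδ : δ = γ
    · subst hδ
      rw [Finsupp.single_eq_same, if_pos]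
      intro ε hε
      by_cases h : ε = δ
      · rw [h]
      · exact (hlt ε hε h).le
    · rw [Finsupp.single_eq_of_ne hδ]
      split_ifs with hmax
      · by_contra h0
        exact absurd (hmax γ hγ) (not_le.2 (hlt δ (Finsupp.mem_support_iff.2 h0) hδ))
      · rfl

/-- The multiplicative set `T_ξ S[Γ]` of the nonzero `p ∈ S[Γ]` whose leading part is a monomial. -/
def leadingMonomials [Nontrivial S] : Submonoid (AddMonoidAlgebra S Γ) where
  carrier := {p | p ≠ 0 ∧ IsMonomial (leadingPart ξ p)}
  one_mem' := by
    refine (leadingPart_isMonomial_iff ξ 1).2 ⟨0, ?_, ?_⟩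
    · simp [AddMonoidAlgebra.one_def]
    · intro δ hδ hne
      simp only [AddMonoidAlgebra.one_def, AddMonoidAlgebra.coeff_single, Finsupp.mem_support_iff,
        Finsupp.single_eq_of_ne hne, ne_eq, not_true_eq_false] at hδ
  mul_mem' := by
    classical
    intro p q hp hq
    obtain ⟨γ, hγ, hp⟩ := (leadingPart_isMonomial_iff ξ p).1 hp
    obtain ⟨γ', hγ', hq⟩ := (leadingPart_isMonomial_iff ξ q).1 hq
    refine (leadingPart_isMonomial_iff ξ (p * q)).2 ⟨γ + γ', ?_, ?_⟩
    · have hu : UniqueAdd p.coeff.support q.coeff.support γ γ' := by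
        intro a b ha hb hab
        have hξ : ξ a + ξ b = ξ γ + ξ γ' := by rw [← map_add, hab, map_add]
        by_cases h1 : a = γ
        · exact ⟨h1, by rw [h1] at hab; exact add_left_cancel hab⟩
        · have h2 := hp a ha h1
          by_cases h3 : b = γ'
          · rw [h3] at hξ; linarith
          · have h4 := hq b hb h3; linarith
      rw [AddMonoidAlgebra.coeff_mul_add_of_uniqueAdd hu]
      exact hγ.mul hγ'
    · intro δ hδ hne
      obtain ⟨a, ha, b, hb, rfl⟩ := Finset.mem_add.1 (AddMonoidAlgebra.support_coeff_mul_subset p q hδ)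
      rw [map_add, map_add]
      by_cases h1 : a = γ
      · have h3 : b ≠ γ' := fun h => hne (by rw [h1, h])
        have h4 := hq b hb h3
        rw [h1]; linarith
      · have h2 := hp a ha h1
        by_cases h3 : b = γ'
        · rw [h3]; linarith
        · have h4 := hq b hb h3; linarith

/-- The rational Novikov completion `𝓡_ξ S[Γ] = (T_ξ S[Γ])⁻¹ S[Γ]`. -/
def RationalNovikov [Nontrivial S] : Type (max u w) := Localization (leadingMonomials ξ S)

instance [Nontrivial S] : CommRing (RationalNovikov ξ S) :=
  inferInstanceAs (CommRing (Localization (leadingMonomials ξ S)))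

instance [Nontrivial S] : Algebra (AddMonoidAlgebra S Γ) (RationalNovikov ξ S) :=
  inferInstanceAs (Algebra (AddMonoidAlgebra S Γ) (Localization (leadingMonomials ξ S)))

instance [Nontrivial S] : IsLocalization (leadingMonomials ξ S) (RationalNovikov ξ S) :=
  inferInstanceAs (IsLocalization (leadingMonomials ξ S) (Localization (leadingMonomials ξ S)))

end Ring

/-! ### Twisted Novikov homology -/

section Homology

variable {π : Type v} [Group π] {Γ : Type u} [AddCommGroup Γ] (ψ : π →* Multiplicative Γ)
  (ξ : Γ →+ ℝ) {S : Type w} [CommRing S] [Nontrivial S] {k : ℕ} (α : π →* GL (Fin k) S)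

/-- The inclusion `S → 𝓡_ξ S[Γ]`. -/
def scalarHom : S →+* RationalNovikov ξ S :=
  (algebraMap (AddMonoidAlgebra S Γ) (RationalNovikov ξ S)).comp
    AddMonoidAlgebra.singleZeroRingHom

/-- The element of `𝓡_ξ S[Γ]` given by an element of `Γ`. -/
def groupElt : Multiplicative Γ →* RationalNovikov ξ S :=
  (algebraMap (AddMonoidAlgebra S Γ) (RationalNovikov ξ S)).toMonoidHom.comp
    (AddMonoidAlgebra.of S Γ)

/-- The right action of `π` on the space `𝓡_ξ S[Γ]^k` of row vectors: `v · g = ψ(g) (v α(g))`. -/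
def coefficientAction : πᵐᵒᵖ →* Module.End (RationalNovikov ξ S) (Fin k → RationalNovikov ξ S) where
  toFun g :=
    { toFun := fun v => (groupElt ξ (ψ g.unop) : RationalNovikov ξ S) •
        Matrix.vecMul v ((α g.unop : Matrix (Fin k) (Fin k) S).map (scalarHom ξ))
      map_add' := fun v w => by rw [Matrix.add_vecMul, smul_add]
      map_smul' := fun r v => by rw [Matrix.smul_vecMul, smul_comm, RingHom.id_apply] }
  map_one' := by
    refine LinearMap.ext fun v => ?_
    simp
  map_mul' g h := by
    refine LinearMap.ext fun v => ?_
    simp [Matrix.map_mul, smul_smul, mul_comm]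

end Homology

/-- The chain complex `C_*^α(X; 𝓡_ξ S[Γ]^k) = 𝓡_ξ S[Γ]^k ⊗_{ℤ[π]} C_*(X̃)` of `𝓡_ξ S[Γ]`-modules,
where `π = π₁(X, x₀)` and `X̃` is the universal covering of `X`. -/
def twistedChains {X : Type u} [TopologicalSpace X] [LocallyPathConnectedSpace X] {x₀ : X}
    (U : UniversalCover.{u, v} X x₀) {Γ : Type w} [AddCommGroup Γ]
    (ψ : Pi1 X x₀ →* Multiplicative Γ) (ξ : Γ →+ ℝ) {S : Type z} [CommRing S] [Nontrivial S]
    {k : ℕ} (α : Pi1 X x₀ →* GL (Fin k) S) :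
    ChainComplex (ModuleCat.{max v w z} (RationalNovikov ξ S)) ℕ :=
  tensorComplex (coefficientAction ψ ξ α) U.chainAction

/-- The twisted Novikov homology `H_i^α(X; 𝓡_ξ S[Γ]^k)`, a module over `𝓡_ξ S[Γ]`. -/
def twistedHomology {X : Type u} [TopologicalSpace X] [LocallyPathConnectedSpace X] {x₀ : X}
    (U : UniversalCover.{u, v} X x₀) {Γ : Type w} [AddCommGroup Γ]
    (ψ : Pi1 X x₀ →* Multiplicative Γ) (ξ : Γ →+ ℝ) {S : Type z} [CommRing S] [Nontrivial S]
    {k : ℕ} (α : Pi1 X x₀ →* GL (Fin k) S) (i : ℕ) :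
    ModuleCat.{max v w z} (RationalNovikov ξ S) :=
  (twistedChains U ψ ξ α).homology i

end Novikov

end

noncomputable section

namespace Novikov

/-! ### Chains of finite tuples -/

/-! ### Linear maps out of free abelian groups, tested on generators in the support. -/

section FinsuppLemmas

variable {ι : Type*} {N : Type*} [AddCommGroup N]

/-! Let N be the kernel of ξ on π. A lift `h` of the bundle projection to the universal covering is
a height function, with h(gx) = h(x) + ξ(g). Pulled back to the line, the bundle becomes a product ℝ
× F. Shrinking the height to 0, and moving the fiber coordinate along a homotopy from the identity
of F to a map that factors through a compact space, deforms the universal covering N-equivariantly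
into the points of height 0 over a compact subset of M (`UniversalCover.exists_deformation`).

Consequently, in every degree the singular chains C of the universal covering are dominated, up to
N-equivariant chain homotopy, by finitely many N-orbits of tuples of points (`SC.IsDominated`). A
subdivided simplex is deformed, its vertices are moved to nearby points of finitely many orbits, and
the resulting tuple is filled in again by singular simplices. Fillings and homotopies come from
acyclic carriers, the carriers being sheets over small contractible sets (`SC.exists_domination`).

The rest is algebra over the Novikov ring R, with V = R^k. The class ξ is nontrivial, and there is a
t with ξ(t) < 0 that generates π modulo N. The complex V ⊗_{ℤ[π]} C is the cokernel of 1 - θ on V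
⊗_{ℤ[N]} C, where θ(v ⊗ c) = vt ⊗ t⁻¹c. By domination and Cayley–Hamilton there is a monic χ, with
coefficients in the image A of S[ker ξ], such that χ(ψ(t)⁻¹θ) takes cycles to boundaries
(`exists_monic_aeval_mem_range`). So p(θ) annihilates homology for p(X) = χ(ψ(t)⁻¹X). The value p(1)
= χ(ψ(t)⁻¹) has leading part ψ(t)⁻ⁿ, n = deg χ, because ξ vanishes on the coefficients and is
positive on ψ(t)⁻¹; it is therefore a unit of R (`isUnit_eval_of_monic`).

Since p(θ) is congruent to p(1) modulo 1 - θ, the operator 1 - θ is bijective on homology. On chains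
it is injective, because θ raises the height (`mem_coinvRel_of_sub_twist_mem`). The exact sequence
of the cokernel then gives the vanishing (`exact_coinvariants`). -/

theorem map_mem_of_mem_supported {f : (ι →₀ ℤ) →ₗ[ℤ] N} {s : Set ι} {W : Submodule ℤ N}
    (h : ∀ x ∈ s, f (Finsupp.single x 1) ∈ W) {c : ι →₀ ℤ} (hc : c ∈ Finsupp.supported ℤ ℤ s) :
    f c ∈ W := by
  rw [Finsupp.supported_eq_span_single] at hc
  have : Submodule.span ℤ ((fun i : ι => Finsupp.single i (1 : ℤ)) '' s) ≤ W.comap f := by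
    rw [Submodule.span_le]
    rintro _ ⟨x, hx, rfl⟩
    exact h x hx
  exact this hc

theorem eq_of_mem_supported {f g : (ι →₀ ℤ) →ₗ[ℤ] N} {s : Set ι}
    (h : ∀ x ∈ s, f (Finsupp.single x 1) = g (Finsupp.single x 1)) {c : ι →₀ ℤ}
    (hc : c ∈ Finsupp.supported ℤ ℤ s) : f c = g c := by
  have := map_mem_of_mem_supported (f := f - g) (W := ⊥)
    (fun x hx => by simp [h x hx]) hc
  simpa [sub_eq_zero] using this

theorem single_mem_supported_of_mem {s : Set ι} {x : ι} (h : x ∈ s) :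
    Finsupp.single x (1 : ℤ) ∈ Finsupp.supported ℤ ℤ s :=
  Finsupp.single_mem_supported ℤ _ h

theorem supported_mono' {s t : Set ι} (h : s ⊆ t) {c : ι →₀ ℤ}
    (hc : c ∈ Finsupp.supported ℤ ℤ s) : c ∈ Finsupp.supported ℤ ℤ t :=
  Finsupp.supported_mono h hc

/-- The linear extension of a function to the free abelian group. -/
def linExt (f : ι → N) : (ι →₀ ℤ) →ₗ[ℤ] N := Finsupp.linearCombination ℤ f

@[simp] theorem linExt_single (f : ι → N) (x : ι) : linExt f (Finsupp.single x 1) = f x := by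
  simp [linExt]

theorem linExt_hom_ext {f g : (ι →₀ ℤ) →ₗ[ℤ] N}
    (h : ∀ x, f (Finsupp.single x 1) = g (Finsupp.single x 1)) : f = g :=
  Finsupp.lhom_ext' fun x => LinearMap.ext_ring (h x)

end FinsuppLemmas

/-- Chains of finite tuples of elements of `E`, in all dimensions `≥ -1`. -/
abbrev TupleChain (E : Type*) := List E →₀ ℤ

namespace TupleChain

variable {E E' : Type*}

/-- The cone with apex `x`. -/
def cone (x : E) : TupleChain E →ₗ[ℤ] TupleChain E := linExt fun l => Finsupp.single (x :: l) 1

@[simp] theorem cone_single (x : E) (l : List E) :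
    cone x (Finsupp.single l 1) = Finsupp.single (x :: l) 1 := linExt_single _ _

/-- The functoriality of tuple chains. -/
def map (f : E → E') : TupleChain E →ₗ[ℤ] TupleChain E' :=
  linExt fun l => Finsupp.single (l.map f) 1

@[simp] theorem map_single (f : E → E') (l : List E) :
    map f (Finsupp.single l 1) = Finsupp.single (l.map f) 1 := linExt_single _ _

/-- The boundary of a tuple. -/
def bdry : List E → TupleChain E
  | [] => 0
  | x :: l => Finsupp.single l 1 - cone x (bdry l)

/-- The boundary operator on tuple chains. -/
def d : TupleChain E →ₗ[ℤ] TupleChain E := linExt bdry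

@[simp] theorem d_nil : d (Finsupp.single ([] : List E) 1) = 0 := by simp [d, bdry]

@[simp] theorem d_single_cons (x : E) (l : List E) :
    d (Finsupp.single (x :: l) 1) = Finsupp.single l 1 - cone x (d (Finsupp.single l 1)) := by
  simp [d, bdry]

/-- The linear extension of the recursion that defines `bdry`. Coning is a contracting homotopy, and
the identities for prisms and subdivisions are inductions that rest on it. -/
theorem d_cone (x : E) (c : TupleChain E) : d (cone x c) = c - cone x (d c) := by
  have : d ∘ₗ cone x = LinearMap.id - cone x ∘ₗ d := linExt_hom_ext fun l => by simp
  exact LinearMap.congr_fun this c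

theorem d_d (c : TupleChain E) : d (d c) = 0 := by
  have : d ∘ₗ d = (0 : TupleChain E →ₗ[ℤ] TupleChain E) := linExt_hom_ext fun l => by
    induction l with
    | nil => simp
    | cons x l ih =>
      simp only [LinearMap.comp_apply, LinearMap.zero_apply] at ih
      simp [d_cone, ih]
  exact LinearMap.congr_fun this c

theorem map_cone (f : E → E') (x : E) (c : TupleChain E) :
    map f (cone x c) = cone (f x) (map f c) := by
  have : map f ∘ₗ cone x = cone (f x) ∘ₗ map f := linExt_hom_ext fun l => by simp
  exact LinearMap.congr_fun this c

theorem map_d (f : E → E') (c : TupleChain E) : map f (d c) = d (map f c) := by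
  have : map f ∘ₗ d = d ∘ₗ map f := linExt_hom_ext fun l => by
    induction l with
    | nil => simp
    | cons x l ih =>
      simp only [LinearMap.comp_apply, map_single] at ih
      simp [map_cone, ih]
  exact LinearMap.congr_fun this c

/-- Tuple chains supported on a set of tuples. -/
abbrev On (s : Set (List E)) : Submodule ℤ (TupleChain E) := Finsupp.supported ℤ ℤ s

/-- Homogeneous tuple chains. -/
abbrev Hom (E : Type*) (n : ℕ) : Submodule ℤ (TupleChain E) := On {l | l.length = n}

theorem cone_mem {x : E} {s s' : Set (List E)} (h : ∀ l ∈ s, x :: l ∈ s') {c : TupleChain E}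
    (hc : c ∈ On s) : cone x c ∈ On s' :=
  map_mem_of_mem_supported (fun l hl => by
    rw [cone_single]; exact single_mem_supported_of_mem (h l hl)) hc

theorem map_mem {f : E → E'} {s : Set (List E)} {s' : Set (List E')}
    (h : ∀ l ∈ s, l.map f ∈ s') {c : TupleChain E} (hc : c ∈ On s) : map f c ∈ On s' :=
  map_mem_of_mem_supported (fun l hl => by
    rw [map_single]; exact single_mem_supported_of_mem (h l hl)) hc

theorem d_single_mem (l : List E) :
    d (Finsupp.single l 1) ∈ On {l' | l'.Sublist l ∧ l'.length + 1 = l.length} := by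
  induction l with
  | nil => simp
  | cons x l ih =>
    rw [d_single_cons]
    refine Submodule.sub_mem _ (single_mem_supported_of_mem ⟨by simp, rfl⟩) ?_
    refine cone_mem (fun l' hl' => ?_) ih
    exact ⟨hl'.1.cons_cons x, by simpa using hl'.2⟩

theorem d_mem_hom {n : ℕ} {c : TupleChain E} (hc : c ∈ Hom E (n + 1)) : d c ∈ Hom E n :=
  map_mem_of_mem_supported (fun l hl => supported_mono' (fun l' hl' => by
    have := hl'.2
    simp only [Set.mem_ofPred_eq] at hl ⊢
    omega) (d_single_mem l)) hc

theorem d_hom_zero {c : TupleChain E} (hc : c ∈ Hom E 0) : d c = 0 :=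
  eq_of_mem_supported (f := d) (g := 0) (fun l hl => by
    rw [List.length_eq_zero_iff.1 hl]; simp) hc

/-! The prism operator. -/

/-- The prism on a tuple. -/
def prismTuple (f g : E → E') : List E → TupleChain E'
  | [] => 0
  | x :: l => cone (f x) (Finsupp.single ((x :: l).map g) 1 - prismTuple f g l)

/-- The prism operator between two maps. -/
def prism (f g : E → E') : TupleChain E →ₗ[ℤ] TupleChain E' := linExt (prismTuple f g)

theorem prism_cone (f g : E → E') (x : E) (c : TupleChain E) :
    prism f g (cone x c) = cone (f x) (map g (cone x c) - prism f g c) := by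
  have : prism f g ∘ₗ cone x = cone (f x) ∘ₗ (map g ∘ₗ cone x - prism f g) :=
    linExt_hom_ext fun l => by simp [prism, prismTuple]
  exact LinearMap.congr_fun this c

theorem d_prism (f g : E → E') (c : TupleChain E) :
    d (prism f g c) + prism f g (d c) = map g c - map f c := by
  have : d ∘ₗ prism f g + prism f g ∘ₗ d = map g - map f := linExt_hom_ext fun l => by
    induction l with
    | nil => simp [prism, prismTuple]
    | cons x l ih =>
      simp only [LinearMap.add_apply, LinearMap.comp_apply, LinearMap.sub_apply] at ih ⊢
      rw [← cone_single, prism_cone, d_cone, d_cone, map_sub (prism f g), prism_cone]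
      have h1 : d (prism f g (Finsupp.single l 1)) = map g (Finsupp.single l 1)
        - map f (Finsupp.single l 1) - prism f g (d (Finsupp.single l 1)) := by rw [← ih]; abel
      simp only [map_sub, h1, ← map_d, d_cone, map_cone]
      abel
  exact LinearMap.congr_fun this c

theorem prism_map (f g : E → E') {E'' : Type*} (h : E'' → E) (c : TupleChain E'') :
    prism f g (map h c) = prism (f ∘ h) (g ∘ h) c := by
  have : prism f g ∘ₗ map h = prism (f ∘ h) (g ∘ h) := linExt_hom_ext fun l => by
    induction l with
    | nil => simp [prism, prismTuple]
    | cons x l ih =>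
      simp only [LinearMap.comp_apply, map_single, prism, linExt_single] at ih
      simp [prism, prismTuple, ih]
  exact LinearMap.congr_fun this c

theorem map_prism (f g : E → E') {E'' : Type*} (h : E' → E'') (c : TupleChain E) :
    map h (prism f g c) = prism (h ∘ f) (h ∘ g) c := by
  have : map h ∘ₗ prism f g = prism (h ∘ f) (h ∘ g) := linExt_hom_ext fun l => by
    induction l with
    | nil => simp [prism, prismTuple]
    | cons x l ih =>
      simp only [LinearMap.comp_apply, prism, linExt_single] at ih
      simp [prism, prismTuple, ih, map_cone]
  exact LinearMap.congr_fun this c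

theorem prism_single_mem (f g : E → E') (l : List E) :
    prism f g (Finsupp.single l 1) ∈
      On {l' | l'.length = l.length + 1 ∧ ∀ y ∈ l', ∃ x ∈ l, y = f x ∨ y = g x} := by
  induction l with
  | nil => simp [prism, prismTuple]
  | cons x l ih =>
    simp only [prism, linExt_single] at ih ⊢
    rw [prismTuple]
    refine cone_mem (s := {l' | l'.length = l.length + 1 ∧
      ∀ y ∈ l', ∃ z ∈ x :: l, y = f z ∨ y = g z}) ?_ ?_
    · intro l' hl'
      refine ⟨by simp [hl'.1], fun y hy => ?_⟩
      rcases List.mem_cons.1 hy with rfl | hy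
      · exact ⟨x, by simp, Or.inl rfl⟩
      · exact hl'.2 y hy
    · refine Submodule.sub_mem _ (single_mem_supported_of_mem ?_) (supported_mono' ?_ ih)
      · refine ⟨by simp, fun y hy => ?_⟩
        obtain ⟨z, hz, rfl⟩ := List.mem_map.1 hy
        exact ⟨z, hz, Or.inr rfl⟩
      · intro l' hl'
        refine ⟨hl'.1, fun y hy => ?_⟩
        obtain ⟨z, hz, h⟩ := hl'.2 y hy
        exact ⟨z, List.mem_cons_of_mem _ hz, h⟩

/-! Barycentric subdivision, with respect to a choice `β` of apices. -/

section Subdivision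

variable (β : List E → E)

/-- The subdivision operator, on tuples with `n` entries. -/
def sd : ℕ → TupleChain E →ₗ[ℤ] TupleChain E
  | 0 => LinearMap.id
  | n + 1 => linExt fun l => cone (β l) (sd n (d (Finsupp.single l 1)))

/-- The chain homotopy between subdivision and the identity, on tuples with `n` entries. -/
def sdHomotopy : ℕ → TupleChain E →ₗ[ℤ] TupleChain E
  | 0 => 0
  | n + 1 => linExt fun l =>
      cone (β l) (Finsupp.single l 1 - sdHomotopy n (d (Finsupp.single l 1)))

theorem sd_single (n : ℕ) (l : List E) : sd β (n + 1) (Finsupp.single l 1) =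
    cone (β l) (sd β n (d (Finsupp.single l 1))) := linExt_single _ _

theorem sdHomotopy_single (n : ℕ) (l : List E) : sdHomotopy β (n + 1) (Finsupp.single l 1) =
    cone (β l) (Finsupp.single l 1 - sdHomotopy β n (d (Finsupp.single l 1))) :=
  linExt_single _ _

theorem sd_mem_hom (n : ℕ) {c : TupleChain E} (hc : c ∈ Hom E n) : sd β n c ∈ Hom E n := by
  induction n generalizing c with
  | zero => exact hc
  | succ n ih =>
    refine map_mem_of_mem_supported (fun l hl => ?_) hc
    rw [sd_single]
    exact cone_mem (fun l' hl' => by simpa using hl')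
      (ih (d_mem_hom (single_mem_supported_of_mem hl)))

/-- Subdivision cones off the subdivided boundary, which is a cycle by induction, so the boundary of
the cone is just its base. -/
theorem d_sd (n : ℕ) {c : TupleChain E} (hc : c ∈ Hom E (n + 1)) :
    d (sd β (n + 1) c) = sd β n (d c) := by
  induction n generalizing c with
  | zero =>
    refine eq_of_mem_supported (f := d ∘ₗ sd β 1) (g := sd β 0 ∘ₗ d) (fun l hl => ?_) hc
    have := d_hom_zero (d_mem_hom (single_mem_supported_of_mem hl))
    simp [sd, d_cone, this]
  | succ n ih =>
    refine eq_of_mem_supported (f := d ∘ₗ sd β (n + 2)) (g := sd β (n + 1) ∘ₗ d)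
      (fun l hl => ?_) hc
    have h1 := ih (d_mem_hom (single_mem_supported_of_mem hl))
    rw [d_d, map_zero] at h1
    rw [LinearMap.comp_apply, LinearMap.comp_apply, sd_single, d_cone, h1, map_zero,
      sub_zero]

/-- The base of the cone, l - T(dl), has boundary sd(dl) by induction; coning that boundary off
again gives the subdivision of l. -/
theorem d_sdHomotopy (n : ℕ) {c : TupleChain E} (hc : c ∈ Hom E (n + 1)) :
    d (sdHomotopy β (n + 1) c) + sdHomotopy β n (d c) = c - sd β (n + 1) c := by
  induction n generalizing c with
  | zero =>
    refine eq_of_mem_supported (f := d ∘ₗ sdHomotopy β 1 + sdHomotopy β 0 ∘ₗ d)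
      (g := LinearMap.id - sd β 1) (fun l hl => ?_) hc
    simp [sd, sdHomotopy]
  | succ n ih =>
    refine eq_of_mem_supported (f := d ∘ₗ sdHomotopy β (n + 2) + sdHomotopy β (n + 1) ∘ₗ d)
      (g := LinearMap.id - sd β (n + 2)) (fun l hl => ?_) hc
    have h1 := ih (d_mem_hom (single_mem_supported_of_mem hl))
    rw [d_d, map_zero, add_zero] at h1
    simp only [LinearMap.add_apply, LinearMap.comp_apply, LinearMap.sub_apply, LinearMap.id_apply]
    rw [sdHomotopy_single, d_cone, map_sub, h1, sd_single]
    simp only [map_sub]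
    abel

theorem sdHomotopy_mem_hom (n : ℕ) {c : TupleChain E} (hc : c ∈ Hom E n) :
    sdHomotopy β n c ∈ Hom E (n + 1) := by
  induction n generalizing c with
  | zero => exact Submodule.zero_mem _
  | succ n ih =>
    refine map_mem_of_mem_supported (fun l hl => ?_) hc
    rw [sdHomotopy_single]
    exact cone_mem (s := {l | l.length = n + 1}) (fun l' hl' => by simpa using hl')
      (Submodule.sub_mem _ (single_mem_supported_of_mem hl)
        (ih (d_mem_hom (single_mem_supported_of_mem hl))))

/-- Apices enter only through `β`, so a map compatible with the choice of apices commutes with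
subdivision. Linear face inclusions respect barycenters, which is what makes subdivision natural on
singular chains. -/
theorem map_sd {β' : List E' → E'} {f : E → E'} (hf : ∀ l, f (β l) = β' (l.map f)) (n : ℕ)
    (c : TupleChain E) : map f (sd β n c) = sd β' n (map f c) := by
  induction n generalizing c with
  | zero => rfl
  | succ n ih =>
    have : map f ∘ₗ sd β (n + 1) = sd β' (n + 1) ∘ₗ map f := linExt_hom_ext fun l => by
      simp [sd, map_cone, ih, map_d, hf]
    exact LinearMap.congr_fun this c

theorem map_sdHomotopy {β' : List E' → E'} {f : E → E'} (hf : ∀ l, f (β l) = β' (l.map f))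
    (n : ℕ) (c : TupleChain E) : map f (sdHomotopy β n c) = sdHomotopy β' n (map f c) := by
  induction n generalizing c with
  | zero => simp [sdHomotopy]
  | succ n ih =>
    have : map f ∘ₗ sdHomotopy β (n + 1) = sdHomotopy β' (n + 1) ∘ₗ map f :=
      linExt_hom_ext fun l => by simp [sdHomotopy, map_cone, ih, map_d, hf]
    exact LinearMap.congr_fun this c

/-- Iterated subdivision. -/
def sdIter (m n : ℕ) : TupleChain E →ₗ[ℤ] TupleChain E := sd β n ^ m

theorem sdIter_zero (n : ℕ) (c : TupleChain E) : sdIter β 0 n c = c := rfl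

theorem sdIter_succ (m n : ℕ) (c : TupleChain E) :
    sdIter β (m + 1) n c = sd β n (sdIter β m n c) := by
  rw [sdIter, pow_succ', sdIter]; rfl

theorem sdIter_mem_hom (m n : ℕ) {c : TupleChain E} (hc : c ∈ Hom E n) :
    sdIter β m n c ∈ Hom E n := by
  induction m with
  | zero => exact hc
  | succ m ih => rw [sdIter_succ]; exact sd_mem_hom β n ih

theorem d_sdIter (m n : ℕ) {c : TupleChain E} (hc : c ∈ Hom E (n + 1)) :
    d (sdIter β m (n + 1) c) = sdIter β m n (d c) := by
  induction m with
  | zero => rfl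
  | succ m ih => rw [sdIter_succ, sdIter_succ, d_sd β n (sdIter_mem_hom β m _ hc), ih]

theorem map_sdIter {β' : List E' → E'} {f : E → E'} (hf : ∀ l, f (β l) = β' (l.map f)) (m n : ℕ)
    (c : TupleChain E) : map f (sdIter β m n c) = sdIter β' m n (map f c) := by
  induction m with
  | zero => rfl
  | succ m ih => rw [sdIter_succ, sdIter_succ, map_sd β hf, ih]

/-- The chain homotopy between the `m`-th and the `(m+1)`-st iterated subdivision. -/
def stepHomotopy (m n : ℕ) : TupleChain E →ₗ[ℤ] TupleChain E := sdHomotopy β n ∘ₗ sdIter β m n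

theorem d_stepHomotopy (m n : ℕ) {c : TupleChain E} (hc : c ∈ Hom E (n + 1)) :
    d (stepHomotopy β m (n + 1) c) + stepHomotopy β m n (d c) =
      sdIter β m (n + 1) c - sdIter β (m + 1) (n + 1) c := by
  rw [stepHomotopy, stepHomotopy, LinearMap.comp_apply, LinearMap.comp_apply, ← d_sdIter β m n hc,
    d_sdHomotopy β n (sdIter_mem_hom β m _ hc), sdIter_succ]

theorem stepHomotopy_mem_hom (m n : ℕ) {c : TupleChain E} (hc : c ∈ Hom E n) :
    stepHomotopy β m n c ∈ Hom E (n + 1) :=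
  sdHomotopy_mem_hom β n (sdIter_mem_hom β m n hc)

theorem map_stepHomotopy {β' : List E' → E'} {f : E → E'} (hf : ∀ l, f (β l) = β' (l.map f))
    (m n : ℕ) (c : TupleChain E) :
    map f (stepHomotopy β m n c) = stepHomotopy β' m n (map f c) := by
  rw [stepHomotopy, stepHomotopy, LinearMap.comp_apply, LinearMap.comp_apply,
    map_sdHomotopy β hf, map_sdIter β hf]

end Subdivision

end TupleChain

/-! ### Barycentric subdivision of tuples in a normed space -/

namespace TupleChain

section Average

variable {V V' : Type*} [AddCommGroup V] [Module ℝ V] [AddCommGroup V'] [Module ℝ V']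

/-- The barycenter of a tuple. -/
def avg (l : List V) : V := (l.length : ℝ)⁻¹ • l.sum

theorem map_avg (f : V →ₗ[ℝ] V') (l : List V) : f (avg l) = avg (l.map f) := by
  simp [avg, map_list_sum]

theorem avg_mem {s : Set V} (hs : Convex ℝ s) {l : List V} (hl : l ≠ []) (h : ∀ x ∈ l, x ∈ s) :
    avg l ∈ s := by
  have hlen : (0 : ℝ) < l.length := by
    exact_mod_cast List.length_pos_iff.2 hl
  have hsum : l.sum = ∑ i : Fin l.length, l.get i := by
    rw [Fin.sum_univ_def, List.map_get_finRange]
  rw [avg, hsum, Finset.smul_sum]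
  exact hs.sum_mem (fun i _ => by positivity) (by simp [hlen.ne']) fun i _ => h _ (List.get_mem _ _)

/-- The convex hull of the entries of a tuple. -/
def hull (l : List V) : Set V := convexHull ℝ {x | x ∈ l}

theorem subset_hull {l : List V} {x : V} (h : x ∈ l) : x ∈ hull l := subset_convexHull _ _ h

theorem hull_mono {l l' : List V} (h : ∀ x ∈ l', x ∈ hull l) : hull l' ⊆ hull l :=
  convexHull_min h (convex_convexHull _ _)

theorem hull_subset {s : Set V} (hs : Convex ℝ s) {l : List V} (h : ∀ x ∈ l, x ∈ s) :
    hull l ⊆ s := convexHull_min h hs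

theorem sdHomotopy_single_mem_hull (n : ℕ) (l : List V) (hl : l.length = n) :
    sdHomotopy avg n (Finsupp.single l 1) ∈ On {l' | ∀ x ∈ l', x ∈ hull l} := by
  induction n generalizing l with
  | zero => exact Submodule.zero_mem _
  | succ n ih =>
    rw [sdHomotopy_single]
    refine cone_mem (s := {l' | ∀ x ∈ l', x ∈ hull l}) ?_ ?_
    · intro l' hl' x hx
      rcases List.mem_cons.1 hx with rfl | hx
      · exact avg_mem (convex_convexHull _ _) (by rintro rfl; simp at hl) fun x hx => subset_hull hx
      · exact hl' x hx
    · refine Submodule.sub_mem _ (single_mem_supported_of_mem fun x hx => subset_hull hx) ?_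
      refine map_mem_of_mem_supported (fun l' hl' => ?_) (d_single_mem l)
      refine supported_mono' ?_ (ih l' (by have := hl'.2; omega))
      intro l'' hl'' x hx
      exact hull_mono (fun y hy => subset_hull (hl'.1.subset hy)) (hl'' x hx)

end Average

section Mesh

variable {V : Type*} [NormedAddCommGroup V] [NormedSpace ℝ V]

theorem norm_sum_map_le {ι V : Type*} [SeminormedAddCommGroup V] (f : ι → V) {δ : ℝ} (l : List ι) (h : ∀ x ∈ l, ‖f x‖ ≤ δ) :
    ‖(l.map f).sum‖ ≤ l.length * δ := by
  induction l with
  | nil => simp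
  | cons x l ih =>
    have h1 := ih fun y hy => h y (List.mem_cons_of_mem _ hy)
    have h2 := h x List.mem_cons_self
    have h3 := norm_add_le (f x) (l.map f).sum
    simp only [List.map_cons, List.sum_cons, List.length_cons, Nat.cast_add, Nat.cast_one]
    linarith

/-- Balls are convex, so only an entry x of the tuple has to be tested. With n entries, the
barycenter minus x is 1/n times a sum of n - 1 differences of norm at most δ, and (n - 1)/n ≤ N/(N +
1). -/
theorem dist_avg_le {N : ℕ} {δ : ℝ} (hδ : 0 ≤ δ) {l : List V} (hl : l ≠ [])
    (hN : l.length ≤ N + 1) (h : ∀ x ∈ l, ∀ y ∈ l, dist x y ≤ δ) {y : V} (hy : y ∈ hull l) :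
    dist y (avg l) ≤ N / (N + 1) * δ := by
  classical
  suffices hull l ⊆ Metric.closedBall (avg l) (N / (N + 1) * δ) from this hy
  refine hull_subset (convex_closedBall _ _) fun x hx => ?_
  rw [Metric.mem_closedBall, dist_comm, dist_eq_norm]
  have hn : 0 < l.length := List.length_pos_iff.2 hl
  have hn' : (0 : ℝ) < l.length := by exact_mod_cast hn
  have hper := List.perm_cons_erase hx
  have hlen : (l.erase x).length + 1 = l.length := by simpa using hper.length_eq.symm
  have hsum : ∀ m : List V, (m.map fun z => z - x).sum = m.sum - (m.length : ℝ) • x := by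
    intro m
    induction m with
    | nil => simp
    | cons a m ih =>
      simp only [List.map_cons, List.sum_cons, ih, List.length_cons, Nat.cast_add, Nat.cast_one,
        add_smul, one_smul]
      abel
  have h1 : avg l - x = (l.length : ℝ)⁻¹ • ((l.erase x).map fun z => z - x).sum := by
    have : ((l.erase x).map fun z => z - x).sum = (l.map fun z => z - x).sum := by
      rw [(hper.map _).sum_eq]; simp
    rw [this, hsum, avg, smul_sub, smul_smul, inv_mul_cancel₀ hn'.ne', one_smul]
  have h2 := norm_sum_map_le (fun z => z - x) (l.erase x) (δ := δ) fun z hz => by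
    rw [← dist_eq_norm]; exact h z (List.mem_of_mem_erase hz) x hx
  rw [h1, norm_smul, norm_inv, Real.norm_natCast]
  have h3 : ((l.erase x).length : ℝ) = l.length - 1 := by
    rw [← hlen]; push_cast; ring
  rw [h3] at h2
  have h4 : (l.length : ℝ) ≤ N + 1 := by exact_mod_cast hN
  calc (l.length : ℝ)⁻¹ * _ ≤ (l.length : ℝ)⁻¹ * ((l.length - 1) * δ) := by gcongr
    _ = (1 - (l.length : ℝ)⁻¹) * δ := by field_simp
    _ ≤ (1 - ((N : ℝ) + 1)⁻¹) * δ := by gcongr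
    _ = N / (N + 1) * δ := by field_simp; ring

/-- An edge of the subdivision either joins the barycenter to a point of the hull, or belongs to the
subdivision of a face. The bound N on the dimension stays fixed in the induction, so one contraction
factor serves all faces. -/
theorem sd_single_mem_mesh {N : ℕ} {δ : ℝ} (hδ : 0 ≤ δ) (n : ℕ) (hn : n ≤ N + 1) (l : List V)
    (hl : l.length = n) (h : ∀ x ∈ l, ∀ y ∈ l, dist x y ≤ δ) :
    sd avg n (Finsupp.single l 1) ∈ On {l' | (∀ x ∈ l', x ∈ hull l) ∧
      ∀ x ∈ l', ∀ y ∈ l', dist x y ≤ N / (N + 1) * δ} := by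
  have hpos : 0 ≤ N / (N + 1) * δ := by positivity
  induction n generalizing l with
  | zero =>
    rw [List.length_eq_zero_iff.1 hl]
    exact single_mem_supported_of_mem (by simp)
  | succ n ih =>
    have hne : l ≠ [] := by rintro rfl; simp at hl
    rw [sd_single]
    refine cone_mem (s := {l' | (∀ x ∈ l', x ∈ hull l) ∧
      ∀ x ∈ l', ∀ y ∈ l', dist x y ≤ N / (N + 1) * δ}) ?_ ?_
    · intro l' hl'
      have h1 : ∀ x ∈ l', dist x (avg l) ≤ N / (N + 1) * δ := fun x hx =>
        dist_avg_le hδ hne (hl ▸ hn) h (hl'.1 x hx)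
      refine ⟨fun x hx => ?_, fun x hx y hy => ?_⟩
      · rcases List.mem_cons.1 hx with rfl | hx
        · exact avg_mem (convex_convexHull _ _) hne fun x hx => subset_hull hx
        · exact hl'.1 x hx
      · rcases List.mem_cons.1 hx with rfl | hx <;> rcases List.mem_cons.1 hy with rfl | hy
        · simpa using hpos
        · rw [dist_comm]; exact h1 y hy
        · exact h1 x hx
        · exact hl'.2 x hx y hy
    · refine map_mem_of_mem_supported (fun l' hl' => ?_) (d_single_mem l)
      refine supported_mono' ?_
        (ih (by omega) l' (by have := hl'.2; omega) fun x hx y hy =>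
          h x (hl'.1.subset hx) y (hl'.1.subset hy))
      intro l'' hl''
      refine ⟨fun x hx => ?_, hl''.2⟩
      exact hull_mono (fun y hy => subset_hull (hl'.1.subset hy)) (hl''.1 x hx)

theorem dist_le_of_mem_hull {δ : ℝ} {l : List V} (h : ∀ x ∈ l, ∀ y ∈ l, dist x y ≤ δ) {x y : V}
    (hx : x ∈ hull l) (hy : y ∈ hull l) : dist x y ≤ δ := by
  obtain ⟨x', hx', y', hy', h'⟩ := convexHull_exists_dist_ge2 hx hy
  exact h'.trans (h x' hx' y' hy')

theorem sdIter_single_mem_mesh {N : ℕ} {δ : ℝ} (hδ : 0 ≤ δ) (m : ℕ) (l : List V)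
    (hl : l.length ≤ N + 1) (h : ∀ x ∈ l, ∀ y ∈ l, dist x y ≤ δ) :
    sdIter avg m l.length (Finsupp.single l 1) ∈ On {l' | (∀ x ∈ l', x ∈ hull l) ∧
      ∀ x ∈ l', ∀ y ∈ l', dist x y ≤ (N / (N + 1)) ^ m * δ} := by
  -- The length has to be carried along, since the next subdivision is applied to tuples of that
  -- length.
  suffices sdIter avg m l.length (Finsupp.single l 1) ∈ On {l' | l'.length = l.length ∧
      (∀ x ∈ l', x ∈ hull l) ∧ ∀ x ∈ l', ∀ y ∈ l', dist x y ≤ (N / (N + 1)) ^ m * δ} from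
    supported_mono' (fun l' hl' => hl'.2) this
  induction m with
  | zero =>
    rw [sdIter_zero]
    exact single_mem_supported_of_mem ⟨rfl, fun x hx => subset_hull hx, by simpa using h⟩
  | succ m ih =>
    rw [sdIter_succ]
    refine map_mem_of_mem_supported (fun l' hl' => ?_) ih
    have h1 := sd_mem_hom avg l.length
      (single_mem_supported_of_mem (s := {l' : List V | l'.length = l.length}) hl'.1)
    have h2 := sd_single_mem_mesh (N := N) (by positivity) l.length hl l' hl'.1 hl'.2.2
    have h3 : sd avg l.length (Finsupp.single l' 1) ∈ On ({l' : List V | l'.length = l.length} ∩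
      {l'' | (∀ x ∈ l'', x ∈ hull l') ∧
        ∀ x ∈ l'', ∀ y ∈ l'', dist x y ≤ N / (N + 1) * ((N / (N + 1)) ^ m * δ)}) := by
      rw [On, Finsupp.supported_inter]; exact ⟨h1, h2⟩
    refine supported_mono' ?_ h3
    intro l'' hl''
    refine ⟨hl''.1, fun x hx => hull_mono hl'.2.1 (hl''.2.1 x hx), fun x hx y hy => ?_⟩
    rw [pow_succ', mul_assoc]
    exact hl''.2.2 x hx y hy

/-- The last homotopy does not shrink anything, but it stays in the hulls of the tuples of the m-th
subdivision, whose diameters are already under control. -/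
theorem stepHomotopy_single_mem_mesh {N : ℕ} {δ : ℝ} (hδ : 0 ≤ δ) (m : ℕ) (l : List V)
    (hl : l.length ≤ N + 1) (h : ∀ x ∈ l, ∀ y ∈ l, dist x y ≤ δ) :
    stepHomotopy avg m l.length (Finsupp.single l 1) ∈ On {l' | (∀ x ∈ l', x ∈ hull l) ∧
      ∀ x ∈ l', ∀ y ∈ l', dist x y ≤ (N / (N + 1)) ^ m * δ} := by
  have h1 := sdIter_single_mem_mesh hδ m l hl h
  have h2 := sdIter_mem_hom avg m l.length
    (single_mem_supported_of_mem (s := {l' : List V | l'.length = l.length}) rfl)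
  have h3 : sdIter avg m l.length (Finsupp.single l 1) ∈ On ({l' : List V | l'.length = l.length} ∩
      {l' | (∀ x ∈ l', x ∈ hull l) ∧
      ∀ x ∈ l', ∀ y ∈ l', dist x y ≤ (N / (N + 1)) ^ m * δ}) := by
    rw [On, Finsupp.supported_inter]; exact ⟨h2, h1⟩
  rw [stepHomotopy, LinearMap.comp_apply]
  refine map_mem_of_mem_supported (fun l' hl' => ?_) h3
  refine supported_mono' ?_ (sdHomotopy_single_mem_hull _ l' hl'.1)
  intro l'' hl''
  exact ⟨fun x hx => hull_mono hl'.2.1 (hl'' x hx),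
    fun x hx y hy => dist_le_of_mem_hull hl'.2.2 (hl'' x hx) (hl'' y hy)⟩

end Mesh

end TupleChain

/-! ### Singular chains -/

/-- The topological `n`-simplex. -/
abbrev Simp (n : ℕ) := stdSimplex ℝ (Fin (n + 1))

/-- Singular chains, as finitely supported functions on the set of singular simplices. -/
abbrev SC (n : ℕ) (X : Type*) [TopologicalSpace X] := C(Simp n, X) →₀ ℤ

namespace SC

variable {X Y Z : Type*} [TopologicalSpace X] [TopologicalSpace Y] [TopologicalSpace Z]

/-- The inclusion of the `j`-th face of the standard simplex. -/
def faceMap {n : ℕ} (j : Fin (n + 2)) : C(Simp n, Simp (n + 1)) :=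
  ⟨stdSimplex.map j.succAbove, stdSimplex.continuous_map _⟩

/-- The boundary operator. -/
def d (n : ℕ) : SC (n + 1) X →ₗ[ℤ] SC n X :=
  linExt fun σ => ∑ j : Fin (n + 2), (-1 : ℤ) ^ (j : ℕ) • Finsupp.single (σ.comp (faceMap j)) 1

theorem d_single (n : ℕ) (σ : C(Simp (n + 1), X)) : d n (Finsupp.single σ 1) =
    ∑ j : Fin (n + 2), (-1 : ℤ) ^ (j : ℕ) • Finsupp.single (σ.comp (faceMap j)) 1 :=
  linExt_single _ _

/-- Functoriality of singular chains. -/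
def map (f : C(X, Y)) (n : ℕ) : SC n X →ₗ[ℤ] SC n Y :=
  linExt fun σ => Finsupp.single (f.comp σ) 1

@[simp] theorem map_single (f : C(X, Y)) (n : ℕ) (σ : C(Simp n, X)) :
    map f n (Finsupp.single σ 1) = Finsupp.single (f.comp σ) 1 := linExt_single _ _

theorem map_d (f : C(X, Y)) (n : ℕ) (c : SC (n + 1) X) : map f n (d n c) = d n (map f (n + 1) c) := by
  have : map f n ∘ₗ d n = d n ∘ₗ map f (n + 1) := linExt_hom_ext fun σ => by
    simp only [LinearMap.comp_apply, d_single, map_single, map_sum, map_smul,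
      ContinuousMap.comp_assoc]
  exact LinearMap.congr_fun this c

theorem map_comp (g : C(Y, Z)) (f : C(X, Y)) (n : ℕ) (c : SC n X) :
    map g n (map f n c) = map (g.comp f) n c := by
  have : map g n ∘ₗ map f n = map (g.comp f) n := linExt_hom_ext fun σ => by
    simp [ContinuousMap.comp_assoc]
  exact LinearMap.congr_fun this c

theorem map_id (n : ℕ) (c : SC n X) : map (ContinuousMap.id X) n c = c := by
  have : map (ContinuousMap.id X) n = LinearMap.id := linExt_hom_ext fun σ => by simp
  exact LinearMap.congr_fun this c

/-- Singular chains supported on the singular simplices in a given set. -/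
abbrev In (n : ℕ) (A : Set X) : Submodule ℤ (SC n X) :=
  Finsupp.supported ℤ ℤ {σ : C(Simp n, X) | ∀ t, σ t ∈ A}

/-! #### Affine simplices -/

section Push

variable {V : Type*} [AddCommGroup V] [Module ℝ V]

/-- The affine simplex with given vertices. -/
def aff (m : ℕ) (l : List V) (t : Simp m) : V := ∑ i : Fin (m + 1), t i • l.getD i 0

theorem aff_mem {s : Set V} (hs : Convex ℝ s) {m : ℕ} {l : List V} (hl : l.length = m + 1)
    (h : ∀ x ∈ l, x ∈ s) (t : Simp m) : aff m l t ∈ s := by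
  refine hs.sum_mem (fun i _ => t.2.1 i) t.2.2 fun i _ => ?_
  rw [List.getD_eq_getElem _ _ (by rw [hl]; exact i.2)]
  exact h _ (List.getElem_mem _)

theorem aff_map {V' : Type*} [AddCommGroup V'] [Module ℝ V'] (g : V →ₗ[ℝ] V') (m : ℕ) (l : List V)
    (t : Simp m) : aff m (l.map g) t = g (aff m l t) := by
  simp only [aff, map_sum, map_smul]
  refine Finset.sum_congr rfl fun i _ => ?_
  rw [← List.getD_map l 0 g, map_zero]

theorem aff_faceMap {m : ℕ} (j : Fin (m + 2)) {l : List V} (hl : l.length = m + 2) (t : Simp m) :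
    aff (m + 1) l (faceMap j t) = aff m (l.eraseIdx j) t := by
  have h1 (i : Fin (m + 2)) : faceMap j t i = ∑ k, if j.succAbove k = i then t k else 0 := by
    change (stdSimplex.map j.succAbove t) i = _
    rw [stdSimplex.map_coe, FunOnFinite.linearMap_apply_apply, Finset.sum_filter]
  simp only [aff, h1, Finset.sum_smul]
  rw [Finset.sum_comm]
  refine Finset.sum_congr rfl fun k _ => ?_
  rw [Finset.sum_eq_single (j.succAbove k) (fun i _ hi => by rw [if_neg hi.symm, zero_smul])
    (by simp), if_pos rfl]
  congr 1
  have hk : (j.succAbove k : ℕ) < l.length := by rw [hl]; exact (j.succAbove k).2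
  have hk' : (k : ℕ) < (l.eraseIdx j).length := by
    rw [List.length_eraseIdx_of_lt (by rw [hl]; exact j.2), hl]; exact k.2
  rw [List.getD_eq_getElem _ _ hk, List.getD_eq_getElem _ _ hk', List.getElem_eraseIdx]
  by_cases h : (k : ℕ) < j
  · simp only [h, dite_true]
    congr 1
    rw [Fin.succAbove_of_castSucc_lt _ _ (by simpa [Fin.lt_def] using h)]
    rfl
  · simp only [h, dite_false]
    congr 1
    rw [Fin.succAbove_of_le_castSucc _ _ (by simpa [Fin.le_def] using h)]
    rfl

open scoped Classical in
/-- The chain consisting of a singular simplex, given as a function. -/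
def ofFun {m : ℕ} (φ : Simp m → X) : SC m X :=
  -- The default 0 makes `push` a total linear map; the chain-level identities apply it to tuples in
  -- a convex set on which the function is continuous, where the default does not occur.
  if h : Continuous φ then Finsupp.single ⟨φ, h⟩ 1 else 0

/-- The singular chains of affine simplices, mapped to a space `X` by a function. -/
def push (f : V → X) (m : ℕ) : TupleChain V →ₗ[ℤ] SC m X := linExt fun l => ofFun (f ∘ aff m l)

theorem push_single {f : V → X} {m : ℕ} {l : List V} (h : Continuous (f ∘ aff m l)) :
    push f m (Finsupp.single l 1) = Finsupp.single ⟨f ∘ aff m l, h⟩ 1 := by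
  rw [push, linExt_single, ofFun, dif_pos h]

/-- Tuples of given length with entries in a given set. -/
def tuples (s : Set V) (n : ℕ) : Set (List V) := {l | l.length = n ∧ ∀ x ∈ l, x ∈ s}

theorem push_map {V' : Type*} [AddCommGroup V'] [Module ℝ V'] (f : V' → X) (g : V →ₗ[ℝ] V')
    (m : ℕ) (c : TupleChain V) : push f m (TupleChain.map g c) = push (f ∘ g) m c := by
  have : push f m ∘ₗ TupleChain.map g = push (f ∘ g) m := linExt_hom_ext fun l => by
    have h : f ∘ aff m (l.map g) = (f ∘ g) ∘ aff m l := by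
      funext t; simp [aff_map]
    simp only [LinearMap.comp_apply, TupleChain.map_single, push, linExt_single, h]
  exact LinearMap.congr_fun this c

theorem push_congr {f f' : V → X} {s : Set V} (hs : Convex ℝ s) (h : Set.EqOn f f' s) {m : ℕ}
    {c : TupleChain V} (hc : c ∈ TupleChain.On (tuples s (m + 1))) : push f m c = push f' m c := by
  refine eq_of_mem_supported (fun l hl => ?_) hc
  have h : f ∘ aff m l = f' ∘ aff m l := funext fun t => h (aff_mem hs hl.1 hl.2 t)
  simp only [push, linExt_single, h]

variable [TopologicalSpace V] [ContinuousAdd V] [ContinuousSMul ℝ V]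

theorem continuous_aff (m : ℕ) (l : List V) : Continuous (aff m l) := by
  refine continuous_finsetSum _ fun i _ => ?_
  exact ((continuous_apply i).comp continuous_subtype_val).smul continuous_const

theorem continuous_comp_aff {f : V → X} {s : Set V} (hf : ContinuousOn f s) (hs : Convex ℝ s)
    {m : ℕ} {l : List V} (hl : l.length = m + 1) (h : ∀ x ∈ l, x ∈ s) :
    Continuous (f ∘ aff m l) :=
  hf.comp_continuous (continuous_aff m l) (aff_mem hs hl h)

theorem map_push {f : V → X} {s : Set V} (hf : ContinuousOn f s) (hs : Convex ℝ s) (g : C(X, Y))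
    {m : ℕ} {c : TupleChain V} (hc : c ∈ TupleChain.On (tuples s (m + 1))) :
    map g m (push f m c) = push (g ∘ f) m c := by
  refine eq_of_mem_supported (f := map g m ∘ₗ push f m) (fun l hl => ?_) hc
  have h := continuous_comp_aff hf hs hl.1 hl.2
  rw [LinearMap.comp_apply, push_single h, push_single (f := g ∘ f) (g.continuous.comp h), map_single]
  rfl

/-- Reconciles the recursive boundary of tuples with the alternating sum over faces used for
singular simplices. -/
theorem tupleChain_d_single {E : Type*} (n : ℕ) (l : List E) (hl : l.length = n + 1) :
    TupleChain.d (Finsupp.single l 1) =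
      ∑ j : Fin (n + 1), (-1 : ℤ) ^ (j : ℕ) • Finsupp.single (l.eraseIdx j) 1 := by
  induction n generalizing l with
  | zero =>
    obtain ⟨x, rfl⟩ := List.length_eq_one_iff.1 hl
    simp
  | succ n ih =>
    match l, hl with
    | x :: l, hl =>
      rw [TupleChain.d_single_cons, ih l (by simpa using hl)]
      conv_rhs => rw [Fin.sum_univ_succ]
      simp only [Fin.val_zero, pow_zero, one_smul, List.eraseIdx_cons_zero, Fin.val_succ, pow_succ,
        mul_neg, mul_one, neg_smul, List.eraseIdx_cons_succ, map_sum, map_smul,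
        TupleChain.cone_single, Finset.sum_neg_distrib, sub_eq_add_neg]

/-- Restricting an affine simplex to a face deletes a vertex. This transfers every identity between
tuple chains to singular chains. -/
theorem d_push {f : V → X} {s : Set V} (hf : ContinuousOn f s) (hs : Convex ℝ s) {m : ℕ}
    {c : TupleChain V} (hc : c ∈ TupleChain.On (tuples s (m + 2))) :
    d m (push f (m + 1) c) = push f m (TupleChain.d c) := by
  refine eq_of_mem_supported (f := d m ∘ₗ push f (m + 1)) (g := push f m ∘ₗ TupleChain.d)
    (fun l hl => ?_) hc
  rw [LinearMap.comp_apply, LinearMap.comp_apply, push_single (continuous_comp_aff hf hs hl.1 hl.2),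
    d_single, tupleChain_d_single (m + 1) l hl.1, map_sum]
  refine Finset.sum_congr rfl fun j _ => ?_
  rw [map_smul]
  congr 1
  have h1 : (l.eraseIdx j).length = m + 1 := by
    rw [List.length_eraseIdx_of_lt (by rw [hl.1]; exact j.2), hl.1]; rfl
  rw [push_single (continuous_comp_aff hf hs h1 fun x hx => hl.2 x (List.mem_of_mem_eraseIdx hx))]
  congr 1
  ext t
  exact congrArg f (aff_faceMap j hl.1 t)

end Push

theorem d_mem_tuples {V : Type*} {s : Set V} {n : ℕ} {c : TupleChain V}
    (hc : c ∈ TupleChain.On (tuples s (n + 1))) : TupleChain.d c ∈ TupleChain.On (tuples s n) := by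
  refine map_mem_of_mem_supported (fun l hl => ?_) hc
  refine supported_mono' ?_ (TupleChain.d_single_mem l)
  intro l' hl'
  exact ⟨by have := hl'.2; have := hl.1; omega, fun x hx => hl.2 x (hl'.1.subset hx)⟩

/-! #### Vertices -/

/-- The tuple of vertices of a singular simplex. -/
def vertices {n : ℕ} (σ : C(Simp n, X)) : List X := List.ofFn fun i => σ (stdSimplex.vertex i)

/-- The chain map taking a singular simplex to its tuple of vertices. -/
def vert (n : ℕ) : SC n X →ₗ[ℤ] TupleChain X := linExt fun σ => Finsupp.single (vertices σ) 1

@[simp] theorem vert_single {n : ℕ} (σ : C(Simp n, X)) :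
    vert n (Finsupp.single σ 1) = Finsupp.single (vertices σ) 1 := linExt_single _ _

theorem length_vertices {n : ℕ} (σ : C(Simp n, X)) : (vertices σ).length = n + 1 := by
  simp [vertices]

theorem eraseIdx_ofFn {E : Type*} {n : ℕ} (f : Fin (n + 1) → E) (j : Fin (n + 1)) :
    (List.ofFn f).eraseIdx j = List.ofFn fun i => f (j.succAbove i) := by
  refine List.ext_getElem ?_ fun i h1 h2 => ?_
  · rw [List.length_eraseIdx_of_lt (by simpa using Nat.lt_succ_iff.1 j.2)]; simp
  · rw [List.getElem_eraseIdx]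
    simp only [List.length_ofFn] at h2
    by_cases h : i < j
    · simp only [h, dite_true, List.getElem_ofFn]
      rw [Fin.succAbove_of_castSucc_lt _ _ (by simpa [Fin.lt_def] using h)]
      rfl
    · simp only [h, dite_false, List.getElem_ofFn]
      rw [Fin.succAbove_of_le_castSucc _ _ (by simpa [Fin.le_def] using h)]
      rfl

theorem vertices_face {n : ℕ} (σ : C(Simp (n + 1), X)) (j : Fin (n + 2)) :
    vertices (σ.comp (faceMap j)) = (vertices σ).eraseIdx j := by
  rw [vertices, vertices, eraseIdx_ofFn]
  congr 1
  funext i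
  exact congrArg σ (stdSimplex.map_vertex _ _)

theorem d_vert (n : ℕ) (c : SC (n + 1) X) : TupleChain.d (vert (n + 1) c) = vert n (d n c) := by
  have : TupleChain.d ∘ₗ vert (n + 1) = vert n ∘ₗ d (X := X) n := linExt_hom_ext fun σ => by
    simp only [LinearMap.comp_apply, vert_single, d_single, map_sum, map_smul, vertices_face,
      tupleChain_d_single (n + 1) _ (length_vertices σ)]
  exact LinearMap.congr_fun this c

theorem vert_mem_hom (n : ℕ) (c : SC n X) : vert n c ∈ TupleChain.Hom X (n + 1) := by
  refine map_mem_of_mem_supported (s := Set.univ) (fun σ _ => ?_) (by simp)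
  rw [vert_single]
  exact single_mem_supported_of_mem (length_vertices σ)

theorem vert_map (f : C(X, Y)) (n : ℕ) (c : SC n X) :
    vert n (map f n c) = TupleChain.map f (vert n c) := by
  have : vert n ∘ₗ map f n = TupleChain.map f ∘ₗ vert n := linExt_hom_ext fun σ => by
    simp [vertices, List.map_ofFn, Function.comp_def]
  exact LinearMap.congr_fun this c

/-! #### The model simplex -/

/-- The vertices of the standard simplex. -/
def stdVertices (n : ℕ) : List (Fin (n + 1) → ℝ) := List.ofFn fun i => Pi.single i 1

theorem length_stdVertices (n : ℕ) : (stdVertices n).length = n + 1 := by simp [stdVertices]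

theorem getElem_stdVertices {n : ℕ} (i : Fin (n + 1)) (h : (i : ℕ) < (stdVertices n).length) :
    (stdVertices n)[(i : ℕ)] = Pi.single i 1 := List.getElem_ofFn _

theorem stdVertices_mem (n : ℕ) : stdVertices n ∈ tuples (stdSimplex ℝ (Fin (n + 1))) (n + 1) := by
  refine ⟨length_stdVertices n, fun x hx => ?_⟩
  obtain ⟨i, rfl⟩ := (List.mem_ofFn' _ _).1 hx
  exact single_mem_stdSimplex ℝ i

theorem aff_stdVertices (n : ℕ) (t : Simp n) : aff n (stdVertices n) t = t := by
  funext k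
  simp only [aff, Finset.sum_apply, Pi.smul_apply, smul_eq_mul]
  rw [Finset.sum_eq_single k]
  · rw [List.getD_eq_getElem _ _ (by rw [length_stdVertices]; exact k.2), getElem_stdVertices]
    simp
  · intro i _ hi
    rw [List.getD_eq_getElem _ _ (by rw [length_stdVertices]; exact i.2), getElem_stdVertices]
    simp [Pi.single_eq_of_ne hi.symm]
  · simp

/-- The linear extension of the face inclusion. -/
def faceLin {n : ℕ} (j : Fin (n + 2)) : (Fin (n + 1) → ℝ) →ₗ[ℝ] (Fin (n + 2) → ℝ) :=
  FunOnFinite.linearMap ℝ ℝ j.succAbove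

theorem stdVertices_eraseIdx {n : ℕ} (j : Fin (n + 2)) :
    (stdVertices (n + 1)).eraseIdx j = (stdVertices n).map (faceLin j) := by
  rw [stdVertices, stdVertices, eraseIdx_ofFn, List.map_ofFn]
  congr 1
  funext i
  simp [faceLin]

theorem d_stdVertices (n : ℕ) : TupleChain.d (Finsupp.single (stdVertices (n + 1)) 1) =
    ∑ j : Fin (n + 2), (-1 : ℤ) ^ (j : ℕ) •
      TupleChain.map (faceLin j) (Finsupp.single (stdVertices n) 1) := by
  rw [tupleChain_d_single (n + 1) _ (length_stdVertices _)]
  simp only [TupleChain.map_single, stdVertices_eraseIdx]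

open scoped Classical in
/-- The extension of a singular simplex to a function on the ambient vector space. -/
def ext {n : ℕ} (σ : C(Simp n, X)) (v : Fin (n + 1) → ℝ) : X :=
  -- The value off the simplex is arbitrary: all tuples that are pushed along this function have
  -- their hull in the simplex.
  if h : v ∈ stdSimplex ℝ (Fin (n + 1)) then σ ⟨v, h⟩ else σ (stdSimplex.vertex 0)

theorem ext_coe {n : ℕ} (σ : C(Simp n, X)) (t : Simp n) : ext σ t.1 = σ t := by
  rw [ext, dif_pos t.2]

theorem continuousOn_ext {n : ℕ} (σ : C(Simp n, X)) :
    ContinuousOn (ext σ) (stdSimplex ℝ (Fin (n + 1))) := by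
  rw [continuousOn_iff_continuous_domRestrict]
  convert! σ.continuous using 1
  funext t
  exact ext_coe σ t

theorem ext_face {n : ℕ} (σ : C(Simp (n + 1), X)) (j : Fin (n + 2)) :
    Set.EqOn (ext (σ.comp (faceMap j))) (ext σ ∘ faceLin j) (stdSimplex ℝ (Fin (n + 1))) := by
  intro v hv
  have h : faceLin j v = (faceMap j ⟨v, hv⟩ : Simp (n + 1)).1 := rfl
  rw [Function.comp_apply, h, ext_coe]
  exact ext_coe (σ.comp (faceMap j)) ⟨v, hv⟩

theorem ext_map {n : ℕ} (f : C(X, Y)) (σ : C(Simp n, X)) : ext (f.comp σ) = f ∘ ext σ := by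
  funext v
  simp only [ext, Function.comp_apply]
  split_ifs <;> rfl

/-- Every singular simplex is the image of the model simplex, so a chain of tuples in the model
defines an operator on all singular chains. -/
theorem push_ext_stdVertices {n : ℕ} (σ : C(Simp n, X)) :
    push (ext σ) n (Finsupp.single (stdVertices n) 1) = Finsupp.single σ 1 := by
  have h : ext σ ∘ aff n (stdVertices n) = σ := by
    funext t
    rw [Function.comp_apply, aff_stdVertices]
    exact ext_coe σ t
  rw [push_single (by rw [h]; exact σ.continuous)]
  congr 1
  ext t
  exact congrFun h t

end SC

theorem mem_supported_inter {ι : Type*} {s t : Set ι} {c : ι →₀ ℤ}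
    (h : c ∈ Finsupp.supported ℤ ℤ s) (h' : c ∈ Finsupp.supported ℤ ℤ t) :
    c ∈ Finsupp.supported ℤ ℤ (s ∩ t) := by
  rw [Finsupp.supported_inter]; exact ⟨h, h'⟩

/-! ### Natural operators on singular chains, defined on the model simplex. -/

namespace SC

variable {X Y : Type*} [TopologicalSpace X] [TopologicalSpace Y]

/-- Naturality under faces: an operator given by a model chain `b`, evaluated on the boundary of σ,
is the push along σ of the face images of `b`. Homotopy formulas thereby reduce to formulas between
tuples in the model. It is applied to subdivisions and to prisms. -/
theorem linExt_push_d {n m : ℕ} {V V' : Type*} [AddCommGroup V] [Module ℝ V] [AddCommGroup V']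
    [Module ℝ V'] (E : C(Simp n, X) → V → Y) (E' : C(Simp (n + 1), X) → V' → Y)
    (L : Fin (n + 2) → V →ₗ[ℝ] V') {s : Set V} (hs : Convex ℝ s)
    (hE : ∀ σ j, Set.EqOn (E (σ.comp (faceMap j))) (E' σ ∘ L j) s) {b : TupleChain V}
    (hb : b ∈ TupleChain.On (tuples s (m + 1))) (σ : C(Simp (n + 1), X)) :
    linExt (fun τ => push (E τ) m b) (d n (Finsupp.single σ 1)) =
      push (E' σ) m (∑ j : Fin (n + 2), (-1 : ℤ) ^ (j : ℕ) • TupleChain.map (L j) b) := by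
  rw [d_single, map_sum, map_sum]
  refine Finset.sum_congr rfl fun j _ => ?_
  rw [map_smul, map_smul, linExt_single, push_map, push_congr hs (hE σ j) hb]

/-- The face of the model simplex. -/
abbrev modelSimplex (n : ℕ) : Set (Fin (n + 1) → ℝ) := stdSimplex ℝ (Fin (n + 1))

theorem convex_modelSimplex (n : ℕ) : Convex ℝ (modelSimplex n) := convex_stdSimplex ℝ _

theorem single_stdVertices_mem (n : ℕ) :
    Finsupp.single (stdVertices n) (1 : ℤ) ∈ TupleChain.On (tuples (modelSimplex n) (n + 1)) :=
  single_mem_supported_of_mem (stdVertices_mem n)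

theorem d_d (n : ℕ) (c : SC (n + 2) X) : d n (d (n + 1) c) = 0 := by
  have : d n ∘ₗ d (n + 1) = (0 : SC (n + 2) X →ₗ[ℤ] SC n X) := linExt_hom_ext fun σ => by
    rw [LinearMap.comp_apply, ← push_ext_stdVertices σ, d_push (continuousOn_ext σ)
      (convex_modelSimplex _) (single_stdVertices_mem _), d_push (continuousOn_ext σ)
      (convex_modelSimplex _) (d_mem_tuples (single_stdVertices_mem _)), TupleChain.d_d, map_zero,
      LinearMap.zero_apply]
  exact LinearMap.congr_fun this c

/-! #### Subdivision of singular chains -/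

section Subdivision

open TupleChain (sdIter stepHomotopy avg On Hom)

theorem dist_stdVertices_le (n : ℕ) :
    ∀ x ∈ stdVertices n, ∀ y ∈ stdVertices n, dist x y ≤ 1 := by
  intro x hx y hy
  exact (Metric.dist_le_diam_of_mem (bounded_stdSimplex _) ((stdVertices_mem n).2 x hx)
    ((stdVertices_mem n).2 y hy)).trans diam_stdSimplex_le

/-- The tuples in the model simplex of mesh `(n/(n+1))^k`. -/
def meshTuples (k n m : ℕ) : Set (List (Fin (n + 1) → ℝ)) :=
  {l | l ∈ tuples (modelSimplex n) m ∧ ∀ x ∈ l, ∀ y ∈ l, dist x y ≤ ((n : ℝ) / (n + 1)) ^ k}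

theorem hull_stdVertices_subset (n : ℕ) : TupleChain.hull (stdVertices n) ⊆ modelSimplex n :=
  TupleChain.hull_subset (convex_modelSimplex n) (stdVertices_mem n).2

/-- The iterated subdivision of the model simplex. -/
def modelSd (k n : ℕ) : TupleChain (Fin (n + 1) → ℝ) :=
  sdIter avg k (n + 1) (Finsupp.single (stdVertices n) 1)

/-- The chain homotopy between iterated subdivisions of the model simplex. -/
def modelStep (k n : ℕ) : TupleChain (Fin (n + 1) → ℝ) :=
  stepHomotopy avg k (n + 1) (Finsupp.single (stdVertices n) 1)

theorem single_stdVertices_mem_hom (n : ℕ) :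
    Finsupp.single (stdVertices n) (1 : ℤ) ∈ Hom (Fin (n + 1) → ℝ) (n + 1) :=
  single_mem_supported_of_mem (length_stdVertices n)

theorem modelSd_mem (k n : ℕ) : modelSd k n ∈ On (meshTuples k n (n + 1)) := by
  have h1 := TupleChain.sdIter_single_mem_mesh (N := n) zero_le_one k (stdVertices n)
    (length_stdVertices n).le (dist_stdVertices_le n)
  rw [length_stdVertices, mul_one] at h1
  have h2 := TupleChain.sdIter_mem_hom avg k _ (single_stdVertices_mem_hom n)
  refine supported_mono' ?_ (mem_supported_inter h1 h2)
  exact fun l hl => ⟨⟨hl.2, fun x hx => hull_stdVertices_subset n (hl.1.1 x hx)⟩, hl.1.2⟩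

theorem modelStep_mem (k n : ℕ) : modelStep k n ∈ On (meshTuples k n (n + 2)) := by
  have h1 := TupleChain.stepHomotopy_single_mem_mesh (N := n) zero_le_one k (stdVertices n)
    (length_stdVertices n).le (dist_stdVertices_le n)
  rw [length_stdVertices, mul_one] at h1
  have h2 := TupleChain.stepHomotopy_mem_hom avg k _ (single_stdVertices_mem_hom n)
  refine supported_mono' ?_ (mem_supported_inter h1 h2)
  exact fun l hl => ⟨⟨hl.2, fun x hx => hull_stdVertices_subset n (hl.1.1 x hx)⟩, hl.1.2⟩

/-- Iterated subdivision of singular chains. -/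
def sd (k n : ℕ) : SC n X →ₗ[ℤ] SC n X := linExt fun σ => push (ext σ) n (modelSd k n)

/-- The chain homotopy between consecutive iterated subdivisions of singular chains. -/
def step (k n : ℕ) : SC n X →ₗ[ℤ] SC (n + 1) X :=
  linExt fun σ => push (ext σ) (n + 1) (modelStep k n)

theorem sd_zero (n : ℕ) (c : SC n X) : sd 0 n c = c := by
  have : sd 0 n = (LinearMap.id : SC n X →ₗ[ℤ] SC n X) := linExt_hom_ext fun σ => by
    rw [sd, linExt_single, modelSd, TupleChain.sdIter_zero, push_ext_stdVertices,
      LinearMap.id_apply]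
  exact LinearMap.congr_fun this c

theorem meshTuples_subset (k n m : ℕ) : meshTuples k n m ⊆ tuples (modelSimplex n) m :=
  fun _ h => h.1

theorem d_step_succ (k n : ℕ) (c : SC (n + 1) X) :
    d (n + 1) (step k (n + 1) c) + step k n (d n c) = sd k (n + 1) c - sd (k + 1) (n + 1) c := by
  have : d (n + 1) ∘ₗ step k (n + 1) + step k n ∘ₗ d n =
      (sd k (n + 1) - sd (k + 1) (n + 1) : SC (n + 1) X →ₗ[ℤ] SC (n + 1) X) :=
    linExt_hom_ext fun σ => by
    rw [LinearMap.add_apply, LinearMap.comp_apply, LinearMap.comp_apply, LinearMap.sub_apply, step,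
      step, linExt_push_d ext ext faceLin (convex_modelSimplex n) ext_face
        (supported_mono' (meshTuples_subset _ _ _) (modelStep_mem k n)), linExt_single,
      d_push (continuousOn_ext σ) (convex_modelSimplex _)
        (supported_mono' (meshTuples_subset _ _ _) (modelStep_mem k (n + 1))), ← map_add,
      sd, sd, linExt_single, linExt_single, ← map_sub, modelSd, modelSd,
      ← TupleChain.d_stepHomotopy avg k _ (single_stdVertices_mem_hom (n + 1)), d_stdVertices,
      map_sum]
    congr 2
    refine Finset.sum_congr rfl fun j _ => ?_
    rw [map_smul, modelStep,
      TupleChain.map_stepHomotopy avg (TupleChain.map_avg (faceLin j)) k (n + 1)]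
  exact LinearMap.congr_fun this c

theorem d_step_zero (k : ℕ) (c : SC 0 X) : d 0 (step k 0 c) = sd k 0 c - sd (k + 1) 0 c := by
  have : d 0 ∘ₗ step k 0 = (sd k 0 - sd (k + 1) 0 : SC 0 X →ₗ[ℤ] SC 0 X) :=
    linExt_hom_ext fun σ => by
    rw [LinearMap.comp_apply, LinearMap.sub_apply, step, linExt_single,
      d_push (continuousOn_ext σ) (convex_modelSimplex _)
        (supported_mono' (meshTuples_subset _ _ _) (modelStep_mem k 0)),
      sd, sd, linExt_single, linExt_single, ← map_sub, modelSd, modelSd,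
      ← TupleChain.d_stepHomotopy avg k _ (single_stdVertices_mem_hom 0)]
    congr 1
    simp [TupleChain.stepHomotopy, TupleChain.sdHomotopy, modelStep]
  exact LinearMap.congr_fun this c

theorem map_sd (f : C(X, Y)) (k n : ℕ) (c : SC n X) : map f n (sd k n c) = sd k n (map f n c) := by
  have : map f n ∘ₗ sd k n = sd k n ∘ₗ map f n := linExt_hom_ext fun σ => by
    rw [LinearMap.comp_apply, LinearMap.comp_apply, map_single, sd, sd, linExt_single,
      linExt_single, map_push (continuousOn_ext σ) (convex_modelSimplex _) f
        (supported_mono' (meshTuples_subset _ _ _) (modelSd_mem k n)), ext_map]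
  exact LinearMap.congr_fun this c

theorem map_step (f : C(X, Y)) (k n : ℕ) (c : SC n X) :
    map f (n + 1) (step k n c) = step k n (map f n c) := by
  have : map f (n + 1) ∘ₗ step k n = step k n ∘ₗ map f n := linExt_hom_ext fun σ => by
    rw [LinearMap.comp_apply, LinearMap.comp_apply, map_single, step, step, linExt_single,
      linExt_single, map_push (continuousOn_ext σ) (convex_modelSimplex _) f
        (supported_mono' (meshTuples_subset _ _ _) (modelStep_mem k n)), ext_map]
  exact LinearMap.congr_fun this c

/-- The chain homotopy between the identity and the `m`-th iterated subdivision. -/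
def multiStep (m n : ℕ) : SC n X →ₗ[ℤ] SC (n + 1) X := ∑ k ∈ Finset.range m, step k n

theorem d_multiStep_succ (m n : ℕ) (c : SC (n + 1) X) :
    d (n + 1) (multiStep m (n + 1) c) + multiStep m n (d n c) = c - sd m (n + 1) c := by
  simp only [multiStep, LinearMap.sum_apply, map_sum, ← Finset.sum_add_distrib, d_step_succ]
  rw [Finset.sum_range_sub', sd_zero]

theorem d_multiStep_zero (m : ℕ) (c : SC 0 X) : d 0 (multiStep m 0 c) = c - sd m 0 c := by
  simp only [multiStep, LinearMap.sum_apply, map_sum, d_step_zero]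
  rw [Finset.sum_range_sub', sd_zero]

end Subdivision

/-! #### Small chains -/

section Small

variable (𝒮 : Set (Set X))

/-- The chains supported on simplices whose image is contained in a member of `𝒮`. -/
abbrev Small (n : ℕ) : Submodule ℤ (SC n X) :=
  Finsupp.supported ℤ ℤ {σ : C(Simp n, X) | ∃ A ∈ 𝒮, ∀ t, σ t ∈ A}

theorem push_ext_mem_small {n : ℕ} (σ : C(Simp n, X)) (m k : ℕ)
    (h : ∀ l ∈ meshTuples k n (m + 1), ∃ A ∈ 𝒮, ∀ v ∈ TupleChain.hull l, ext σ v ∈ A)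
    {c : TupleChain (Fin (n + 1) → ℝ)} (hc : c ∈ TupleChain.On (meshTuples k n (m + 1))) :
    push (ext σ) m c ∈ Small 𝒮 m := by
  refine map_mem_of_mem_supported (fun l hl => ?_) hc
  rw [push_single (continuous_comp_aff (continuousOn_ext σ) (convex_modelSimplex n) hl.1.1 hl.1.2)]
  obtain ⟨A, hA, hlA⟩ := h l hl
  refine single_mem_supported_of_mem ⟨A, hA, fun t => hlA _ ?_⟩
  exact aff_mem (convex_convexHull _ _) hl.1.1 (fun x hx => TupleChain.subset_hull hx) t

variable (h𝒮 : ∀ x : X, ∃ A ∈ 𝒮, A ∈ nhds x)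
include h𝒮

/-- The model simplex is compact, so the preimages of the interiors of members of 𝒮 have a Lebesgue
number, which the mesh (n/(n+1))^k eventually undercuts. -/
theorem exists_mesh_small {n : ℕ} (σ : C(Simp n, X)) : ∃ k₀, ∀ k ≥ k₀, ∀ m,
    ∀ l ∈ meshTuples k n (m + 1), ∃ A ∈ 𝒮, ∀ v ∈ TupleChain.hull l, ext σ v ∈ A := by
  choose A hA hAx using h𝒮
  obtain ⟨δ, hδ, h⟩ := lebesgue_number_lemma_of_metric (s := (Set.univ : Set (Simp n)))
    (c := fun x : X => σ ⁻¹' interior (A x)) isCompact_univ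
    (fun x => isOpen_interior.preimage σ.continuous) fun t _ => by
      simp only [Set.mem_iUnion]
      exact ⟨σ t, mem_interior_iff_mem_nhds.2 (hAx _)⟩
  have hκ : (n : ℝ) / (n + 1) < 1 := by rw [div_lt_one (by positivity)]; linarith
  obtain ⟨k₀, hk₀⟩ := exists_pow_lt_of_lt_one hδ hκ
  refine ⟨k₀, fun k hk m l hl => ?_⟩
  have hlΔ : TupleChain.hull l ⊆ modelSimplex n :=
    TupleChain.hull_subset (convex_modelSimplex n) hl.1.2
  have hne : l ≠ [] := by rintro rfl; simpa using hl.1.1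
  obtain ⟨x, hx⟩ := List.exists_mem_of_ne_nil l hne
  obtain ⟨a, ha⟩ := h ⟨x, hl.1.2 x hx⟩ (Set.mem_univ _)
  refine ⟨A a, hA a, fun v hv => ?_⟩
  have hv' : (⟨v, hlΔ hv⟩ : Simp n) ∈ Metric.ball (⟨x, hl.1.2 x hx⟩ : Simp n) δ := by
    rw [Metric.mem_ball]
    refine lt_of_le_of_lt (TupleChain.dist_le_of_mem_hull hl.2 hv (TupleChain.subset_hull hx)) ?_
    exact lt_of_le_of_lt (pow_le_pow_of_le_one (by positivity) hκ.le hk) hk₀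
  have := interior_subset (ha hv')
  rwa [← ext_coe] at this

theorem exists_order (n : ℕ) (σ : C(Simp n, X)) : ∃ k₀, ∀ k ≥ k₀,
    sd k n (Finsupp.single σ 1) ∈ Small 𝒮 n ∧ step k n (Finsupp.single σ 1) ∈ Small 𝒮 (n + 1) := by
  obtain ⟨k₀, h⟩ := exists_mesh_small 𝒮 h𝒮 σ
  refine ⟨k₀, fun k hk => ⟨?_, ?_⟩⟩
  · rw [sd, linExt_single]
    exact push_ext_mem_small 𝒮 σ _ k (h k hk _) (modelSd_mem k n)
  · rw [step, linExt_single]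
    exact push_ext_mem_small 𝒮 σ _ k (h k hk _) (modelStep_mem k n)

omit h𝒮

/-- The number of subdivisions after which a simplex is small. -/
def order₀ (n : ℕ) (σ : C(Simp n, X)) : ℕ :=
  -- The least such number, not merely a chosen one: it is determined by σ and 𝒮, hence invariant
  -- under symmetries of the family.
  sInf {k₀ | ∀ k ≥ k₀, sd k n (Finsupp.single σ 1) ∈ Small 𝒮 n ∧
    step k n (Finsupp.single σ 1) ∈ Small 𝒮 (n + 1)}

/-- The number of subdivisions after which a simplex and all its faces are small. -/
def order : (n : ℕ) → C(Simp n, X) → ℕ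
  | 0, σ => order₀ 𝒮 0 σ
  | n + 1, σ => max (order₀ 𝒮 (n + 1) σ)
      (Finset.univ.sup fun j : Fin (n + 2) => order n (σ.comp (faceMap j)))

theorem order₀_le_order (n : ℕ) (σ : C(Simp n, X)) : order₀ 𝒮 n σ ≤ order 𝒮 n σ := by
  cases n with
  | zero => exact le_rfl
  | succ n => exact le_max_left _ _

theorem order_face_le (n : ℕ) (σ : C(Simp (n + 1), X)) (j : Fin (n + 2)) :
    order 𝒮 n (σ.comp (faceMap j)) ≤ order 𝒮 (n + 1) σ :=
  (Finset.le_sup (f := fun j : Fin (n + 2) => order 𝒮 n (σ.comp (faceMap j)))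
    (Finset.mem_univ j)).trans (le_max_right _ _)

theorem small_of_order_le (h𝒮 : ∀ x : X, ∃ A ∈ 𝒮, A ∈ nhds x) {n : ℕ} {σ : C(Simp n, X)} {k : ℕ}
    (hk : order 𝒮 n σ ≤ k) : sd k n (Finsupp.single σ 1) ∈ Small 𝒮 n ∧
    step k n (Finsupp.single σ 1) ∈ Small 𝒮 (n + 1) :=
  Nat.sInf_mem (exists_order 𝒮 h𝒮 n σ) k ((order₀_le_order 𝒮 n σ).trans hk)

/-- The chain homotopy between the identity and a chain map with values in small chains. -/
def smallHomotopy (n : ℕ) : SC n X →ₗ[ℤ] SC (n + 1) X :=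
  linExt fun σ => multiStep (order 𝒮 n σ) n (Finsupp.single σ 1)

/-- A chain map with values in small chains. -/
def toSmall : (n : ℕ) → SC n X →ₗ[ℤ] SC n X
  | 0 => LinearMap.id - d 0 ∘ₗ smallHomotopy 𝒮 0
  | n + 1 => LinearMap.id - d (n + 1) ∘ₗ smallHomotopy 𝒮 (n + 1) - smallHomotopy 𝒮 n ∘ₗ d n

theorem toSmall_zero (c : SC 0 X) : toSmall 𝒮 0 c = c - d 0 (smallHomotopy 𝒮 0 c) := rfl

theorem toSmall_succ (n : ℕ) (c : SC (n + 1) X) : toSmall 𝒮 (n + 1) c =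
    c - d (n + 1) (smallHomotopy 𝒮 (n + 1) c) - smallHomotopy 𝒮 n (d n c) := rfl

theorem d_toSmall (n : ℕ) (c : SC (n + 1) X) :
    d n (toSmall 𝒮 (n + 1) c) = toSmall 𝒮 n (d n c) := by
  cases n with
  | zero => rw [toSmall_succ, toSmall_zero, map_sub, map_sub, d_d, sub_zero]
  | succ n => rw [toSmall_succ, toSmall_succ, map_sub, map_sub, d_d, d_d, sub_zero, map_zero,
      sub_zero]

/-- Only steps of index at least the order of σ survive in the difference, and each of these is
small. -/
theorem multiStep_sub_mem (h𝒮 : ∀ x : X, ∃ A ∈ 𝒮, A ∈ nhds x) {n : ℕ} {σ : C(Simp n, X)} {m : ℕ}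
    (hm : order 𝒮 n σ ≤ m) : multiStep m n (Finsupp.single σ 1) -
      multiStep (order 𝒮 n σ) n (Finsupp.single σ 1) ∈ Small 𝒮 (n + 1) := by
  simp only [multiStep, LinearMap.sum_apply]
  rw [← Finset.sum_range_add_sum_Ico _ hm, add_sub_cancel_left]
  exact Submodule.sum_mem _ fun k hk => (small_of_order_le 𝒮 h𝒮 (Finset.mem_Ico.1 hk).1).2

/-- With m the order of σ, the chain is the m-th subdivision of σ plus the difference, on the
boundary of σ, of the m-step homotopy and `smallHomotopy`. Faces have order at most m, so this
difference consists of small steps. -/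
theorem toSmall_mem (h𝒮 : ∀ x : X, ∃ A ∈ 𝒮, A ∈ nhds x) (n : ℕ) (c : SC n X) :
    toSmall 𝒮 n c ∈ Small 𝒮 n := by
  refine map_mem_of_mem_supported (s := Set.univ) (fun σ _ => ?_) (by simp)
  cases n with
  | zero =>
    rw [toSmall_zero, smallHomotopy, linExt_single, d_multiStep_zero, sub_sub_cancel]
    exact (small_of_order_le 𝒮 h𝒮 le_rfl).1
  | succ n =>
    have h1 := d_multiStep_succ (order 𝒮 (n + 1) σ) n (Finsupp.single σ 1)
    have h2 : toSmall 𝒮 (n + 1) (Finsupp.single σ 1) =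
        sd (order 𝒮 (n + 1) σ) (n + 1) (Finsupp.single σ 1) +
        (multiStep (order 𝒮 (n + 1) σ) n (d n (Finsupp.single σ 1)) -
          smallHomotopy 𝒮 n (d n (Finsupp.single σ 1))) := by
      rw [toSmall_succ, smallHomotopy, linExt_single]
      have h3 : sd (order 𝒮 (n + 1) σ) (n + 1) (Finsupp.single σ 1) = Finsupp.single σ 1 -
          (d (n + 1) (multiStep (order 𝒮 (n + 1) σ) (n + 1) (Finsupp.single σ 1)) +
            multiStep (order 𝒮 (n + 1) σ) n (d n (Finsupp.single σ 1))) := by rw [h1]; abel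
      rw [h3]
      abel
    rw [h2]
    refine Submodule.add_mem _ (small_of_order_le 𝒮 h𝒮 le_rfl).1 ?_
    rw [d_single, map_sum, map_sum, ← Finset.sum_sub_distrib]
    refine Submodule.sum_mem _ fun j _ => ?_
    rw [map_smul, map_smul, ← smul_sub, smallHomotopy, linExt_single]
    exact Submodule.smul_mem _ _ (multiStep_sub_mem 𝒮 h𝒮 (order_face_le 𝒮 n σ j))

/-! ### Equivariance of the passage to small chains. -/

section Equivariance

variable {𝒮}
variable {f f' : C(X, X)} (hf : ∀ A ∈ 𝒮, f '' A ∈ 𝒮) (hf' : ∀ A ∈ 𝒮, f' '' A ∈ 𝒮)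
  (hff' : f'.comp f = ContinuousMap.id X)

theorem map_mem_small (hf : ∀ A ∈ 𝒮, f '' A ∈ 𝒮) {n : ℕ} {c : SC n X} (hc : c ∈ Small 𝒮 n) :
    map f n c ∈ Small 𝒮 n := by
  refine map_mem_of_mem_supported (fun σ hσ => ?_) hc
  obtain ⟨A, hA, hσA⟩ := hσ
  rw [map_single]
  exact single_mem_supported_of_mem ⟨_, hf A hA, fun t => Set.mem_image_of_mem _ (hσA t)⟩

include hf hf' hff' in
theorem map_mem_small_iff {n : ℕ} {c : SC n X} : map f n c ∈ Small 𝒮 n ↔ c ∈ Small 𝒮 n := by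
  refine ⟨fun h => ?_, map_mem_small hf⟩
  have := map_mem_small hf' h
  rwa [map_comp, hff', map_id] at this

include hf hf' hff' in
theorem order_comp (n : ℕ) (σ : C(Simp n, X)) : order 𝒮 n (f.comp σ) = order 𝒮 n σ := by
  have h0 (n : ℕ) (σ : C(Simp n, X)) : order₀ 𝒮 n (f.comp σ) = order₀ 𝒮 n σ := by
    simp only [order₀, ← map_single, ← map_sd, ← map_step, map_mem_small_iff hf hf' hff']
  induction n with
  | zero => exact h0 0 σ
  | succ n ih => simp only [order, h0, ContinuousMap.comp_assoc, ih]

include hf hf' hff' in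
theorem map_smallHomotopy (n : ℕ) (c : SC n X) :
    map f (n + 1) (smallHomotopy 𝒮 n c) = smallHomotopy 𝒮 n (map f n c) := by
  have : map f (n + 1) ∘ₗ smallHomotopy 𝒮 n = smallHomotopy 𝒮 n ∘ₗ map f n :=
    linExt_hom_ext fun σ => by
    simp only [LinearMap.comp_apply, map_single, smallHomotopy, linExt_single,
      order_comp hf hf' hff', multiStep, LinearMap.sum_apply, map_sum, map_step]
  exact LinearMap.congr_fun this c

include hf hf' hff' in
theorem map_toSmall (n : ℕ) (c : SC n X) :
    map f n (toSmall 𝒮 n c) = toSmall 𝒮 n (map f n c) := by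
  cases n with
  | zero => simp only [toSmall_zero, map_sub, map_d, map_smallHomotopy hf hf' hff']
  | succ n => simp only [toSmall_succ, map_sub, map_d, map_smallHomotopy hf hf' hff']

end Equivariance

end Small

end SC

namespace SC

variable {X Y : Type*} [TopologicalSpace X] [TopologicalSpace Y]

/-! #### Homotopy invariance -/

section Homotopy

open TupleChain (On prism)

/-- A homotopy on a singular simplex, as a function on an ambient vector space. -/
def extHomotopy (H : C(X × unitInterval, Y)) {n : ℕ} (σ : C(Simp n, X))
    (v : (Fin (n + 1) → ℝ) × ℝ) : Y :=
  H (ext σ v.1, Set.projIcc 0 1 zero_le_one v.2)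

theorem continuousOn_extHomotopy (H : C(X × unitInterval, Y)) {n : ℕ} (σ : C(Simp n, X)) :
    ContinuousOn (extHomotopy H σ) (modelSimplex n ×ˢ Set.univ) := by
  refine H.continuous.comp_continuousOn (ContinuousOn.prodMk ?_ ?_)
  · exact (continuousOn_ext σ).comp continuousOn_fst fun v hv => hv.1
  · exact (continuous_projIcc.comp continuous_snd).continuousOn

theorem convex_prismModel (n : ℕ) :
    Convex ℝ (modelSimplex n ×ˢ (Set.univ : Set ℝ)) := (convex_modelSimplex n).prod convex_univ

/-- The face inclusion of the prism. -/
def prismFace {n : ℕ} (j : Fin (n + 2)) : ((Fin (n + 1) → ℝ) × ℝ) →ₗ[ℝ] ((Fin (n + 2) → ℝ) × ℝ) :=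
  (faceLin j).prodMap LinearMap.id

theorem extHomotopy_face (H : C(X × unitInterval, Y)) {n : ℕ} (σ : C(Simp (n + 1), X))
    (j : Fin (n + 2)) : Set.EqOn (extHomotopy H (σ.comp (faceMap j)))
      (extHomotopy H σ ∘ prismFace j) (modelSimplex n ×ˢ Set.univ) := by
  intro v hv
  have := ext_face σ j hv.1
  simp only [extHomotopy, this]
  rfl

/-- The prism over the model simplex. -/
def modelPrism (n : ℕ) : TupleChain ((Fin (n + 1) → ℝ) × ℝ) :=
  prism (fun v => (v, 0)) (fun v => (v, 1)) (Finsupp.single (stdVertices n) 1)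

theorem modelPrism_mem (n : ℕ) :
    modelPrism n ∈ On (tuples (modelSimplex n ×ˢ Set.univ) (n + 2)) := by
  refine supported_mono' ?_ (TupleChain.prism_single_mem _ _ (stdVertices n))
  rintro l ⟨hl, h⟩
  refine ⟨by rw [hl, length_stdVertices], fun y hy => ?_⟩
  obtain ⟨x, hx, rfl | rfl⟩ := h y hy <;> exact ⟨(stdVertices_mem n).2 x hx, Set.mem_univ _⟩

theorem map_modelPrism {n : ℕ} (j : Fin (n + 2)) : TupleChain.map (prismFace j) (modelPrism n) =
    prism (fun v => (v, 0)) (fun v => (v, 1))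
      (TupleChain.map (faceLin j) (Finsupp.single (stdVertices n) 1)) := by
  rw [modelPrism, TupleChain.map_prism, TupleChain.prism_map]
  rfl

theorem push_slice (H : C(X × unitInterval, Y)) {n : ℕ} (σ : C(Simp n, X)) (s : unitInterval) :
    push (extHomotopy H σ) n (TupleChain.map (fun v => (v, (s : ℝ)))
      (Finsupp.single (stdVertices n) 1)) =
    Finsupp.single ((H.comp (ContinuousMap.prodMk (.id X) (.const X s))).comp σ) 1 := by
  have h1 (t : Simp n) : aff (V := (Fin (n + 1) → ℝ) × ℝ) n
      ((stdVertices n).map fun v => (v, (s : ℝ))) t = (t.1, (s : ℝ)) := by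
    have h2 : aff (V := (Fin (n + 1) → ℝ) × ℝ) n ((stdVertices n).map fun v => (v, (s : ℝ))) t =
        ∑ i : Fin (n + 1), t i • ((Pi.single i 1, (s : ℝ)) : (Fin (n + 1) → ℝ) × ℝ) := by
      unfold aff
      refine Finset.sum_congr rfl fun i _ => ?_
      rw [List.getD_eq_getElem _ _ (by rw [List.length_map, length_stdVertices]; exact i.2),
        List.getElem_map, getElem_stdVertices]
    rw [h2]
    refine Prod.ext ?_ ?_
    · refine Eq.trans ?_ (aff_stdVertices n t)
      rw [aff, Prod.fst_sum]
      refine Finset.sum_congr rfl fun i _ => ?_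
      rw [List.getD_eq_getElem _ _ (by rw [length_stdVertices]; exact i.2), getElem_stdVertices]
      rfl
    · rw [Prod.snd_sum]
      simp only [Prod.smul_mk, smul_eq_mul, ← Finset.sum_mul]
      rw [stdSimplex.sum_eq_one, one_mul]
  have h2 : extHomotopy H σ ∘ aff n ((stdVertices n).map fun v => (v, (s : ℝ))) =
      fun t => H (σ t, s) := by
    funext t
    rw [Function.comp_apply, h1, extHomotopy, ext_coe, Set.projIcc_val]
  rw [TupleChain.map_single, push_single (by rw [h2]; fun_prop)]
  congr 1
  ext t
  exact congrFun h2 t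

/-- The chain homotopy induced by a homotopy. -/
def hop (H : C(X × unitInterval, Y)) (n : ℕ) : SC n X →ₗ[ℤ] SC (n + 1) Y :=
  linExt fun σ => push (extHomotopy H σ) (n + 1) (modelPrism n)

/-- A slice of a homotopy. -/
def slice (H : C(X × unitInterval, Y)) (s : unitInterval) : C(X, Y) :=
  H.comp (ContinuousMap.prodMk (.id X) (.const X s))

@[simp] theorem slice_apply (H : C(X × unitInterval, Y)) (s : unitInterval) (x : X) :
    slice H s x = H (x, s) := rfl

theorem push_d_modelPrism (H : C(X × unitInterval, Y)) {n : ℕ} (σ : C(Simp n, X)) :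
    push (extHomotopy H σ) n (TupleChain.d (modelPrism n)) +
      push (extHomotopy H σ) n (prism (fun v => (v, 0)) (fun v => (v, 1))
        (TupleChain.d (Finsupp.single (stdVertices n) 1))) =
      Finsupp.single ((slice H 1).comp σ) 1 - Finsupp.single ((slice H 0).comp σ) 1 := by
  have h0 := push_slice H σ 0
  have h1 := push_slice H σ 1
  rw [Set.Icc.coe_zero] at h0
  rw [Set.Icc.coe_one] at h1
  rw [← map_add, modelPrism, TupleChain.d_prism, map_sub, h0, h1]
  rfl

theorem d_hop_succ (H : C(X × unitInterval, Y)) (n : ℕ) (c : SC (n + 1) X) :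
    d (n + 1) (hop H (n + 1) c) + hop H n (d n c) =
      map (slice H 1) (n + 1) c - map (slice H 0) (n + 1) c := by
  have : d (n + 1) ∘ₗ hop H (n + 1) + hop H n ∘ₗ d n =
      map (slice H 1) (n + 1) - map (slice H 0) (n + 1) := linExt_hom_ext fun σ => by
    rw [LinearMap.add_apply, LinearMap.comp_apply, LinearMap.comp_apply, LinearMap.sub_apply, hop,
      hop, linExt_push_d (extHomotopy H) (extHomotopy H) prismFace (convex_prismModel n)
        (extHomotopy_face H) (modelPrism_mem n), linExt_single,
      d_push (continuousOn_extHomotopy H σ) (convex_prismModel _) (modelPrism_mem (n + 1)),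
      map_single, map_single, ← push_d_modelPrism, d_stdVertices, map_sum (prism _ _)]
    congr 2
    refine Finset.sum_congr rfl fun j _ => ?_
    rw [map_smul, map_modelPrism]
  exact LinearMap.congr_fun this c

theorem d_hop_zero (H : C(X × unitInterval, Y)) (c : SC 0 X) :
    d 0 (hop H 0 c) = map (slice H 1) 0 c - map (slice H 0) 0 c := by
  have : d 0 ∘ₗ hop H 0 = map (slice H 1) 0 - map (slice H 0) 0 := linExt_hom_ext fun σ => by
    rw [LinearMap.comp_apply, LinearMap.sub_apply, hop, linExt_single,
      d_push (continuousOn_extHomotopy H σ) (convex_prismModel _) (modelPrism_mem 0),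
      map_single, map_single, ← push_d_modelPrism]
    -- The boundary of a single vertex is the empty tuple, on which the prism vanishes.
    simp [stdVertices, prism, TupleChain.prismTuple]
  exact LinearMap.congr_fun this c

theorem map_hop (H : C(X × unitInterval, X)) (f : C(X, X))
    (hf : ∀ x s, H (f x, s) = f (H (x, s))) (n : ℕ) (c : SC n X) :
    map f (n + 1) (hop H n c) = hop H n (map f n c) := by
  have : map f (n + 1) ∘ₗ hop H n = hop H n ∘ₗ map f n := linExt_hom_ext fun σ => by
    rw [LinearMap.comp_apply, LinearMap.comp_apply, map_single, hop, linExt_single, linExt_single,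
      map_push (continuousOn_extHomotopy H σ) (convex_prismModel _) f (modelPrism_mem n)]
    congr 2
    funext v
    rw [extHomotopy, ext_map, Function.comp_apply, Function.comp_apply, hf]
    rfl
  exact LinearMap.congr_fun this c

end Homotopy

/-! #### Cycles in contractible sets -/

/-- Cycles; in degree zero, those of the augmented complex. -/
def IsCycle : (n : ℕ) → SC n X → Prop
  | 0, z => TupleChain.d (vert 0 z) = 0
  | n + 1, z => d n z = 0

theorem IsCycle.d_vert_eq_zero {n : ℕ} {z : SC n X} (hz : IsCycle n z) :
    TupleChain.d (vert n z) = 0 := by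
  cases n with
  | zero => exact hz
  | succ n => rw [d_vert, show d n z = 0 from hz, map_zero]

/-- Up to a boundary, the contraction turns the cycle into a chain of constant simplices. This is
the push of a cycle of tuples at one point, which a cone bounds; in degree 0 the augmentation
condition makes the tuples a cycle. -/
theorem exists_eq_d_of_contractible [ContractibleSpace X] {n : ℕ} {z : SC n X} (hz : IsCycle n z) :
    ∃ w, d n w = z := by
  obtain ⟨x₀, ⟨H⟩⟩ := id_nullhomotopic X
  let H' : C(X × unitInterval, X) := H.toContinuousMap.comp ContinuousMap.prodSwap
  have h0 : slice H' 0 = ContinuousMap.id X := by ext x; simp [H']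
  have h1 : slice H' 1 = ContinuousMap.const X x₀ := by ext x; simp [H']
  have h2 : d n (hop H' n z) = map (ContinuousMap.const X x₀) n z - z := by
    cases n with
    | zero => rw [d_hop_zero, h0, h1, map_id]
    | succ n =>
      have := d_hop_succ H' n z
      rwa [show d n z = 0 from hz, map_zero, add_zero, h0, h1, map_id] at this
  let c : TupleChain ℝ := TupleChain.map (fun _ => 0) (vert n z)
  have hc : TupleChain.d c = 0 := by
    rw [← TupleChain.map_d, hz.d_vert_eq_zero, map_zero]
  have hcm : c ∈ TupleChain.On (tuples Set.univ (n + 1)) := by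
    refine TupleChain.map_mem ?_ (vert_mem_hom n z)
    exact fun l hl => ⟨by simpa using hl, by simp⟩
  have h3 : push (fun _ : ℝ => x₀) n c = map (ContinuousMap.const X x₀) n z := by
    have : push (fun _ : ℝ => x₀) n ∘ₗ TupleChain.map (fun _ => 0) ∘ₗ vert n =
        map (ContinuousMap.const X x₀) n := linExt_hom_ext fun σ => by
      simp only [LinearMap.comp_apply, vert_single, TupleChain.map_single, map_single]
      rw [push_single (by exact continuous_const)]
      rfl
    exact LinearMap.congr_fun this z
  have h4 : d n (push (fun _ : ℝ => x₀) (n + 1) (TupleChain.cone 0 c)) =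
      map (ContinuousMap.const X x₀) n z := by
    rw [d_push continuousOn_const convex_univ (s := Set.univ), TupleChain.d_cone, hc, map_zero,
      sub_zero, h3]
    refine TupleChain.cone_mem ?_ hcm
    exact fun l hl => ⟨by simp [hl.1], by simp⟩
  exact ⟨push (fun _ : ℝ => x₀) (n + 1) (TupleChain.cone 0 c) - hop H' n z, by
    rw [map_sub, h4, h2, sub_sub_cancel]⟩

/-- The inclusion of a subset. -/
def incl (A : Set X) : C(A, X) := ⟨Subtype.val, continuous_subtype_val⟩

theorem exists_map_incl {n : ℕ} {A : Set X} {z : SC n X} (hz : z ∈ In n A) :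
    ∃ z', map (incl A) n z' = z := by
  have : z ∈ LinearMap.range (map (incl A) n) :=
    map_mem_of_mem_supported (f := LinearMap.id) (W := LinearMap.range (map (incl A) n))
      (s := {σ : C(Simp n, X) | ∀ t, σ t ∈ A})
      (fun σ hσ => ⟨Finsupp.single ⟨fun t => ⟨σ t, hσ t⟩, by fun_prop⟩ 1, by
        rw [map_single]; rfl⟩) hz
  exact this

theorem map_incl_mem {n : ℕ} {A : Set X} (z : SC n A) : map (incl A) n z ∈ In n A := by
  refine map_mem_of_mem_supported (s := Set.univ) (fun σ _ => ?_) (by simp)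
  rw [map_single]
  exact single_mem_supported_of_mem fun t => (σ t).2

theorem incl_comp_injective (n : ℕ) (A : Set X) :
    Function.Injective fun σ : C(Simp n, A) => (incl A).comp σ := by
  intro σ τ h
  ext t
  exact DFunLike.congr_fun h t

theorem map_incl_injective (n : ℕ) (A : Set X) : Function.Injective (map (incl A) n) := by
  have : map (incl A) n = Finsupp.lmapDomain ℤ ℤ fun σ : C(Simp n, A) => (incl A).comp σ :=
    linExt_hom_ext fun σ => by simp
  rw [this]
  exact Finsupp.mapDomain_injective (incl_comp_injective n A)

theorem map_tuple_injective {E E' : Type*} {f : E → E'} (hf : Function.Injective f) :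
    Function.Injective (TupleChain.map f) := by
  have : TupleChain.map f = Finsupp.lmapDomain ℤ ℤ (List.map f) := linExt_hom_ext fun l => by simp
  rw [this]
  exact Finsupp.mapDomain_injective (List.map_injective_iff.2 hf)

/-- Cycles in a contractible set bound in that set. -/
theorem exists_mem_d_eq {A : Set X} [ContractibleSpace A] {n : ℕ} {z : SC n X} (hz : IsCycle n z)
    (hzA : z ∈ In n A) : ∃ w ∈ In (n + 1) A, d n w = z := by
  obtain ⟨z, rfl⟩ := exists_map_incl hzA
  have hz' : IsCycle n z := by
    cases n with
    | zero =>
      refine map_tuple_injective (f := incl A) Subtype.val_injective ?_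
      rw [map_zero, TupleChain.map_d, ← vert_map]
      exact hz
    | succ n =>
      refine map_incl_injective n A ?_
      rw [map_zero, map_d]
      exact hz
  obtain ⟨w, rfl⟩ := exists_eq_d_of_contractible hz'
  exact ⟨map (incl A) (n + 1) w, map_incl_mem w, (map_d _ _ _).symm⟩

end SC

/-! ### Equivariant choices and acyclic carriers -/

/-- Equivariant choice of solutions of an invariant problem, over a free action. -/
theorem exists_equivariant {G B M : Type*} [Group G] [Nonempty M] (β : G → B → B) (μ : G → M → M)
    (hβ1 : ∀ b, β 1 b = b) (hβ : ∀ g h b, β (g * h) b = β g (β h b))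
    (hμ : ∀ g h m, μ (g * h) m = μ g (μ h m)) {P : Set B}
    (hP : ∀ g, ∀ b ∈ P, β g b ∈ P) (hfree : ∀ g, ∀ b ∈ P, β g b = b → g = 1)
    (R : B → M → Prop) (hR : ∀ g, ∀ b ∈ P, ∀ m, R b m → R (β g b) (μ g m))
    (hex : ∀ b ∈ P, ∃ m, R b m) :
    ∃ f : B → M, ∀ b ∈ P, R b (f b) ∧ ∀ g, f (β g b) = μ g (f b) := by
  classical
  let : MulAction G P :=
    { smul := fun g b => ⟨β g b.1, hP g b.1 b.2⟩
      one_smul := fun b => Subtype.ext (hβ1 b.1)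
      mul_smul := fun g h b => Subtype.ext (hβ g h b.1) }
  have hsm (g : G) (b : P) : (g • b).1 = β g b.1 := rfl
  have hfree' (g h : G) (b : P) (hgh : g • b = h • b) : g = h := by
    have h1 : (h⁻¹ * g) • b = b := by rw [mul_smul, hgh, inv_smul_smul]
    have h2 := hfree _ b.1 b.2 (congrArg Subtype.val h1)
    exact (inv_mul_eq_one.1 h2).symm
  choose m hm using hex
  -- Solve the problem at one representative of each orbit and translate. By freeness the
  -- translating element `γ b` is unique, so the translation is well defined and equivariant.
  let rep : P → P := fun b => Quotient.out (Quotient.mk (MulAction.orbitRel G P) b)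
  have hrep (b : P) : ∃ g : G, g • rep b = b := by
    have : MulAction.orbitRel G P (rep b) b := Quotient.exact (Quotient.out_eq _)
    exact MulAction.mem_orbit_iff.1 ((MulAction.orbitRel G P).symm this)
  choose γ hγ using hrep
  have hrep' (g : G) (b : P) : rep (g • b) = rep b := by
    have : Quotient.mk (MulAction.orbitRel G P) (g • b) = Quotient.mk _ b :=
      Quotient.sound (MulAction.mem_orbit b g)
    simp only [rep, this]
  have hγ' (g : G) (b : P) : γ (g • b) = g * γ b := by
    refine hfree' _ _ (rep b) ?_
    rw [mul_smul, hγ, ← hrep' g b, hγ]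
  let f₀ : P → M := fun b => μ (γ b) (m (rep b).1 (rep b).2)
  refine ⟨fun b => if hb : b ∈ P then f₀ ⟨b, hb⟩ else Classical.arbitrary M, fun b hb => ?_⟩
  have h0 (g : G) : f₀ (g • ⟨b, hb⟩) = μ g (f₀ ⟨b, hb⟩) := by
    simp only [f₀, hγ', hμ]
    congr 3
    exact (congrArg Subtype.val (hrep' g ⟨b, hb⟩))
  refine ⟨?_, fun g => ?_⟩ <;> beta_reduce
  · rw [dif_pos hb]
    have h1 := hR (γ ⟨b, hb⟩) _ (rep ⟨b, hb⟩).2 _ (hm _ (rep ⟨b, hb⟩).2)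
    have h2 : β (γ ⟨b, hb⟩) (rep ⟨b, hb⟩).1 = b := congrArg Subtype.val (hγ ⟨b, hb⟩)
    rwa [h2] at h1
  · rw [dif_pos hb, dif_pos (hP g b hb)]
    exact h0 g

/-- Multiplication by a group element, as a continuous map. -/
def smulMap {G X : Type*} [TopologicalSpace X] [SMul G X] [ContinuousConstSMul G X] (g : G) :
    C(X, X) := ⟨fun x => g • x, continuous_const_smul g⟩

@[simp] theorem smulMap_apply {G X : Type*} [TopologicalSpace X] [SMul G X]
    [ContinuousConstSMul G X] (g : G) (x : X) : smulMap g x = g • x := rfl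

section SMulMap

variable {G X : Type*} [Group G] [TopologicalSpace X] [MulAction G X] [ContinuousConstSMul G X]

theorem smulMap_one : smulMap (1 : G) = ContinuousMap.id X := by ext x; simp

theorem smulMap_mul (g h : G) : smulMap (g * h) = (smulMap g).comp (smulMap h : C(X, X)) := by
  ext x; simp [mul_smul]

theorem smulMap_inv_comp (g : G) : (smulMap g⁻¹).comp (smulMap g) = ContinuousMap.id X := by
  ext x; simp

end SMulMap

namespace SC

/-- A family of sets is a star refinement of another one, by contractible sets: a member and all
the members that meet it lie in a single contractible member of the coarser family. -/
def StarRefines {X : Type*} [TopologicalSpace X] (𝒜 ℬ : Set (Set X)) : Prop :=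
  ∀ W ∈ 𝒜, ∀ 𝒞 ⊆ 𝒜, (∀ A ∈ 𝒞, (A ∩ W).Nonempty) →
    ∃ U ∈ ℬ, ContractibleSpace U ∧ W ⊆ U ∧ ∀ A ∈ 𝒞, A ⊆ U

theorem map_mem_in {X : Type*} [TopologicalSpace X] {f : C(X, X)} {n : ℕ} {A : Set X} {c : SC n X}
    (hc : c ∈ In n A) : map f n c ∈ In n (f '' A) := by
  refine map_mem_of_mem_supported (fun σ hσ => ?_) hc
  rw [map_single]
  exact single_mem_supported_of_mem fun t => ⟨_, hσ t, rfl⟩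

theorem in_mono {X : Type*} [TopologicalSpace X] {n : ℕ} {A A' : Set X} (h : A ⊆ A')
    {c : SC n X} (hc : c ∈ In n A) : c ∈ In n A' := by
  refine supported_mono' ?_ hc
  exact fun σ hσ t => h (hσ t)

section Carrier

variable {G X : Type*} [Group G] [TopologicalSpace X] [MulAction G X] [ContinuousConstSMul G X]


/-- Data for the method of acyclic carriers: an equivariant chain map `e` defined on a complex
with free bases, and traces of the basis elements. -/
structure CarrierData (G X : Type*) [Group G] [TopologicalSpace X] [MulAction G X]
    [ContinuousConstSMul G X] (B : ℕ → Type*) (N : ℕ) where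
  β : ∀ n, G → B n → B n
  β_one : ∀ n b, β n 1 b = b
  β_mul : ∀ n g h b, β n (g * h) b = β n g (β n h b)
  -- The basis elements small enough for the construction, stable under faces and under the group;
  -- nothing is bounded outside this set.
  P : ∀ n, Set (B n)
  β_mem : ∀ n g, ∀ b ∈ P n, β n g b ∈ P n
  free : ∀ n g, ∀ b ∈ P n, β n g b = b → g = 1
  bd : ∀ n, B (n + 1) → (B n →₀ ℤ)
  bd_bd : ∀ n b, linExt (bd n) (bd (n + 1) b) = 0
  bd_β : ∀ n g b, bd n (β (n + 1) g b) = Finsupp.lmapDomain ℤ ℤ (β n g) (bd n b)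
  trace : ∀ n, B n → Set X
  trace_β : ∀ n g b, trace n (β n g b) = smulMap g '' trace n b
  bd_mem : ∀ n, ∀ b ∈ P (n + 1), bd n b ∈
    Finsupp.supported ℤ ℤ {b' | b' ∈ P n ∧ (trace n b' ∩ trace (n + 1) b).Nonempty}
  e : ∀ n, B n → SC n X
  e_β : ∀ n g, ∀ b ∈ P n, e n (β n g b) = map (smulMap g) n (e n b)
  isCycle : ∀ b ∈ P 0, IsCycle 0 (e 0 b)
  d_e : ∀ n, n + 1 < N → ∀ b ∈ P (n + 1), d n (e (n + 1) b) = linExt (e n) (bd n b)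
  fam : ℕ → Set (Set X)
  fam_smul : ∀ n (g : G), ∀ A ∈ fam n, smulMap g '' A ∈ fam n
  star : ∀ n < N, StarRefines (fam n) (fam (n + 1))
  -- The value of `e` may leave the set W around the trace, but only into a set E of the same scale
  -- that meets W. This room is needed because `e` may involve realizations of tuples.
  e_mem : ∀ n < N, ∀ b ∈ P n, ∃ W ∈ fam n, trace n b ⊆ W ∧ ∃ E ∈ fam n, (E ∩ W).Nonempty ∧
    e n b ∈ In n (W ∪ E)

variable {B : ℕ → Type*} {N : ℕ} (D : CarrierData G X B N)

/-- The properties of one degree of the homotopy constructed by acyclic carriers. -/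
structure CarrierData.IsLift (n : ℕ) (k : B n → SC (n + 1) X) : Prop where
  smul : ∀ g, ∀ b ∈ D.P n, k (D.β n g b) = map (smulMap g) (n + 1) (k b)
  mem : n < N → ∀ b ∈ D.P n, ∃ U ∈ D.fam (n + 1), D.trace n b ⊆ U ∧ k b ∈ In (n + 1) U
  d_bd : n + 1 < N → ∀ b ∈ D.P (n + 1), d n (linExt k (D.bd n b)) = linExt (D.e n) (D.bd n b)

include D in
-- Each z(b) bounds inside its contractible set. The choice of bounding chains is made on orbit
-- representatives and spread by the free action.
theorem CarrierData.exists_step {n : ℕ} (z : B n → SC n X)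
    (hz : ∀ g, ∀ b ∈ D.P n, z (D.β n g b) = map (smulMap g) n (z b))
    (hc : ∀ b ∈ D.P n, IsCycle n (z b))
    (hU : ∀ b ∈ D.P n, ∃ U ∈ D.fam (n + 1), ContractibleSpace U ∧ D.trace n b ⊆ U ∧ z b ∈ In n U) :
    ∃ k : B n → SC (n + 1) X, ∀ b ∈ D.P n, (d n (k b) = z b ∧
      ∃ U ∈ D.fam (n + 1), D.trace n b ⊆ U ∧ k b ∈ In (n + 1) U) ∧
      ∀ g, k (D.β n g b) = map (smulMap g) (n + 1) (k b) := by
  refine exists_equivariant (D.β n) (fun g => map (smulMap g) (n + 1)) (D.β_one n) (D.β_mul n)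
    (fun g h m => by rw [smulMap_mul, map_comp]) (D.β_mem n) (D.free n)
    (fun b k => d n k = z b ∧ ∃ U ∈ D.fam (n + 1), D.trace n b ⊆ U ∧ k ∈ In (n + 1) U) ?_ ?_
  · rintro g b hb m ⟨h1, U, hU, h2, h3⟩
    refine ⟨by rw [← map_d, h1, hz g b hb], _, D.fam_smul _ g U hU, ?_, map_mem_in h3⟩
    rw [D.trace_β]
    exact Set.image_mono h2
  · intro b hb
    obtain ⟨U, h1, h2, h3, h4⟩ := hU b hb
    obtain ⟨w, hw, hw'⟩ := exists_mem_d_eq (hc b hb) h4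
    exact ⟨w, hw', U, h1, h3, hw⟩

theorem linExt_β {n : ℕ} {M : Type*} [AddCommGroup M] (g : G) (f f' : B n → M)
    (c : B n →₀ ℤ) (hf : ∀ b ∈ D.P n, f (D.β n g b) = f' b) (hc : c ∈ Finsupp.supported ℤ ℤ (D.P n)) :
    linExt f (Finsupp.lmapDomain ℤ ℤ (D.β n g) c) = linExt f' c := by
  refine eq_of_mem_supported (f := linExt f ∘ₗ Finsupp.lmapDomain ℤ ℤ (D.β n g)) (fun b hb => ?_) hc
  simp [hf b hb]

theorem CarrierData.bd_mem' (n : ℕ) {b : B (n + 1)} (hb : b ∈ D.P (n + 1)) :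
    D.bd n b ∈ Finsupp.supported ℤ ℤ (D.P n) := by
  refine supported_mono' ?_ (D.bd_mem n b hb)
  exact fun b' h => h.1

theorem CarrierData.exists_zero : ∃ k : B 0 → SC 1 X, D.IsLift 0 k ∧
    (0 < N → ∀ b ∈ D.P 0, d 0 (k b) = D.e 0 b) := by
  by_cases hN : 0 < N
  · obtain ⟨k, hk⟩ := D.exists_step (D.e 0) (D.e_β 0) D.isCycle fun b hb => by
      obtain ⟨W, hW, hbW, E, hE, hEW, he⟩ := D.e_mem 0 hN b hb
      obtain ⟨U, hU, hc, hWU, hEU⟩ := D.star 0 hN W hW {E} (by simpa) (by simpa)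
      exact ⟨U, hU, hc, hbW.trans hWU, in_mono (Set.union_subset hWU (hEU E rfl)) he⟩
    refine ⟨k, ⟨fun g b hb => (hk b hb).2 g, fun _ b hb => (hk b hb).1.2, fun _ b hb => ?_⟩,
      fun _ b hb => (hk b hb).1.1⟩
    refine eq_of_mem_supported (f := d 0 ∘ₗ linExt k) (fun b' hb' => ?_) (D.bd_mem' 0 hb)
    simp [(hk b' hb').1.1]
  -- From degree N on nothing is required beyond equivariance, and zero will do.
  · exact ⟨0, ⟨by simp, by omega, by omega⟩, by omega⟩

/-- The chain e(b) - k(∂b) is a cycle, and it must lie in one contractible set. The traces of the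
faces meet the trace of b, so the sets that carry k on the faces all meet W, and the star refinement
encloses them together with W. -/
theorem CarrierData.exists_succ (n : ℕ) (k : B n → SC (n + 1) X) (hk : D.IsLift n k) :
    ∃ k' : B (n + 1) → SC (n + 2) X, D.IsLift (n + 1) k' ∧
      (n + 1 < N → ∀ b ∈ D.P (n + 1),
        d (n + 1) (k' b) = D.e (n + 1) b - linExt k (D.bd n b)) := by
  by_cases hN : n + 1 < N
  · obtain ⟨k', hk'⟩ := D.exists_step (fun b => D.e (n + 1) b - linExt k (D.bd n b))
      (fun g b hb => by
        rw [map_sub, D.e_β _ g b hb, D.bd_β, linExt_β D g k (fun b => map (smulMap g) _ (k b)) _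
          (fun b hb => hk.smul g b hb) (D.bd_mem' n hb)]
        congr 1
        exact eq_of_mem_supported (g := map (smulMap g) _ ∘ₗ linExt k) (fun b' hb' => by simp)
          (D.bd_mem' n hb))
      (fun b hb => by
        change d n _ = 0
        rw [map_sub, D.d_e n hN b hb, hk.d_bd hN b hb, sub_self])
      (fun b hb => by
        obtain ⟨W, hW, hbW, E, hE, hEW, he⟩ := D.e_mem _ hN b hb
        obtain ⟨U, hU, hc, hWU, hEU⟩ := D.star _ hN W hW
          {A | A ∈ D.fam (n + 1) ∧ (A ∩ W).Nonempty} (fun A hA => hA.1) (fun A hA => hA.2)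
        refine ⟨U, hU, hc, hbW.trans hWU, Submodule.sub_mem _
          (in_mono (Set.union_subset hWU (hEU E ⟨hE, hEW⟩)) he) ?_⟩
        refine map_mem_of_mem_supported ?_ (D.bd_mem n b hb)
        rintro b' ⟨hb', x, hx, hx'⟩
        obtain ⟨A, hA, hA', hA''⟩ := hk.mem (by omega) b' hb'
        rw [linExt_single]
        exact in_mono (hEU A ⟨hA, x, hA' hx, hbW hx'⟩) hA'')
    refine ⟨k', ⟨fun g b hb => (hk' b hb).2 g, fun _ b hb => (hk' b hb).1.2, fun _ b hb => ?_⟩,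
      fun _ b hb => (hk' b hb).1.1⟩
    have h1 : d (n + 1) (linExt k' (D.bd (n + 1) b)) =
        linExt (D.e (n + 1)) (D.bd (n + 1) b) - linExt k (linExt (D.bd n) (D.bd (n + 1) b)) := by
      refine eq_of_mem_supported (f := d (n + 1) ∘ₗ linExt k')
        (g := linExt (D.e (n + 1)) - linExt k ∘ₗ linExt (D.bd n)) (fun b' hb' => ?_)
        (D.bd_mem' _ hb)
      simp [(hk' b' hb').1.1]
    rw [h1, D.bd_bd, map_zero, sub_zero]
  · exact ⟨0, ⟨by simp, by omega, by omega⟩, by omega⟩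

/-- The method of acyclic carriers. -/
theorem CarrierData.exists_homotopy : ∃ k : ∀ n, B n → SC (n + 1) X,
    (∀ n, ∀ g, ∀ b ∈ D.P n, k n (D.β n g b) = map (smulMap g) (n + 1) (k n b)) ∧
    (∀ n < N, ∀ b ∈ D.P n, ∃ U ∈ D.fam (n + 1), D.trace n b ⊆ U ∧ k n b ∈ In (n + 1) U) ∧
    (0 < N → ∀ b ∈ D.P 0, d 0 (k 0 b) = D.e 0 b) ∧
    ∀ n, n + 1 < N → ∀ b ∈ D.P (n + 1),
      d (n + 1) (k (n + 1) b) = D.e (n + 1) b - linExt (k n) (D.bd n b) := by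
  obtain ⟨k₀, h0, h0'⟩ := D.exists_zero
  choose s hs hs' using D.exists_succ
  let K : ∀ n, {k : B n → SC (n + 1) X // D.IsLift n k} :=
    fun n => Nat.rec ⟨k₀, h0⟩ (fun n k => ⟨s n k.1 k.2, hs n k.1 k.2⟩) n
  exact ⟨fun n => (K n).1, fun n => (K n).2.smul, fun n hn => (K n).2.mem hn, h0',
    fun n hn => hs' n (K n).1 (K n).2 hn⟩

end Carrier

end SC

namespace SC

/-! ### Realizing small tuples by singular simplices. -/

section Domination

variable {G X : Type*} [Group G] [TopologicalSpace X] [MulAction G X] [ContinuousConstSMul G X]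

/-- Tuples of length `m` with entries in a member of the family `𝒜`. -/
def smallTuples {X : Type*} (𝒜 : Set (Set X)) (m : ℕ) : Set (List X) :=
  {l | l.length = m ∧ ∃ W ∈ 𝒜, ∀ x ∈ l, x ∈ W}

theorem d_single_mem_smallTuples {X : Type*} {𝒜 : Set (Set X)} {m : ℕ} {l : List X}
    (hl : l ∈ smallTuples 𝒜 (m + 1)) :
    TupleChain.d (Finsupp.single l 1) ∈ TupleChain.On {l' | l' ∈ smallTuples 𝒜 m ∧ l' ⊆ l} := by
  obtain ⟨hl, W, hW, hlW⟩ := hl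
  refine supported_mono' ?_ (TupleChain.d_single_mem l)
  rintro l' ⟨h1, h2⟩
  exact ⟨⟨by omega, W, hW, fun x hx => hlW x (h1.subset hx)⟩, h1.subset⟩

theorem map_smul_mem_smallTuples {𝒜 : Set (Set X)} (h𝒜 : ∀ (g : G), ∀ A ∈ 𝒜, smulMap g '' A ∈ 𝒜)
    {m : ℕ} (g : G) {l : List X} (hl : l ∈ smallTuples 𝒜 m) :
    l.map (smulMap g) ∈ smallTuples 𝒜 m := by
  obtain ⟨hl, W, hW, hlW⟩ := hl
  refine ⟨by simpa, _, h𝒜 g W hW, fun x hx => ?_⟩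
  obtain ⟨y, hy, rfl⟩ := List.mem_map.1 hx
  exact ⟨y, hlW y hy, rfl⟩

theorem map_smul_inv_map (g : G) (l : List X) :
    (l.map (smulMap g)).map (smulMap g⁻¹) = l := by
  simp [Function.comp_def]

theorem map_smul_mem_smallTuples_iff {𝒜 : Set (Set X)}
    (h𝒜 : ∀ (g : G), ∀ A ∈ 𝒜, smulMap g '' A ∈ 𝒜) {m : ℕ} (g : G) {l : List X} :
    l.map (smulMap g) ∈ smallTuples 𝒜 m ↔ l ∈ smallTuples 𝒜 m := by
  refine ⟨fun h => ?_, map_smul_mem_smallTuples h𝒜 g⟩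
  have := map_smul_mem_smallTuples h𝒜 g⁻¹ h
  rwa [map_smul_inv_map] at this

/-- Star refinement with an empty set of neighbors is ordinary refinement, which can be iterated. -/
theorem exists_mem_of_starRefines {𝒮 : ℕ → Set (Set X)} {N : ℕ}
    (hstar : ∀ n < N, StarRefines (𝒮 n) (𝒮 (n + 1))) {m n : ℕ} (hmn : m ≤ n) (hn : n ≤ N)
    {A : Set X} (hA : A ∈ 𝒮 m) : ∃ U ∈ 𝒮 n, A ⊆ U := by
  induction n, hmn using Nat.le_induction with
  | base => exact ⟨A, hA, le_rfl⟩
  | succ n hmn ih =>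
    obtain ⟨U, hU, hAU⟩ := ih (by omega)
    obtain ⟨U', hU', -, h, -⟩ := hstar n (by omega) U hU ∅ (by simp) (by simp)
    exact ⟨U', hU', hAU.trans h⟩

/-- The `0`-simplices given by tuples of length one. -/
def pointChain : TupleChain X →ₗ[ℤ] SC 0 X :=
  linExt fun l => match l with
    | [x] => Finsupp.single (ContinuousMap.const _ x) 1
    | _ => 0

theorem pointChain_singleton (x : X) : pointChain (Finsupp.single [x] 1) =
    Finsupp.single (ContinuousMap.const _ x) 1 := by simp [pointChain]

theorem pointChain_map (f : C(X, X)) (c : TupleChain X) :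
    pointChain (TupleChain.map f c) = map f 0 (pointChain c) := by
  have : pointChain ∘ₗ TupleChain.map f = map f 0 ∘ₗ pointChain := linExt_hom_ext fun l => by
    rcases l with _ | ⟨x, _ | ⟨y, l⟩⟩
    · simp [pointChain]
    · simp [pointChain]
    · simp [pointChain]
  exact LinearMap.congr_fun this c

theorem d_vert_pointChain {c : TupleChain X} (hc : c ∈ TupleChain.Hom X 1) :
    vert 0 (pointChain c) = c := by
  refine eq_of_mem_supported (f := vert 0 ∘ₗ pointChain) (g := LinearMap.id) (fun l hl => ?_) hc
  obtain ⟨x, rfl⟩ := List.length_eq_one_iff.1 hl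
  simp [pointChain_singleton, vertices]

theorem pointChain_mem {c : TupleChain X} {W : Set X} (hc : c ∈ TupleChain.On {l | ∀ x ∈ l, x ∈ W}) :
    pointChain c ∈ In 0 W := by
  refine map_mem_of_mem_supported (fun l hl => ?_) hc
  rcases l with _ | ⟨x, _ | ⟨y, l⟩⟩
  · simp [pointChain]
  · rw [pointChain_singleton]
    exact single_mem_supported_of_mem fun t => hl x (by simp)
  · simp [pointChain]

theorem d_single_mem_subset {X : Type*} (l : List X) :
    TupleChain.d (Finsupp.single l 1) ∈ TupleChain.On {l' | ∀ x ∈ l', x ∈ l} := by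
  refine supported_mono' ?_ (TupleChain.d_single_mem l)
  exact fun l' hl' x hx => hl'.1.subset hx

/-- The carrier data that give a realization of small tuples by singular simplices. -/
def tupleCarrier (hfree : ∀ (g : G) (x : X), g • x = x → g = 1) (𝒮 : ℕ → Set (Set X)) (N : ℕ)
    (hsmul : ∀ n (g : G), ∀ A ∈ 𝒮 n, smulMap g '' A ∈ 𝒮 n)
    (hstar : ∀ n < N + 1, StarRefines (𝒮 n) (𝒮 (n + 1))) :
    CarrierData G X (fun _ => List X) N where
  β _ g l := l.map (smulMap g)
  β_one _ l := by simp [smulMap_one]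
  β_mul _ g h l := by simp [smulMap_mul]
  -- Degree n consists of tuples with n + 2 entries: vertices are realized directly by points, and
  -- the chain produced by the carrier method has one degree more than the index.
  P n := smallTuples (𝒮 1) (n + 2)
  β_mem _ g _ := map_smul_mem_smallTuples (hsmul 1) g
  free n g l hl h := by
    rcases l with _ | ⟨x, l⟩
    · simp [smallTuples] at hl
    · exact hfree g x (by simpa using (List.cons.inj h).1)
  -- With this sign, and with `e` zero above degree 0, the homotopy equation d k = e - k∘bd says
  -- that the realization is a chain map. In degree 0, `e` is the difference of end points that an
  -- edge has to bound.
  bd _ l := -TupleChain.d (Finsupp.single l 1)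
  bd_bd _ l := by
    have : linExt (fun l : List X => -TupleChain.d (Finsupp.single l 1)) = -TupleChain.d :=
      linExt_hom_ext fun l => by simp
    rw [this]
    simp [TupleChain.d_d]
  bd_β _ g l := by
    have : Finsupp.lmapDomain ℤ ℤ (List.map (smulMap g : C(X, X))) = TupleChain.map (smulMap g) :=
      linExt_hom_ext fun l => by simp
    rw [this, map_neg, TupleChain.map_d, TupleChain.map_single]
  trace _ l := {x | x ∈ l}
  trace_β _ g l := by ext x; simp
  bd_mem n l hl := by
    refine Submodule.neg_mem _ (supported_mono' ?_ (d_single_mem_smallTuples hl))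
    rintro l' ⟨h1, h2⟩
    refine ⟨h1, ?_⟩
    rcases l' with _ | ⟨x, l'⟩
    · simp [smallTuples] at h1
    · exact ⟨x, by simp, h2 (by simp)⟩
  e n l := match n with
    | 0 => pointChain (TupleChain.d (Finsupp.single l 1))
    | _ + 1 => 0
  e_β n g l hl := by
    cases n with
    | zero => rw [← pointChain_map, TupleChain.map_d, TupleChain.map_single]
    | succ n => simp
  isCycle l hl := by
    change TupleChain.d (vert 0 (pointChain _)) = 0
    rw [d_vert_pointChain, TupleChain.d_d]
    exact TupleChain.d_mem_hom (single_mem_supported_of_mem hl.1)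
  d_e n _ l hl := by
    cases n with
    | zero =>
      have : linExt (fun l : List X => pointChain (TupleChain.d (Finsupp.single l 1))) =
        pointChain ∘ₗ TupleChain.d := linExt_hom_ext fun l => by simp
      simp [this, TupleChain.d_d]
    | succ n =>
      have : linExt (fun l : List X => (0 : SC (n + 1) X)) = 0 := linExt_hom_ext fun l => by simp
      simp [this]
  fam n := 𝒮 (n + 1)
  fam_smul n := hsmul (n + 1)
  star n hn := hstar (n + 1) (by omega)
  e_mem n hn l hl := by
    obtain ⟨hl', W, hW, hlW⟩ := hl
    obtain ⟨U, hU, hWU⟩ := exists_mem_of_starRefines hstar (n := n + 1) (by omega) (by omega) hW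
    have hlU : {x | x ∈ l} ⊆ U := fun x hx => hWU (hlW x hx)
    refine ⟨U, hU, hlU, U, hU, ?_, ?_⟩
    · rcases l with _ | ⟨x, l⟩
      · simp at hl'
      · exact ⟨x, hlU (by simp), hlU (by simp)⟩
    · cases n with
      | zero =>
        rw [Set.union_self]
        refine pointChain_mem (supported_mono' ?_ (d_single_mem_subset l))
        exact fun l' hl' x hx => hlU (hl' x hx)
      | succ n => exact Submodule.zero_mem _

/-- An equivariant chain map, in low degrees, from small tuples to singular chains that stays near
the given vertices. Acyclic carriers fill in the simplices. -/
theorem exists_realization (hfree : ∀ (g : G) (x : X), g • x = x → g = 1) (𝒮 : ℕ → Set (Set X))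
    (N : ℕ) (hsmul : ∀ n (g : G), ∀ A ∈ 𝒮 n, smulMap g '' A ∈ 𝒮 n)
    (hstar : ∀ n < N + 1, StarRefines (𝒮 n) (𝒮 (n + 1))) :
    ∃ s : ∀ n, TupleChain X →ₗ[ℤ] SC n X,
      (∀ n (g : G) c, s n (TupleChain.map (smulMap g) c) = map (smulMap g) n (s n c)) ∧
      (∀ n ≤ N, ∀ l ∈ smallTuples (𝒮 1) (n + 1), ∃ U ∈ 𝒮 (n + 1), (∀ x ∈ l, x ∈ U) ∧
        s n (Finsupp.single l 1) ∈ In n U) ∧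
      (∀ n < N, ∀ l ∈ smallTuples (𝒮 1) (n + 2),
        d n (s (n + 1) (Finsupp.single l 1)) = s n (TupleChain.d (Finsupp.single l 1))) ∧
      ∀ l ∈ smallTuples (𝒮 1) 1, TupleChain.d (vert 0 (s 0 (Finsupp.single l 1))) =
        Finsupp.single [] 1 := by
  classical
  obtain ⟨k, hk1, hk2, hk3, hk4⟩ := (tupleCarrier hfree 𝒮 N hsmul hstar).exists_homotopy
  let s : ∀ n, TupleChain X →ₗ[ℤ] SC n X := fun n => match n with
    | 0 => pointChain
    | n + 1 => linExt fun l => if l ∈ smallTuples (𝒮 1) (n + 2) then k n l else 0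
  have hs (n : ℕ) (l : List X) (hl : l ∈ smallTuples (𝒮 1) (n + 2)) :
      s (n + 1) (Finsupp.single l 1) = k n l := by simp [s, if_pos hl]
  refine ⟨s, fun n g c => ?_, fun n hn l hl => ?_, fun n hn l hl => ?_, fun l hl => ?_⟩
  · cases n with
    | zero => exact pointChain_map _ c
    | succ n =>
      have : s (n + 1) ∘ₗ TupleChain.map (smulMap g) = map (smulMap g) _ ∘ₗ s (n + 1) :=
        linExt_hom_ext fun l => by
          by_cases hl : l ∈ smallTuples (𝒮 1) (n + 2)
          · have hl' := map_smul_mem_smallTuples (hsmul 1) g hl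
            rw [LinearMap.comp_apply, LinearMap.comp_apply, TupleChain.map_single, hs _ _ hl,
              hs _ _ hl']
            exact hk1 n g l hl
          · have hl' : l.map (smulMap g) ∉ smallTuples (𝒮 1) (n + 2) :=
              fun h => hl ((map_smul_mem_smallTuples_iff (hsmul 1) g).1 h)
            simp [s, if_neg hl, if_neg hl']
      exact LinearMap.congr_fun this c
  · cases n with
    | zero =>
      obtain ⟨hl', W, hW, hlW⟩ := hl
      exact ⟨W, hW, hlW, pointChain_mem (single_mem_supported_of_mem hlW)⟩
    | succ n =>
      rw [hs n l hl]
      obtain ⟨U, hU, h1, h2⟩ := hk2 n (by omega) l hl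
      exact ⟨U, hU, h1, h2⟩
  · rw [hs n l hl]
    cases n with
    | zero => exact hk3 hn l hl
    | succ n =>
      refine (hk4 n hn l hl).trans ?_
      change (0 : SC (n + 1) X) - linExt (k n) (-TupleChain.d (Finsupp.single l 1)) = _
      rw [map_neg, zero_sub, neg_neg]
      refine eq_of_mem_supported (fun l' hl' => ?_) (d_single_mem_smallTuples hl)
      rw [hs n l' hl'.1, linExt_single]
  · change TupleChain.d (vert 0 (pointChain _)) = _
    obtain ⟨x, rfl⟩ := List.length_eq_one_iff.1 hl.1
    rw [d_vert_pointChain (single_mem_supported_of_mem rfl)]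
    simp

end Domination

end SC

namespace SC

/-! ### Domination of singular chains by finitely many orbits of tuples. -/

section Domination

variable {G X : Type*} [Group G] [TopologicalSpace X] [MulAction G X] [ContinuousConstSMul G X]

/-- The boundary operator, as an operator in every degree. -/
def bd : ∀ n, SC n X →ₗ[ℤ] SC (n - 1) X
  | 0 => 0
  | n + 1 => d n

/-- Freeness allows the nearby point to be chosen once per orbit. The map `a` need not be
continuous, since it is applied only to vertices. -/
theorem exists_near_equivariant [Nonempty X] (hfree : ∀ (g : G) (x : X), g • x = x → g = 1)
    {𝒜 : Set (Set X)} (h𝒜 : ∀ (g : G), ∀ A ∈ 𝒜, smulMap g '' A ∈ 𝒜) {r : C(X, X)}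
    (hr : ∀ (g : G) x, r (g • x) = g • r x) {F : Set X}
    (hnear : ∀ x, ∃ A ∈ 𝒜, ∃ g : G, ∃ p ∈ F, r x ∈ A ∧ g • p ∈ A) :
    ∃ a : X → X, (∀ (g : G) x, a (g • x) = g • a x) ∧ (∀ x, ∃ g : G, ∃ p ∈ F, a x = g • p) ∧
      ∀ x, ∃ A ∈ 𝒜, r x ∈ A ∧ a x ∈ A := by
  obtain ⟨a, ha⟩ := exists_equivariant (P := Set.univ) (fun (g : G) (x : X) => g • x)
    (fun (g : G) (x : X) => g • x) (one_smul G) mul_smul mul_smul (fun _ _ _ => trivial)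
    (fun g x _ => hfree g x)
    (fun x y => (∃ g : G, ∃ p ∈ F, y = g • p) ∧ ∃ A ∈ 𝒜, r x ∈ A ∧ y ∈ A) (by
      rintro g x - _ ⟨⟨h, p, hp, rfl⟩, A, hA, h1, h2⟩
      refine ⟨⟨g * h, p, hp, by rw [mul_smul]⟩, _, h𝒜 g A hA, ⟨_, h1, by simp [hr]⟩,
        ⟨_, h2, rfl⟩⟩) (fun x _ => by
      obtain ⟨A, hA, g, p, hp, h1, h2⟩ := hnear x
      exact ⟨_, ⟨g, p, hp, rfl⟩, A, hA, h1, h2⟩)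
  exact ⟨a, fun g x => (ha x trivial).2 g, fun x => (ha x trivial).1.1,
    fun x => (ha x trivial).1.2⟩

/-- Up to the action, there are finitely many small tuples with entries in the orbits of a finite
set. -/
theorem exists_finite_representatives {𝒮 : ℕ → Set (Set X)}
    (h1 : ∀ (g : G), ∀ A ∈ 𝒮 1, smulMap g '' A ∈ 𝒮 1) (hstar : StarRefines (𝒮 1) (𝒮 2))
    (hinj : ∀ A ∈ 𝒮 2, ∀ (g : G), ∀ x ∈ A, g • x ∈ A → g = 1) {F : Set X} (hF : F.Finite) (n : ℕ) :
    ∃ L : Set (List X), L.Finite ∧ ∀ l ∈ smallTuples (𝒮 1) (n + 1),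
      (∀ x ∈ l, ∃ g : G, ∃ p ∈ F, x = g • p) → ∃ g : G, ∃ l' ∈ L, l = l'.map (smulMap g) := by
  -- The points in the orbit of p that are close to p'. For given p and p' there is at most one: two
  -- of them would lie in one member of 𝒮 2, which meets an orbit at most once.
  let Φ : Set X := ⋃ p ∈ F, ⋃ p' ∈ F, {x | (∃ g : G, x = g • p) ∧ ∃ W ∈ 𝒮 1, p' ∈ W ∧ x ∈ W}
  have hΦ : Φ.Finite := by
    refine hF.biUnion fun p _ => hF.biUnion fun p' _ => Set.Subsingleton.finite ?_
    rintro _ ⟨⟨g, rfl⟩, W, hW, hW1, hW2⟩ _ ⟨⟨g', rfl⟩, W', hW', hW1', hW2'⟩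
    obtain ⟨U, hU, -, hWU, hU'⟩ := hstar W hW {W'} (by simpa) (by
      rintro _ rfl; exact ⟨p', hW1', hW1⟩)
    have := hinj U hU (g' * g⁻¹) (g • p) (hWU hW2) (by
      rw [smul_smul, inv_mul_cancel_right]; exact hU' _ rfl hW2')
    rw [mul_inv_eq_one.1 this]
  refine ⟨{l | l.length = n + 1 ∧ ∀ x ∈ l, x ∈ Φ}, ?_, ?_⟩
  · have : Finite Φ := hΦ
    refine ((List.finite_length_eq Φ (n + 1)).image (List.map Subtype.val)).subset ?_
    rintro l ⟨hl, hl'⟩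
    refine ⟨l.attach.map fun x => ⟨x.1, hl' x.1 x.2⟩, by simpa, ?_⟩
    simp [Function.comp_def]
  · rintro l ⟨hl, W, hW, hlW⟩ hlF
    obtain ⟨x, l₀, rfl⟩ := List.exists_cons_of_length_eq_add_one hl
    obtain ⟨g, p, hp, hgp⟩ := hlF x (by simp)
    -- Translate so that the first entry becomes the point p of F; the others then share a small set
    -- with p, and hence lie in Φ.
    refine ⟨g, (x :: l₀).map (smulMap g⁻¹), ⟨by simpa using hl, fun y hy => ?_⟩, ?_⟩
    · obtain ⟨z, hz, rfl⟩ := List.mem_map.1 hy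
      obtain ⟨g', p', hp', rfl⟩ := hlF z hz
      refine Set.mem_biUnion hp' (Set.mem_biUnion hp ⟨⟨g⁻¹ * g', ?_⟩, _, h1 g⁻¹ W hW,
        ⟨x, hlW x (by simp), ?_⟩, ⟨_, hlW _ hz, rfl⟩⟩)
      · simp [mul_smul]
      · simp [hgp]
    · have := map_smul_inv_map g⁻¹ (x :: l₀)
      rw [inv_inv] at this
      exact this.symm

/-- The sets joining each r(v) to a(v) all meet the set that contains r∘σ, so one star enlargement
holds everything. -/
theorem map_vertices_mem {𝒮 : ℕ → Set (Set X)} (hstar : StarRefines (𝒮 0) (𝒮 1)) {r : C(X, X)}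
    {a : X → X} (ha : ∀ x, ∃ A ∈ 𝒮 0, r x ∈ A ∧ a x ∈ A) {n : ℕ} {σ : C(Simp n, X)}
    (hσ : ∃ A ∈ 𝒮 0, ∀ t, r (σ t) ∈ A) :
    ∃ U ∈ 𝒮 1, (∀ t, r (σ t) ∈ U) ∧ ∀ x ∈ (vertices σ).map a, x ∈ U := by
  obtain ⟨A, hA, hσA⟩ := hσ
  obtain ⟨U, hU, -, hAU, h⟩ := hstar A hA {A' | A' ∈ 𝒮 0 ∧ (A' ∩ A).Nonempty}
    (fun _ h => h.1) (fun _ h => h.2)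
  refine ⟨U, hU, fun t => hAU (hσA t), fun x hx => ?_⟩
  obtain ⟨y, hy, rfl⟩ := List.mem_map.1 hx
  obtain ⟨i, rfl⟩ := (List.mem_ofFn' _ _).1 hy
  obtain ⟨A', hA', h1, h2⟩ := ha (σ (stdSimplex.vertex i))
  exact h A' ⟨hA', _, h1, hσA _⟩ h2

/-- The carrier data for the comparison of a map with its simplicial approximation. -/
def comparisonCarrier [Nonempty X] (hfree : ∀ (g : G) (x : X), g • x = x → g = 1)
    (𝒮 : ℕ → Set (Set X)) (N : ℕ)
    (hsmul : ∀ n (g : G), ∀ A ∈ 𝒮 n, smulMap g '' A ∈ 𝒮 n)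
    (hstar : ∀ n < N + 1, StarRefines (𝒮 n) (𝒮 (n + 1)))
    (s : ∀ n, TupleChain X →ₗ[ℤ] SC n X)
    (hs1 : ∀ n (g : G) c, s n (TupleChain.map (smulMap g) c) = map (smulMap g) n (s n c))
    (hs2 : ∀ n ≤ N, ∀ l ∈ smallTuples (𝒮 1) (n + 1), ∃ U ∈ 𝒮 (n + 1), (∀ x ∈ l, x ∈ U) ∧
        s n (Finsupp.single l 1) ∈ In n U)
    (hs3 : ∀ n < N, ∀ l ∈ smallTuples (𝒮 1) (n + 2),
        d n (s (n + 1) (Finsupp.single l 1)) = s n (TupleChain.d (Finsupp.single l 1)))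
    (hs4 : ∀ l ∈ smallTuples (𝒮 1) 1, TupleChain.d (vert 0 (s 0 (Finsupp.single l 1))) =
        Finsupp.single [] 1)
    (r : C(X, X)) (hr : ∀ (g : G) x, r (g • x) = g • r x) (a : X → X)
    (ha : ∀ (g : G) x, a (g • x) = g • a x) (ha' : ∀ x, ∃ A ∈ 𝒮 0, r x ∈ A ∧ a x ∈ A) :
    CarrierData G X (fun n => C(Simp n, X)) N where
  β _ g σ := (smulMap g).comp σ
  β_one _ σ := by ext; simp
  β_mul _ g h σ := by ext; simp [mul_smul]
  P n := {σ | ∃ A ∈ 𝒮 0, ∀ t, r (σ t) ∈ A}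
  β_mem n g σ hσ := by
    obtain ⟨A, hA, hσA⟩ := hσ
    exact ⟨_, hsmul 0 g A hA, fun t => ⟨_, hσA t, by simp [hr]⟩⟩
  free n g σ _ h := hfree g (σ (stdSimplex.vertex 0)) (DFunLike.congr_fun h _)
  bd n σ := d n (Finsupp.single σ 1)
  bd_bd n σ := by
    have : linExt (fun σ : C(Simp (n + 1), X) => d n (Finsupp.single σ 1)) = d n :=
      linExt_hom_ext fun l => by simp
    rw [this, d_d]
  bd_β n g σ := by
    have : Finsupp.lmapDomain ℤ ℤ (fun σ : C(Simp n, X) => (smulMap g).comp σ) =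
        map (smulMap g) n := linExt_hom_ext fun l => by simp
    rw [this, map_d, map_single]
  trace n σ := Set.range fun t => r (σ t)
  trace_β n g σ := by
    ext x
    simp [hr]
  bd_mem n σ hσ := by
    obtain ⟨A, hA, hσA⟩ := hσ
    rw [d_single]
    refine Submodule.sum_mem _ fun j _ => Submodule.smul_mem _ _ (single_mem_supported_of_mem ?_)
    exact ⟨⟨A, hA, fun t => hσA _⟩, r (σ (faceMap j (stdSimplex.vertex 0))), ⟨_, rfl⟩, ⟨_, rfl⟩⟩
  -- The difference of two augmentation-preserving chain maps with common small carriers; a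
  -- null-homotopy of it is a homotopy between the two.
  e n σ := s n (TupleChain.map a (vert n (Finsupp.single σ 1))) - map r n (Finsupp.single σ 1)
  e_β n g σ _ := by
    have h1 (c : TupleChain X) : TupleChain.map a (TupleChain.map (smulMap g) c) =
        TupleChain.map (smulMap g) (TupleChain.map a c) := by
      have : TupleChain.map a ∘ₗ TupleChain.map (smulMap g) =
          TupleChain.map (smulMap g) ∘ₗ TupleChain.map a := linExt_hom_ext fun l => by
        simp [Function.comp_def, ha]
      exact LinearMap.congr_fun this c
    have h2 : r.comp (smulMap g) = (smulMap g).comp r := by ext x; simp [hr]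
    rw [← map_single, vert_map, h1, hs1, map_comp, h2, ← map_comp, map_sub]
  isCycle σ hσ := by
    have hσ' : (vertices σ).map a ∈ smallTuples (𝒮 1) 1 := by
      obtain ⟨U, hU, -, h⟩ := map_vertices_mem (hstar 0 (by omega)) ha' hσ
      exact ⟨by simp [length_vertices], U, hU, h⟩
    change TupleChain.d (vert 0 _) = 0
    rw [map_sub, map_sub, vert_single, TupleChain.map_single, hs4 _ hσ', map_single, vert_single,
      tupleChain_d_single 0 _ (length_vertices _)]
    simp [vertices]
  d_e n hn σ hσ := by
    have hσ' : (vertices σ).map a ∈ smallTuples (𝒮 1) (n + 2) := by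
      obtain ⟨U, hU, -, h⟩ := map_vertices_mem (hstar 0 (by omega)) ha' hσ
      exact ⟨by simp [length_vertices], U, hU, h⟩
    have : linExt (fun σ : C(Simp n, X) => s n (TupleChain.map a (vert n (Finsupp.single σ 1))) -
        map r n (Finsupp.single σ 1)) = s n ∘ₗ TupleChain.map a ∘ₗ vert n - map r n :=
      linExt_hom_ext fun l => by simp
    rw [this, map_sub, vert_single, TupleChain.map_single, hs3 n (by omega) _ hσ', LinearMap.sub_apply,
      map_d]
    simp only [LinearMap.comp_apply]
    rw [← d_vert, TupleChain.map_d, vert_single, TupleChain.map_single]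
  fam n := 𝒮 (n + 1)
  fam_smul n := hsmul (n + 1)
  star n hn := hstar (n + 1) (by omega)
  e_mem n hn σ hσ := by
    obtain ⟨U, hU, hσU, h⟩ := map_vertices_mem (hstar 0 (by omega)) ha' hσ
    have hσ' : (vertices σ).map a ∈ smallTuples (𝒮 1) (n + 1) :=
      ⟨by simp [length_vertices], U, hU, h⟩
    obtain ⟨E, hE, hlE, hsE⟩ := hs2 n hn.le _ hσ'
    obtain ⟨W, hW, hUW⟩ := exists_mem_of_starRefines hstar (n := n + 1) (by omega) (by omega) hU
    refine ⟨W, hW, ?_, E, hE, ?_, Submodule.sub_mem _ ?_ ?_⟩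
    · rintro _ ⟨t, rfl⟩
      exact hUW (hσU t)
    · have hv : a (σ (stdSimplex.vertex 0)) ∈ (vertices σ).map a :=
        List.mem_map_of_mem ((List.mem_ofFn' _ _).2 ⟨0, rfl⟩)
      exact ⟨_, hlE _ hv, hUW (h _ hv)⟩
    · rw [vert_single, TupleChain.map_single]
      exact in_mono Set.subset_union_right hsE
    · rw [map_single]
      exact single_mem_supported_of_mem fun t => Or.inl (hUW (hσU t))

variable (G X) in
/-- In degree `i`, the singular chains are dominated, up to equivariant chain homotopy, by finitely
many tuples. -/
def IsDominated (i : ℕ) : Prop :=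
    ∃ (I : SC i X →ₗ[ℤ] TupleChain X) (S : TupleChain X →ₗ[ℤ] SC i X)
      (K : SC i X →ₗ[ℤ] SC (i + 1) X) (K' : SC (i - 1) X →ₗ[ℤ] SC i X) (L : Set (List X)),
      (∀ c, S (I c) - c = d i (K c) + K' (bd i c)) ∧
      (∀ (g : G) c, I (map (smulMap g) i c) = TupleChain.map (smulMap g) (I c)) ∧
      (∀ (g : G) c, S (TupleChain.map (smulMap g) c) = map (smulMap g) i (S c)) ∧
      (∀ (g : G) c, K (map (smulMap g) i c) = map (smulMap g) (i + 1) (K c)) ∧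
      (∀ (g : G) c, K' (map (smulMap g) (i - 1) c) = map (smulMap g) i (K' c)) ∧
      L.Finite ∧ ∀ c, I c ∈ TupleChain.On {l | ∃ g : G, ∃ l' ∈ L, l = l'.map (smulMap g)}

/-- A space with a free action and an equivariant deformation into finitely many small sets, up to
the action: in each degree its singular chains are dominated, up to chain homotopy, by finitely
many basis elements. -/
theorem exists_domination [Nonempty X] (hfree : ∀ (g : G) (x : X), g • x = x → g = 1)
    (𝒮 : ℕ → Set (Set X)) (i : ℕ)
    (hsmul : ∀ n (g : G), ∀ A ∈ 𝒮 n, smulMap g '' A ∈ 𝒮 n)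
    (hstar : ∀ n < i + 2, StarRefines (𝒮 n) (𝒮 (n + 1)))
    (hinj : ∀ A ∈ 𝒮 2, ∀ (g : G), ∀ x ∈ A, g • x ∈ A → g = 1)
    (H : C(X × unitInterval, X)) (H_zero : ∀ x, H (x, 0) = x)
    (H_smul : ∀ (g : G) x s, H (g • x, s) = g • H (x, s))
    (hsmall : ∀ x, ∃ O ∈ nhds x, ∃ A ∈ 𝒮 0, ∀ y ∈ O, H (y, 1) ∈ A)
    {F : Set X} (hF : F.Finite)
    (hnear : ∀ x, ∃ A ∈ 𝒮 0, ∃ g : G, ∃ p ∈ F, H (x, 1) ∈ A ∧ g • p ∈ A) :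
    IsDominated G X i := by
  classical
  let r : C(X, X) := slice H 1
  have hr (g : G) (x : X) : r (g • x) = g • r x := H_smul g x 1
  obtain ⟨a, ha1, ha2, ha3⟩ := exists_near_equivariant hfree (hsmul 0) hr hnear
  obtain ⟨s, hs1, hs2, hs3, hs4⟩ := exists_realization hfree 𝒮 (i + 1) hsmul hstar
  obtain ⟨k, hk1, -, hk3, hk4⟩ := (comparisonCarrier hfree 𝒮 (i + 1) hsmul hstar s hs1 hs2 hs3 hs4
    r hr a ha1 ha3).exists_homotopy
  obtain ⟨L, hL, hL'⟩ := exists_finite_representatives (hsmul 1) (hstar 1 (by omega)) hinj hF i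
  -- Smallness is measured after the deformation: far from the compact part there is no uniform
  -- small scale, but the image under `r` has one.
  let 𝒱 : Set (Set X) := {O | ∃ A ∈ 𝒮 0, ∀ y ∈ O, r y ∈ A}
  have h𝒱 (x : X) : ∃ O ∈ 𝒱, O ∈ nhds x := by
    obtain ⟨O, hO, A, hA, h⟩ := hsmall x
    exact ⟨O, ⟨A, hA, h⟩, hO⟩
  have h𝒱g (g : G) : ∀ O ∈ 𝒱, smulMap g '' O ∈ 𝒱 := by
    rintro O ⟨A, hA, h⟩
    refine ⟨_, hsmul 0 g A hA, ?_⟩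
    rintro _ ⟨y, hy, rfl⟩
    exact ⟨r y, h y hy, by simp [hr]⟩
  have hsmallP (n : ℕ) : ∀ σ ∈ {σ : C(Simp n, X) | ∃ A ∈ 𝒱, ∀ t, σ t ∈ A},
      ∃ A ∈ 𝒮 0, ∀ t, r (σ t) ∈ A := by
    rintro σ ⟨O, ⟨A, hA, h⟩, hσ⟩
    exact ⟨A, hA, fun t => h _ (hσ t)⟩
  have hrg (g : G) : r.comp (smulMap g) = (smulMap g).comp r := by ext x; simp [hr]
  have hag (g : G) (c : TupleChain X) : TupleChain.map a (TupleChain.map (smulMap g) c) =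
      TupleChain.map (smulMap g) (TupleChain.map a c) := by
    have : TupleChain.map a ∘ₗ TupleChain.map (smulMap g) =
        TupleChain.map (smulMap g) ∘ₗ TupleChain.map a := linExt_hom_ext fun l => by
      simp [Function.comp_def, ha1]
    exact LinearMap.congr_fun this c
  -- Extension by zero is harmless: smallness is invariant under the group, and the homotopy formula
  -- is only used after `toSmall`.
  let h : ∀ n, SC n X →ₗ[ℤ] SC (n + 1) X := fun n =>
    linExt fun σ => if ∃ A ∈ 𝒮 0, ∀ t, r (σ t) ∈ A then k n σ else 0
  have hP (n : ℕ) (σ : C(Simp n, X)) (hσ : ∃ A ∈ 𝒮 0, ∀ t, r (σ t) ∈ A) :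
      h n (Finsupp.single σ 1) = k n σ := by simp only [h, linExt_single, if_pos hσ]
  have hPg (n : ℕ) (g : G) (σ : C(Simp n, X)) (hσ : ∃ A ∈ 𝒮 0, ∀ t, r (σ t) ∈ A) :
      ∃ A ∈ 𝒮 0, ∀ t, r ((smulMap g).comp σ t) ∈ A := by
    obtain ⟨A, hA, hσA⟩ := hσ
    exact ⟨_, hsmul 0 g A hA, fun t => ⟨_, hσA t, by simp [hr]⟩⟩
  have hh1 (n : ℕ) (g : G) (c : SC n X) : h n (map (smulMap g) n c) =
      map (smulMap g) (n + 1) (h n c) := by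
    have : h n ∘ₗ map (smulMap g) n = map (smulMap g) (n + 1) ∘ₗ h n := linExt_hom_ext fun σ => by
      rw [LinearMap.comp_apply, LinearMap.comp_apply, map_single]
      by_cases hσ : ∃ A ∈ 𝒮 0, ∀ t, r (σ t) ∈ A
      · rw [hP n σ hσ, hP n _ (hPg n g σ hσ)]
        exact hk1 n g σ hσ
      · have hσ' : ¬ ∃ A ∈ 𝒮 0, ∀ t, r ((smulMap g).comp σ t) ∈ A := fun h' => hσ (by
          have := hPg n g⁻¹ _ h'
          rwa [← ContinuousMap.comp_assoc, smulMap_inv_comp, ContinuousMap.id_comp] at this)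
        simp only [h, linExt_single, if_neg hσ, if_neg hσ', map_zero]
    exact LinearMap.congr_fun this c
  have hI (n : ℕ) (g : G) (c : SC n X) : TupleChain.map a (vert n (toSmall 𝒱 n
      (map (smulMap g) n c))) = TupleChain.map (smulMap g) (TupleChain.map a
        (vert n (toSmall 𝒱 n c))) := by
    rw [← map_toSmall (h𝒱g g) (h𝒱g g⁻¹) (smulMap_inv_comp g), vert_map, hag]
  have hD (n : ℕ) (g : G) (c : SC n X) : smallHomotopy 𝒱 n (map (smulMap g) n c) =
      map (smulMap g) (n + 1) (smallHomotopy 𝒱 n c) :=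
    (map_smallHomotopy (h𝒱g g) (h𝒱g g⁻¹) (smulMap_inv_comp g) n c).symm
  have hhop (n : ℕ) (g : G) (c : SC n X) : hop H n (map (smulMap g) n c) =
      map (smulMap g) (n + 1) (hop H n c) :=
    (map_hop H (smulMap g) (fun x s => H_smul g x s) n c).symm
  have hslice : slice H 0 = ContinuousMap.id X := by ext x; exact H_zero x
  -- Three homotopies are combined: from the realized vertices to `r` on small chains, from small
  -- chains back to all chains (followed by `r`), and from `r` to the identity along `H`.
  let K : ∀ n, SC n X →ₗ[ℤ] SC (n + 1) X := fun n =>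
    h n ∘ₗ toSmall 𝒱 n - map r (n + 1) ∘ₗ smallHomotopy 𝒱 n + hop H n
  have hK (n : ℕ) (c : SC n X) : K n c = h n (toSmall 𝒱 n c) -
    map r (n + 1) (smallHomotopy 𝒱 n c) + hop H n c := rfl
  have hKg (n : ℕ) (g : G) (c : SC n X) : K n (map (smulMap g) n c) =
      map (smulMap g) (n + 1) (K n c) := by
    rw [hK, hK, ← map_toSmall (h𝒱g g) (h𝒱g g⁻¹) (smulMap_inv_comp g), hh1, hD, hhop, map_comp, hrg,
      ← map_comp, map_add, map_sub]
  let K' : SC (i - 1) X →ₗ[ℤ] SC i X := match i with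
    | 0 => 0
    | n + 1 => K n
  refine ⟨TupleChain.map a ∘ₗ vert i ∘ₗ toSmall 𝒱 i, s i, K i, K', L, fun c => ?_,
    fun g c => hI i g c, fun g c => hs1 i g c, hKg i, fun g c => ?_, hL, fun c => ?_⟩
  · cases i with
    | zero =>
      have h1 : d 0 (h 0 (toSmall 𝒱 0 c)) = s 0 (TupleChain.map a (vert 0 (toSmall 𝒱 0 c))) -
          map r 0 (toSmall 𝒱 0 c) :=
        eq_of_mem_supported (f := d 0 ∘ₗ h 0)
          (g := s 0 ∘ₗ TupleChain.map a ∘ₗ vert 0 - map r 0) (fun σ hσ => by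
            rw [LinearMap.comp_apply, hP _ _ (hsmallP _ σ hσ)]
            exact hk3 (by omega) σ (hsmallP _ σ hσ)) (toSmall_mem 𝒱 h𝒱 0 c)
      have h3 : map r 0 (toSmall 𝒱 0 c) = map r 0 c - map r 0 (d 0 (smallHomotopy 𝒱 0 c)) := by
        rw [toSmall_zero, map_sub]
      change s 0 (TupleChain.map a (vert 0 (toSmall 𝒱 0 c))) - c =
        d 0 (K 0 c) + (0 : SC (0 - 1) X →ₗ[ℤ] SC 0 X) _
      rw [hK, map_add, map_sub, h1, d_hop_zero, ← map_d, hslice, map_id, h3, LinearMap.zero_apply]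
      change _ = _ + (map r 0 c - c) + 0
      abel
    | succ n =>
      have h1 : d (n + 1) (h (n + 1) (toSmall 𝒱 (n + 1) c)) =
          s (n + 1) (TupleChain.map a (vert (n + 1) (toSmall 𝒱 (n + 1) c))) -
          map r (n + 1) (toSmall 𝒱 (n + 1) c) - h n (d n (toSmall 𝒱 (n + 1) c)) :=
        eq_of_mem_supported (f := d (n + 1) ∘ₗ h (n + 1))
          (g := s (n + 1) ∘ₗ TupleChain.map a ∘ₗ vert (n + 1) - map r (n + 1) - h n ∘ₗ d n)
          (fun σ hσ => by
            rw [LinearMap.comp_apply, hP _ _ (hsmallP _ σ hσ)]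
            refine (hk4 n (by omega) σ (hsmallP _ σ hσ)).trans ?_
            simp only [LinearMap.sub_apply, LinearMap.comp_apply]
            congr 1
            obtain ⟨A, hA, hσA⟩ := hsmallP _ σ hσ
            refine eq_of_mem_supported (s := {σ | ∃ A ∈ 𝒮 0, ∀ t, r (σ t) ∈ A}) (fun σ' hσ' => ?_) ?_
            · rw [hP n σ' hσ', linExt_single]
            · change d n (Finsupp.single σ 1) ∈ _
              rw [d_single]
              exact Submodule.sum_mem _ fun j _ => Submodule.smul_mem _ _
                (single_mem_supported_of_mem ⟨A, hA, fun t => hσA _⟩)) (toSmall_mem 𝒱 h𝒱 (n + 1) c)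
      have h3 : map r (n + 1) (toSmall 𝒱 (n + 1) c) = map r (n + 1) c -
          map r (n + 1) (d (n + 1) (smallHomotopy 𝒱 (n + 1) c)) -
          map r (n + 1) (smallHomotopy 𝒱 n (d n c)) := by
        rw [toSmall_succ, map_sub, map_sub]
      have h2 := d_hop_succ H n c
      rw [hslice, map_id] at h2
      change s (n + 1) (TupleChain.map a (vert (n + 1) (toSmall 𝒱 (n + 1) c))) - c =
        d (n + 1) (K (n + 1) c) + K n (d n c)
      rw [hK, hK, map_add, map_sub, h1, d_toSmall, ← map_d, eq_sub_of_add_eq h2, h3]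
      change _ = _ + (map r (n + 1) c - c - _) + _
      abel
  · cases i with
    | zero => simp [K']
    | succ n => exact hKg n g c
  · refine map_mem_of_mem_supported (f := TupleChain.map a ∘ₗ vert i) (fun σ hσ => ?_)
      (toSmall_mem 𝒱 h𝒱 i c)
    rw [LinearMap.comp_apply, vert_single, TupleChain.map_single]
    refine single_mem_supported_of_mem (hL' _ ?_ fun x hx => ?_)
    · obtain ⟨U, hU, -, h⟩ := map_vertices_mem (hstar 0 (by omega)) ha3 (hsmallP _ σ hσ)
      exact ⟨by simp [length_vertices], U, hU, h⟩
    · obtain ⟨y, hy, rfl⟩ := List.mem_map.1 hx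
      exact ha2 y

end Domination

end SC

/-! ### Linear algebra -/

section LinearAlgebra

open Polynomial

variable {R : Type*} [CommRing R]

/-- The Cayley–Hamilton theorem, over a subring, for an endomorphism that preserves a lattice. -/
theorem exists_monic_aeval_eq_zero_of_lattice (A : Subring R) {Q : Type*} [AddCommGroup Q]
    [Module R Q] (D : Module.End R Q) {B : Set Q} (hB : B.Finite)
    (hD : ∀ b ∈ B, D b ∈ Submodule.span A B) :
    ∃ χ : A[X], χ.Monic ∧ ∀ q ∈ Submodule.span R B, aeval D (χ.map A.subtype) q = 0 := by
  have hD' : ∀ x ∈ Submodule.span A B, D.restrictScalars A x ∈ Submodule.span A B := by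
    have : Submodule.span A B ≤ (Submodule.span A B).comap (D.restrictScalars A) :=
      Submodule.span_le.2 hD
    exact this
  have : Module.Finite A (Submodule.span A B) := Module.Finite.span_of_finite A hB
  obtain ⟨χ, hχ, h⟩ := LinearMap.exists_monic_and_aeval_eq_zero A ((D.restrictScalars A).restrict hD')
  refine ⟨χ, hχ, fun q hq => ?_⟩
  -- Cayley–Hamilton is applied to the restriction to the A-span of B. This transports the resulting
  -- equation to the ambient module, whence it extends R-linearly.
  have h1 (f : A[X]) (x : Submodule.span A B) :
      ((aeval ((D.restrictScalars A).restrict hD') f x : Submodule.span A B) : Q) =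
        aeval D (f.map A.subtype) x.1 := by
    induction f using Polynomial.induction_on' generalizing x with
    | add f g hf hg => simp [hf, hg]
    | monomial n a =>
      simp only [aeval_monomial, Polynomial.map_monomial, Module.End.mul_apply,
        Module.algebraMap_end_apply, Submodule.coe_smul]
      congr 1
      induction n generalizing x with
      | zero => rfl
      | succ n ih => rw [pow_succ, pow_succ, Module.End.mul_apply, Module.End.mul_apply, ih]; rfl
  induction hq using Submodule.span_induction with
  | mem x hx => rw [← h1 χ ⟨x, Submodule.subset_span hx⟩, h]; rfl
  | zero => rw [map_zero]
  | add x y _ _ hx hy => rw [map_add, hx, hy, add_zero]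
  | smul r x _ hx => rw [map_smul, hx, smul_zero]

/-- If the homology in the middle is dominated by a finitely generated module, then on it an
endomorphism satisfies a monic equation over a subring. -/
theorem exists_monic_aeval_mem_range (A : Subring R) {C C₁ C' Q : Type*}
    [AddCommGroup C] [Module R C] [AddCommGroup C₁] [Module R C₁] [AddCommGroup C'] [Module R C']
    [AddCommGroup Q] [Module R Q] (d : C₁ →ₗ[R] C) (d' : C →ₗ[R] C') (hdd : ∀ x, d' (d x) = 0)
    (φ : Module.End R C) (φ₁ : Module.End R C₁) (φ' : Module.End R C')
    (h₁ : ∀ x, φ (d x) = d (φ₁ x)) (h' : ∀ x, d' (φ x) = φ' (d' x))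
    (I : C →ₗ[R] Q) (S : Q →ₗ[R] C) (K : C →ₗ[R] C₁) (K' : C' →ₗ[R] C)
    (hK : ∀ x, S (I x) - x = d (K x) + K' (d' x)) {B : Set Q} (hB : B.Finite)
    (hI : ∀ x, I x ∈ Submodule.span R B) (hφ : ∀ b ∈ B, I (φ (S b)) ∈ Submodule.span A B) :
    ∃ χ : A[X], χ.Monic ∧ ∀ x, d' x = 0 → ∃ y, d y = aeval φ (χ.map A.subtype) x := by
  obtain ⟨χ, hχ, h⟩ := exists_monic_aeval_eq_zero_of_lattice A (I ∘ₗ φ ∘ₗ S) hB hφ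
  refine ⟨χ, hχ, fun x hx => ?_⟩
  have hT (x : C) (hx : d' x = 0) : d' (S (I x)) = 0 ∧ S (I x) - x ∈ LinearMap.range d := by
    have := hK x
    rw [hx, map_zero, add_zero] at this
    refine ⟨?_, K x, this.symm⟩
    rw [sub_eq_iff_eq_add.1 this, map_add, hdd, hx, add_zero]
  -- On cycles, S∘I is the identity modulo boundaries, so powers of I∘φ∘S compute powers of φ on
  -- homology.
  have hpow (n : ℕ) : d' (S (((I ∘ₗ φ ∘ₗ S) ^ n) (I x))) = 0 ∧
      S (((I ∘ₗ φ ∘ₗ S) ^ n) (I x)) - (φ ^ n) x ∈ LinearMap.range d := by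
    induction n with
    | zero => exact hT x hx
    | succ n ih =>
      rw [pow_succ', pow_succ', Module.End.mul_apply, Module.End.mul_apply]
      set y := S (((I ∘ₗ φ ∘ₗ S) ^ n) (I x))
      have hy : d' (φ y) = 0 := by rw [h', ih.1, map_zero]
      refine ⟨(hT _ hy).1, ?_⟩
      have h2 : φ (y - (φ ^ n) x) ∈ LinearMap.range d := by
        obtain ⟨w, hw⟩ := ih.2
        exact ⟨φ₁ w, by rw [← h₁, hw]⟩
      rw [map_sub] at h2
      have := Submodule.add_mem _ (hT _ hy).2 h2
      rwa [sub_add_sub_cancel] at this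
  have hpoly (f : R[X]) : S (aeval (I ∘ₗ φ ∘ₗ S) f (I x)) - aeval φ f x ∈ LinearMap.range d := by
    induction f using Polynomial.induction_on' with
    | add f g hf hg =>
      simp only [map_add, LinearMap.add_apply]
      rw [add_sub_add_comm]
      exact Submodule.add_mem _ hf hg
    | monomial n a =>
      simp only [aeval_monomial, Module.End.mul_apply, Module.algebraMap_end_apply, map_smul]
      rw [← smul_sub]
      exact Submodule.smul_mem _ _ (hpow n).2
  have h3 := hpoly (χ.map A.subtype)
  rw [h _ (hI x), map_zero, zero_sub, neg_mem_iff] at h3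
  exact h3

/-- X - 1 divides p - p(1), so p(θ) is p(1) modulo the image of 1 - θ. -/
theorem exists_aeval_eq_eval_one_add {M : Type*} [AddCommGroup M] [Module R M] (θ : Module.End R M)
    (p : R[X]) : ∃ q : R[X], ∀ x, aeval θ p x = p.eval 1 • x + (aeval θ q x - θ (aeval θ q x)) := by
  obtain ⟨q, hq⟩ := X_sub_C_dvd_sub_C_eval (p := p) (a := 1)
  refine ⟨-q, fun x => ?_⟩
  have h := congrArg (fun f => aeval θ f x) (sub_eq_iff_eq_add.1 hq)
  simp only [map_add, map_mul, aeval_X, aeval_C, map_sub, map_one, LinearMap.add_apply,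
    Module.End.mul_apply, LinearMap.sub_apply, Module.End.one_apply,
    Module.algebraMap_end_apply] at h
  rw [h, map_neg, LinearMap.neg_apply, map_neg]
  abel

theorem aeval_comm {M M' : Type*} [AddCommGroup M] [Module R M] [AddCommGroup M'] [Module R M']
    {θ : Module.End R M} {θ' : Module.End R M'} {d : M →ₗ[R] M'} (h : ∀ x, d (θ x) = θ' (d x))
    (p : R[X]) (x : M) : d (aeval θ p x) = aeval θ' p (d x) := by
  induction p using Polynomial.induction_on' with
  | add f g hf hg => simp [hf, hg]
  | monomial n a =>
    simp only [aeval_monomial, Module.End.mul_apply, Module.algebraMap_end_apply, map_smul]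
    congr 1
    induction n generalizing x with
    | zero => rfl
    | succ n ih => rw [pow_succ, pow_succ, Module.End.mul_apply, Module.End.mul_apply, ih, h]

/-- On homology p(θ) = 0, so -p(1) factors through 1 - θ; when p(1) is a unit, 1 - θ is onto. Here
the cycle itself is written as a boundary plus a value of 1 - θ. -/
theorem exists_eq_add_of_isUnit_eval {M₂ M₁ M₀ : Type*} [AddCommGroup M₂] [Module R M₂]
    [AddCommGroup M₁] [Module R M₁] [AddCommGroup M₀] [Module R M₀]
    {θ₁ : Module.End R M₁} {d₂ : M₂ →ₗ[R] M₁} {d₁ : M₁ →ₗ[R] M₀}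
    {p₁ : R[X]} (hp₁ : IsUnit (p₁.eval 1))
    (hM₁ : ∀ x, d₁ x = 0 → ∃ y, d₂ y = aeval θ₁ p₁ x) {z : M₁} (hz : d₁ z = 0) :
    ∃ w v, z = d₂ w + (v - θ₁ v) := by
  obtain ⟨y, hy⟩ := hM₁ z hz
  obtain ⟨q, hq⟩ := exists_aeval_eq_eval_one_add θ₁ p₁
  obtain ⟨b, hb⟩ := hp₁.exists_left_inv
  refine ⟨b • y, -(b • aeval θ₁ q z), ?_⟩
  have h := (hq z).symm.trans hy.symm
  have h2 := congrArg (b • ·) (eq_sub_of_add_eq h)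
  simp only [smul_smul, hb, one_smul, smul_sub] at h2
  rw [map_smul, map_neg, map_smul]
  refine h2.trans ?_
  abel

/-- Exactness of the complex of coinvariants of an endomorphism `θ`: the `θ`-homology is
annihilated by polynomials whose value at `1` is a unit. -/
theorem exact_coinvariants {M₂ M₁ M₀ M' : Type*} [AddCommGroup M₂] [Module R M₂]
    [AddCommGroup M₁] [Module R M₁] [AddCommGroup M₀] [Module R M₀] [AddCommGroup M'] [Module R M']
    {θ₁ : Module.End R M₁} {θ₀ : Module.End R M₀} {θ' : Module.End R M'}
    {d₂ : M₂ →ₗ[R] M₁} {d₁ : M₁ →ₗ[R] M₀} {d₀ : M₀ →ₗ[R] M'} (hdd₀ : ∀ x, d₀ (d₁ x) = 0)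
    (h₁ : ∀ x, d₁ (θ₁ x) = θ₀ (d₁ x))
    (h₀ : ∀ x, d₀ (θ₀ x) = θ' (d₀ x)) (hinj' : ∀ x, x - θ' x = 0 → x = 0)
    {p₁ p₀ : R[X]} (hp₁ : IsUnit (p₁.eval 1)) (hp₀ : IsUnit (p₀.eval 1))
    (hM₁ : ∀ x, d₁ x = 0 → ∃ y, d₂ y = aeval θ₁ p₁ x)
    (hM₀ : ∀ x, d₀ x = 0 → ∃ y, d₁ y = aeval θ₀ p₀ x)
    {z : M₁} (hz : ∃ y, d₁ z = y - θ₀ y) : ∃ w v, z = d₂ w + (v - θ₁ v) := by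
  obtain ⟨y, hy⟩ := hz
  -- 1 - θ' takes d₀ y to d₀ d₁ z = 0, and it is injective on chains.
  have hy0 : d₀ y = 0 := by
    refine hinj' _ ?_
    rw [← h₀, ← map_sub, ← hy, hdd₀]
  obtain ⟨y', hy'⟩ := hM₀ y hy0
  obtain ⟨q, hq⟩ := exists_aeval_eq_eval_one_add θ₀ p₀
  obtain ⟨b, hb⟩ := hp₀.exists_left_inv
  -- From p₀(1) y = d₁ y' - (1 - θ) q(θ) y, divided by the unit p₀(1). The term at 0 vanishes.
  have hy1 : y = d₁ (b • (y' + aeval θ₁ q (0 : M₁))) - b • (aeval θ₀ q y - θ₀ (aeval θ₀ q y)) := by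
    have h := (hq y).symm.trans hy'.symm
    have h2 := congrArg (b • ·) (eq_sub_of_add_eq h)
    simp only [smul_smul, hb, one_smul] at h2
    rw [map_zero, add_zero, map_smul, ← smul_sub]
    exact h2
  rw [map_zero, add_zero] at hy1
  -- The formula for y, substituted in d₁ z = (1 - θ) y, shows how to change z by values of 1 - θ
  -- into a genuine cycle.
  have hz' : d₁ (z - (b • y' - θ₁ (b • y')) + b • (aeval θ₁ q z - θ₁ (aeval θ₁ q z))) = 0 := by
    have e1 : d₁ (aeval θ₁ q z) = aeval θ₀ q y - θ₀ (aeval θ₀ q y) := by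
      rw [aeval_comm h₁, hy, map_sub]
      congr 1
      exact (aeval_comm (θ := θ₀) (θ' := θ₀) (d := θ₀) (fun _ => rfl) q y).symm
    have e2 := congrArg (fun y => y - θ₀ y) hy1
    rw [← hy] at e2
    simp only [map_add, map_sub, map_smul, h₁, e1, e2, smul_sub]
    abel
  obtain ⟨w, v, h⟩ := exists_eq_add_of_isUnit_eval hp₁ hM₁ hz'
  refine ⟨w, v + b • y' - b • aeval θ₁ q z, ?_⟩
  have h3 : z = (d₂ w + (v - θ₁ v)) + (b • y' - θ₁ (b • y')) -
      b • (aeval θ₁ q z - θ₁ (aeval θ₁ q z)) := by rw [← h]; abel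
  refine h3.trans ?_
  simp only [map_sub, map_add, map_smul, smul_sub]
  abel

end LinearAlgebra

/-! ### Coinvariants -/

section Coinvariants

open scoped TensorProduct

variable {π : Type*} [Group π] {R : Type*} [CommRing R] {V : Type*} [AddCommGroup V] [Module R V]
  (ρ : πᵐᵒᵖ →* Module.End R V) {C C' C'' : Type*} [AddCommGroup C] [Module ℤ C]
  [AddCommGroup C'] [Module ℤ C'] [AddCommGroup C''] [Module ℤ C'']
  (a : π →* Module.End ℤ C) (a' : π →* Module.End ℤ C') (N : Subgroup π)

/-- The relations `v g ⊗ c = v ⊗ g c`, for `g` in a subgroup. -/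
def coinvRel : Submodule R (V ⊗[ℤ] C) :=
  Submodule.span R {x | ∃ g ∈ N, ∃ (v : V) (c : C),
    x = ρ (MulOpposite.op g) v ⊗ₜ[ℤ] c - v ⊗ₜ[ℤ] a g c}

theorem mem_coinvRel {g : π} (hg : g ∈ N) (v : V) (c : C) :
    ρ (MulOpposite.op g) v ⊗ₜ[ℤ] c - v ⊗ₜ[ℤ] a g c ∈ coinvRel ρ a N :=
  Submodule.subset_span ⟨g, hg, v, c, rfl⟩

variable (R V) in
/-- The map induced on tensor products by a map of the right factors. -/
abbrev lT (f : C →ₗ[ℤ] C') : V ⊗[ℤ] C →ₗ[R] V ⊗[ℤ] C' :=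
  TensorProduct.AlgebraTensorModule.map LinearMap.id f

variable {a a' N}

theorem lT_mem {f : C →ₗ[ℤ] C'} (hf : ∀ g ∈ N, ∀ c, f (a g c) = a' g (f c)) :
    coinvRel ρ a N ≤ (coinvRel ρ a' N).comap (lT R V f) := by
  refine Submodule.span_le.2 ?_
  rintro _ ⟨g, hg, v, c, rfl⟩
  simp only [SetLike.mem_coe, Submodule.mem_comap, map_sub,
    TensorProduct.AlgebraTensorModule.map_tmul, LinearMap.id_apply, hf g hg]
  exact mem_coinvRel ρ a' N hg v (f c)

variable (a) in
/-- The operator `v ⊗ c ↦ v t ⊗ t⁻¹ c`. -/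
def twist (t : π) : V ⊗[ℤ] C →ₗ[R] V ⊗[ℤ] C :=
  TensorProduct.AlgebraTensorModule.map (ρ (MulOpposite.op t)) (a t⁻¹)

@[simp] theorem twist_tmul (t : π) (v : V) (c : C) :
    twist ρ a t (v ⊗ₜ c) = ρ (MulOpposite.op t) v ⊗ₜ a t⁻¹ c := rfl

/-- The twist takes the relation of g to that of t⁻¹gt, which again lies in the normal subgroup. -/
theorem twist_mem [N.Normal] (t : π) : coinvRel ρ a N ≤ (coinvRel ρ a N).comap (twist ρ a t) := by
  refine Submodule.span_le.2 ?_
  rintro _ ⟨g, hg, v, c, rfl⟩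
  have h1 : ρ (MulOpposite.op t) (ρ (MulOpposite.op g) v) =
      ρ (MulOpposite.op (t⁻¹ * g * t)) (ρ (MulOpposite.op t) v) := by
    rw [← Module.End.mul_apply, ← Module.End.mul_apply, ← map_mul, ← map_mul, ← MulOpposite.op_mul,
      ← MulOpposite.op_mul]
    congr 3
    group
  have h2 : a t⁻¹ (a g c) = a (t⁻¹ * g * t) (a t⁻¹ c) := by
    rw [← Module.End.mul_apply, ← Module.End.mul_apply, ← map_mul, ← map_mul]
    congr 2
    group
  simp only [SetLike.mem_coe, Submodule.mem_comap, map_sub, twist_tmul, h1, h2]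
  refine mem_coinvRel ρ a N ?_ _ _
  simpa using ‹N.Normal›.conj_mem g hg t⁻¹

theorem lT_twist {f : C →ₗ[ℤ] C'} {t : π} (hf : ∀ c, f (a t⁻¹ c) = a' t⁻¹ (f c)) (x : V ⊗[ℤ] C) :
    lT R V f (twist ρ a t x) = twist ρ a' t (lT R V f x) := by
  induction x using TensorProduct.induction_on with
  | zero => simp
  | tmul v c => simp [hf]
  | add x y hx hy => simp only [map_add, hx, hy]

/-- The relations of the whole group follow from those of a normal subgroup and those of an
element `t` that generates the quotient. -/
theorem coinvRel_top_le {t : π} (ht : ∀ g : π, ∃ n ∈ N, ∃ m : ℤ, g = n * t ^ m) :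
    coinvRel ρ a ⊤ ≤ coinvRel ρ a N ⊔ LinearMap.range (LinearMap.id - twist ρ a t) := by
  set Q := coinvRel ρ a N ⊔ LinearMap.range (LinearMap.id - twist ρ a t)
  -- The elements whose relations hold modulo Q form a subgroup; it contains N and t, hence
  -- everything.
  let T : Subgroup π :=
    { carrier := {g | ∀ (v : V) (c : C), ρ (MulOpposite.op g) v ⊗ₜ[ℤ] c - v ⊗ₜ[ℤ] a g c ∈ Q}
      one_mem' := fun v c => by simp
      mul_mem' := fun {g h} hg hh v c => by
        have := Q.add_mem (hh (ρ (MulOpposite.op g) v) c) (hg v (a h c))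
        rwa [sub_add_sub_cancel, ← Module.End.mul_apply, ← Module.End.mul_apply, ← map_mul,
          ← map_mul, ← MulOpposite.op_mul] at this
      inv_mem' := fun {g} hg v c => by
        have := Q.neg_mem (hg (ρ (MulOpposite.op g⁻¹) v) (a g⁻¹ c))
        rw [neg_sub, ← Module.End.mul_apply, ← Module.End.mul_apply, ← map_mul,
          ← map_mul, ← MulOpposite.op_mul] at this
        simpa using this }
  have hN : N ≤ T := fun g hg v c => Submodule.mem_sup_left (mem_coinvRel ρ a N hg v c)
  have htT : t ∈ T := fun v c => by
    refine Submodule.mem_sup_right ⟨-(v ⊗ₜ a t c), ?_⟩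
    rw [LinearMap.sub_apply, LinearMap.id_apply, map_neg, twist_tmul, ← Module.End.mul_apply (a t⁻¹),
      ← map_mul]
    simp
    abel
  refine Submodule.span_le.2 ?_
  rintro _ ⟨g, -, v, c, rfl⟩
  obtain ⟨n, hn, m, rfl⟩ := ht g
  exact T.mul_mem (hN hn) (T.zpow_mem htT m) v c

section Basis

variable {B : Type*} {b : π →* Module.End ℤ (B →₀ ℤ)}

/-- The relation of t at t⁻¹c says that v ⊗ c equals its twist, so passing to all coinvariants
identifies the twist with 1. -/
theorem twist_sub_range_le (t : π) :
    LinearMap.range (LinearMap.id - twist ρ a t) ≤ coinvRel ρ a ⊤ := by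
  rintro _ ⟨x, rfl⟩
  induction x using TensorProduct.induction_on with
  | zero => simp
  | tmul v c =>
    have h := mem_coinvRel ρ a ⊤ (Subgroup.mem_top t) v (a t⁻¹ c)
    rw [← Module.End.mul_apply (a t), ← map_mul, mul_inv_cancel, map_one, Module.End.one_apply] at h
    have := Submodule.neg_mem _ h
    rwa [neg_sub] at this
  | add x y hx hy => rw [map_add]; exact Submodule.add_mem _ hx hy

theorem coinvRel_mono {N N' : Subgroup π} (h : N ≤ N') : coinvRel ρ a N ≤ coinvRel ρ a N' := by
  refine Submodule.span_mono ?_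
  rintro _ ⟨g, hg, v, c, rfl⟩
  exact ⟨g, h hg, v, c, rfl⟩

/-- A twist is injective on the coinvariants under a normal subgroup that acts freely on a basis,
if there is a height function on the basis. -/
theorem mem_coinvRel_of_sub_twist_mem {β : π → B → B} (hβ1 : ∀ x, β 1 x = x)
    (hβ : ∀ g h x, β (g * h) x = β g (β h x))
    (hb : ∀ g x, b g (Finsupp.single x 1) = Finsupp.single (β g x) 1) [N.Normal]
    (hfree : ∀ g ∈ N, ∀ x, β g x = x → g = 1) {ht : B → ℝ} {c : π → ℝ}
    (hht : ∀ g x, ht (β g x) = ht x + c g) (hN : ∀ g ∈ N, c g = 0) {t : π} (hct : 0 < c t⁻¹)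
    {x : V ⊗[ℤ] (B →₀ ℤ)} (hx : x - twist ρ b t x ∈ coinvRel ρ b N) : x ∈ coinvRel ρ b N := by
  classical
  -- γ(x) is the element of N that carries the representative of the N-orbit of x to x.
  obtain ⟨γ, hγ⟩ := exists_equivariant (G := N) (P := Set.univ) (fun g x => β g.1 x)
    (fun g h => g * h) hβ1 (fun g h => hβ g.1 h.1) (fun g h m => mul_assoc g h m)
    (fun _ _ _ => trivial) (fun g x _ h => Subtype.ext (hfree g.1 g.2 x h)) (fun _ _ => True)
    (fun _ _ _ _ _ => trivial) (fun _ _ => ⟨1, trivial⟩)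
  have hγ' (g : N) (x : B) : γ (β g.1 x) = g * γ x := (hγ x trivial).2 g
  let rep (x : B) : B := β (γ x).1⁻¹ x
  have hrep (g : N) (x : B) : rep (β g.1 x) = rep x := by
    simp only [rep, hγ', ← hβ]
    congr 1
    simp
  let e := TensorProduct.finsuppScalarRight ℤ R V B
  have he (v : V) (x : B) : e (v ⊗ₜ Finsupp.single x 1) = Finsupp.single x v := by
    refine (TensorProduct.finsuppScalarRight_apply_tmul v _).trans ?_
    rw [Finsupp.sum_single_index] <;> simp
  -- Normal forms: v ⊗ x = v ⊗ γ(x) rep(x) is rewritten as vγ(x) ⊗ rep(x). Two tensors agree in the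
  -- coinvariants exactly if their normal forms agree.
  let σ : (B →₀ V) →ₗ[R] (B →₀ V) := Finsupp.lsum R fun x =>
    (Finsupp.lsingle (rep x)).comp (ρ (MulOpposite.op (γ x).1))
  let τ : V ⊗[ℤ] (B →₀ ℤ) →ₗ[R] (B →₀ V) := σ ∘ₗ e.toLinearMap
  have hτ (v : V) (x : B) : τ (v ⊗ₜ Finsupp.single x 1) =
      Finsupp.single (rep x) (ρ (MulOpposite.op (γ x).1) v) := by
    simp [τ, σ, he]
  have hsingle (x : B) (m : ℤ) : Finsupp.single x m = m • Finsupp.single x (1 : ℤ) := by simp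
  have hτrel : coinvRel ρ b N ≤ LinearMap.ker τ := by
    refine Submodule.span_le.2 ?_
    rintro _ ⟨g, hg, v, c, rfl⟩
    rw [SetLike.mem_coe, LinearMap.mem_ker, map_sub, sub_eq_zero]
    induction c using Finsupp.induction_linear with
    | zero => simp
    | add c c' h h' => rw [map_add, TensorProduct.tmul_add, TensorProduct.tmul_add, map_add, map_add,
        h, h']
    | single x m =>
      rw [hsingle, map_smul, TensorProduct.tmul_smul, TensorProduct.tmul_smul, map_zsmul, map_zsmul,
        hb, hτ, hτ]
      have h1 := hrep ⟨g, hg⟩ x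
      have h2 := hγ' ⟨g, hg⟩ x
      simp only at h1 h2
      rw [h1, h2, Subgroup.coe_mul, MulOpposite.op_mul, map_mul]
      rfl
  have hστ (x : V ⊗[ℤ] (B →₀ ℤ)) : x - e.symm (τ x) ∈ coinvRel ρ b N := by
    induction x using TensorProduct.induction_on with
    | zero => simp
    | add x y hx hy =>
      rw [map_add, map_add, add_sub_add_comm]
      exact Submodule.add_mem _ hx hy
    | tmul v c =>
      induction c using Finsupp.induction_linear with
      | zero => simp
      | add c c' h h' =>
        rw [TensorProduct.tmul_add, map_add, map_add, add_sub_add_comm]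
        exact Submodule.add_mem _ h h'
      | single x m =>
        rw [hsingle, TensorProduct.tmul_smul, map_zsmul, map_zsmul, ← smul_sub]
        refine zsmul_mem ?_ m
        rw [hτ, ← he, e.symm_apply_apply]
        have := Submodule.neg_mem _ (mem_coinvRel ρ b N (γ x).2 v (Finsupp.single (rep x) 1))
        rw [neg_sub, hb, ← hβ] at this
        simpa [hβ1] using this
  have key : τ x = τ (twist ρ b t (e.symm (τ x))) := by
    have h1 := hτrel hx
    rw [LinearMap.mem_ker, map_sub, sub_eq_zero] at h1
    have h2 := hτrel (twist_mem ρ t (hστ x))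
    rw [LinearMap.mem_ker, map_sub, map_sub, sub_eq_zero] at h2
    rw [← h2, ← h1]
  -- The twist raises heights by c(t⁻¹), and passing to representatives leaves them unchanged
  -- because c vanishes on N.
  have hsupp (m : ℝ) (y : B →₀ V) (hy : ∀ x ∈ y.support, m ≤ ht x) :
      ∀ x ∈ (τ (twist ρ b t (e.symm y))).support, m + c t⁻¹ ≤ ht x := by
    have : τ (twist ρ b t (e.symm y)) ∈ Finsupp.supported V R {x | m + c t⁻¹ ≤ ht x} := by
      have h4 := congrArg (fun y => τ (twist ρ b t (e.symm y))) y.sum_single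
      rw [← h4, Finsupp.sum, map_sum, map_sum, map_sum]
      refine Submodule.sum_mem _ fun x hx => ?_
      rw [← he, e.symm_apply_apply, twist_tmul, hb, hτ]
      refine Finsupp.single_mem_supported R _ ?_
      simp only [Set.mem_ofPred_eq, rep, hht]
      rw [hN _ (N.inv_mem (γ _).2)]
      linarith [hy x hx]
    intro x hx
    exact (Finsupp.mem_supported R _).1 this hx
  -- A nonzero normal form fixed by the twist would have a lowest basis element in its finite
  -- support, which the twist pushes strictly upwards.
  have h0 : τ x = 0 := by
    by_contra hne
    obtain ⟨x₀, hx₀, hmin⟩ := (τ x).support.exists_min_image ht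
      (Finsupp.support_nonempty_iff.2 hne)
    have h3 := hsupp (ht x₀) (τ x) hmin x₀ (by rw [← key]; exact hx₀)
    linarith
  have := hστ x
  rwa [h0, map_zero, sub_zero] at this

end Basis

end Coinvariants

/-! ### Coinvariants of singular chains under ker ξ, and exactness from domination. -/

section Exactness

open scoped TensorProduct Polynomial

variable {π : Type*} [Group π] {X : Type*} [TopologicalSpace X] [MulAction π X]
  [ContinuousConstSMul π X]

instance Subgroup.instContinuousConstSMul (N : Subgroup π) : ContinuousConstSMul N X :=
  ⟨fun g => continuous_const_smul g.1⟩

variable (π X) in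
/-- The action on singular chains. -/
def SC.action (n : ℕ) : π →* Module.End ℤ (SC n X) where
  toFun g := SC.map (smulMap g) n
  map_one' := LinearMap.ext fun c => by rw [smulMap_one, SC.map_id]; rfl
  map_mul' g h := LinearMap.ext fun c => by rw [smulMap_mul, ← SC.map_comp]; rfl

variable (π X) in
/-- The action on tuple chains. -/
def TupleChain.action : π →* Module.End ℤ (TupleChain X) where
  toFun g := TupleChain.map (smulMap g)
  map_one' := linExt_hom_ext fun c => by simp [smulMap_one]
  map_mul' g h := linExt_hom_ext fun c => by simp [smulMap_mul]

variable {R : Type*} [CommRing R] {V : Type*} [AddCommGroup V] [Module R V]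
  (ρ : πᵐᵒᵖ →* Module.End R V) (N : Subgroup π)

theorem lT_zero {C C' : Type*} [AddCommGroup C] [Module ℤ C] [AddCommGroup C'] [Module ℤ C']
    (x : V ⊗[ℤ] C) : lT R V (0 : C →ₗ[ℤ] C') x = 0 := by
  induction x using TensorProduct.induction_on with
  | zero => simp
  | tmul v c => simp
  | add x y hx hy => rw [map_add, hx, hy, add_zero]

/-- The coinvariants `V ⊗_{ℤ[N]} C`. -/
abbrev Coinv {C : Type*} [AddCommGroup C] [Module ℤ C] (a : π →* Module.End ℤ C) :=
  (V ⊗[ℤ] C) ⧸ coinvRel ρ a N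

/-- The map of coinvariants induced by an equivariant map. -/
def coinvMap {C C' : Type*} [AddCommGroup C] [Module ℤ C] [AddCommGroup C'] [Module ℤ C']
    {a : π →* Module.End ℤ C} {a' : π →* Module.End ℤ C'} (f : C →ₗ[ℤ] C')
    (hf : ∀ g ∈ N, ∀ c, f (a g c) = a' g (f c)) : Coinv ρ N a →ₗ[R] Coinv ρ N a' :=
  Submodule.mapQ _ _ (lT R V f) (lT_mem ρ hf)

/-- The twist operator on coinvariants. -/
def coinvTwist [N.Normal] {C : Type*} [AddCommGroup C] [Module ℤ C]
    (a : π →* Module.End ℤ C) (t : π) : Module.End R (Coinv ρ N a) :=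
  Submodule.mapQ _ _ (twist ρ a t) (twist_mem ρ t)

theorem coinv_induction {C : Type*} [AddCommGroup C] [Module ℤ C] {a : π →* Module.End ℤ C}
    {p : Coinv ρ N a → Prop} (x : Coinv ρ N a) (h0 : p 0) (hadd : ∀ x y, p x → p y → p (x + y))
    (h : ∀ (v : V) (c : C), p (Submodule.Quotient.mk (v ⊗ₜ c))) : p x := by
  obtain ⟨x, rfl⟩ := Submodule.Quotient.mk_surjective _ x
  induction x using TensorProduct.induction_on with
  | zero => exact h0
  | tmul v c => exact h v c
  | add x y hx hy => exact hadd _ _ hx hy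

theorem coinvMap_coinvTwist [N.Normal] {C C' : Type*} [AddCommGroup C] [Module ℤ C]
    [AddCommGroup C'] [Module ℤ C'] {a : π →* Module.End ℤ C} {a' : π →* Module.End ℤ C'}
    (f : C →ₗ[ℤ] C') (hf : ∀ g c, f (a g c) = a' g (f c)) (t : π) (x : Coinv ρ N a) :
    coinvMap ρ N f (fun g _ => hf g) (coinvTwist ρ N a t x) =
      coinvTwist ρ N a' t (coinvMap ρ N f (fun g _ => hf g) x) := by
  obtain ⟨x, rfl⟩ := Submodule.Quotient.mk_surjective _ x
  exact congrArg Submodule.Quotient.mk (lT_twist ρ (hf t⁻¹) x)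

theorem SC.d_action (n : ℕ) (g : π) (c : SC (n + 1) X) :
    SC.d n (SC.action π X (n + 1) g c) = SC.action π X n g (SC.d n c) :=
  (SC.map_d (smulMap g) n c).symm

/-- The boundary operators on coinvariants of singular chains. -/
def coinvD (n : ℕ) : Coinv ρ N (SC.action π X (n + 1)) →ₗ[R] Coinv ρ N (SC.action π X n) :=
  coinvMap ρ N (SC.d n) fun g _ => SC.d_action n g

theorem SC.bd_map {Y : Type*} [TopologicalSpace Y] (f : C(X, Y)) (n : ℕ) (c : SC n X) :
    SC.bd n (SC.map f n c) = SC.map f (n - 1) (SC.bd n c) := by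
  cases n with
  | zero => simp [bd]
  | succ n => exact (SC.map_d f n c).symm

theorem SC.bd_action (n : ℕ) (g : π) (c : SC n X) :
    SC.bd n (SC.action π X n g c) = SC.action π X (n - 1) g (SC.bd n c) :=
  SC.bd_map (smulMap g) n c

/-- The boundary operators on coinvariants of singular chains, in all degrees. -/
def coinvBd (n : ℕ) : Coinv ρ N (SC.action π X n) →ₗ[R] Coinv ρ N (SC.action π X (n - 1)) :=
  coinvMap ρ N (SC.bd n) fun g _ => SC.bd_action n g

theorem SC.bd_d (n : ℕ) (c : SC (n + 1) X) : SC.bd n (SC.d n c) = 0 := by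
  cases n with
  | zero => rfl
  | succ n => exact SC.d_d n c

theorem coinvBd_coinvD (n : ℕ) (x : Coinv ρ N (SC.action π X (n + 1))) :
    coinvBd ρ N n (coinvD ρ N n x) = 0 := by
  refine coinv_induction ρ N (p := fun x => coinvBd ρ N n (coinvD ρ N n x) = 0) x (by simp)
    (fun x y hx hy => by rw [map_add, map_add, hx, hy, add_zero])
    fun v c => ?_
  change Submodule.Quotient.mk (v ⊗ₜ SC.bd n (SC.d n c)) = _
  rw [SC.bd_d, TensorProduct.tmul_zero]
  rfl

theorem coinvD_coinvTwist [N.Normal] (n : ℕ) (t : π) (x : Coinv ρ N (SC.action π X (n + 1))) :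
    coinvD ρ N n (coinvTwist ρ N _ t x) = coinvTwist ρ N _ t (coinvD ρ N n x) :=
  coinvMap_coinvTwist ρ N (SC.d n) (SC.d_action n) t x

theorem coinvBd_coinvTwist [N.Normal] (n : ℕ) (t : π) (x : Coinv ρ N (SC.action π X n)) :
    coinvBd ρ N n (coinvTwist ρ N _ t x) = coinvTwist ρ N _ t (coinvBd ρ N n x) :=
  coinvMap_coinvTwist ρ N (SC.bd n) (SC.bd_action n) t x

/-- The hypotheses on the coefficients: `V` is spanned by a finite set whose span over a subring `A`
is preserved by `N` and, up to the unit `c`, by `t`. -/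
structure CoefficientLattice (t : π) where
  A : Subring R
  c : Rˣ
  k : ℕ
  e : Fin k → V
  span_eq_top : Submodule.span R (Set.range e) = ⊤
  smul_mem : ∀ g ∈ N, ∀ j, ρ (MulOpposite.op g) (e j) ∈ Submodule.span A (Set.range e)
  twist_mem : ∀ j, (c⁻¹ : Rˣ) • ρ (MulOpposite.op t) (e j) ∈ Submodule.span A (Set.range e)
  isUnit : ∀ χ : A[X], χ.Monic → IsUnit ((χ.map A.subtype).eval ((c⁻¹ : Rˣ) : R))

-- The input for `exact_coinvariants`: a polynomial in the twist that annihilates homology and has a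
-- unit value at 1. The lattice is the A-span of the elements e_j ⊗ l, with l among the finitely
-- many tuples of the domination.
set_option maxHeartbeats 2000000 in
theorem exists_polynomial [N.Normal] {t : π} (Λ : CoefficientLattice ρ N t) {i : ℕ}
    (hdom : SC.IsDominated N X i) : ∃ p : R[X], IsUnit (p.eval 1) ∧
      ∀ x, coinvBd (X := X) ρ N i x = 0 →
        ∃ y, coinvD ρ N i y = Polynomial.aeval (coinvTwist ρ N (SC.action π X i) t) p x := by
  obtain ⟨I, S, K, K', L, hK, hIg, hSg, hKg, hKg', hL, hIL⟩ := hdom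
  let I' : Coinv ρ N (SC.action π X i) →ₗ[R] Coinv ρ N (TupleChain.action π X) :=
    coinvMap ρ N I fun g hg c => hIg ⟨g, hg⟩ c
  let S' : Coinv ρ N (TupleChain.action π X) →ₗ[R] Coinv ρ N (SC.action π X i) :=
    coinvMap ρ N S fun g hg c => hSg ⟨g, hg⟩ c
  let θ := coinvTwist ρ N (SC.action π X i) t
  let B : Set (Coinv ρ N (TupleChain.action π X)) :=
    Set.image2 (fun j l => Submodule.Quotient.mk (Λ.e j ⊗ₜ Finsupp.single l 1)) Set.univ L
  have hB : B.Finite := Set.finite_univ.image2 _ hL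
  have h1 (l : List X) (hl : l ∈ L) (v : V) (hv : v ∈ Submodule.span Λ.A (Set.range Λ.e)) :
      (Submodule.Quotient.mk (v ⊗ₜ Finsupp.single l 1) : Coinv ρ N (TupleChain.action π X)) ∈
        Submodule.span Λ.A B := by
    induction hv using Submodule.span_induction with
    | mem v hv =>
      obtain ⟨j, rfl⟩ := hv
      exact Submodule.subset_span ⟨j, trivial, l, hl, rfl⟩
    | zero => rw [TensorProduct.zero_tmul]; exact Submodule.zero_mem _
    | add v w _ _ hv hw => rw [TensorProduct.add_tmul]; exact Submodule.add_mem _ hv hw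
    | smul r v _ hv => exact Submodule.smul_mem _ r hv
  -- In the coinvariants e_j ⊗ gl equals e_j g ⊗ l, and N preserves the A-span of the e_j; so only
  -- the finitely many representatives l matter.
  have h2 (c : SC i X) (j : Fin Λ.k) :
      (Submodule.Quotient.mk (Λ.e j ⊗ₜ I c) : Coinv ρ N (TupleChain.action π X)) ∈
        Submodule.span Λ.A B := by
    let f : TupleChain X →ₗ[ℤ] Coinv ρ N (TupleChain.action π X) :=
      ((Submodule.mkQ (coinvRel ρ (TupleChain.action π X) N)).restrictScalars ℤ) ∘ₗ
        TensorProduct.mk ℤ V (TupleChain X) (Λ.e j)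
    refine map_mem_of_mem_supported (f := f)
      (W := AddSubgroup.toIntSubmodule (Submodule.span Λ.A B).toAddSubgroup) ?_ (hIL c)
    rintro _ ⟨g, l, hl, rfl⟩
    have h3 := mem_coinvRel ρ (TupleChain.action π X) N g.2 (Λ.e j) (Finsupp.single l 1)
    rw [← Submodule.Quotient.eq] at h3
    have h4 : TupleChain.action π X g.1 (Finsupp.single l 1) =
      Finsupp.single (l.map (smulMap g)) 1 := TupleChain.map_single _ _
    rw [h4] at h3
    have h5 := h1 l hl _ (Λ.smul_mem g.1 g.2 j)
    rw [h3] at h5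
    exact h5
  have h3 (c : SC i X) (v : V) (hv : v ∈ Submodule.span Λ.A (Set.range Λ.e)) :
      (Submodule.Quotient.mk (v ⊗ₜ I c) : Coinv ρ N (TupleChain.action π X)) ∈
        Submodule.span Λ.A B := by
    induction hv using Submodule.span_induction with
    | mem v hv =>
      obtain ⟨j, rfl⟩ := hv
      exact h2 c j
    | zero => rw [TensorProduct.zero_tmul]; exact Submodule.zero_mem _
    | add v w _ _ hv hw => rw [TensorProduct.add_tmul]; exact Submodule.add_mem _ hv hw
    | smul r v _ hv => exact Submodule.smul_mem _ r hv
  have hspan : (Submodule.span Λ.A B : Set (Coinv ρ N (TupleChain.action π X))) ⊆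
      Submodule.span R B := by
    intro x hx
    induction hx using Submodule.span_induction with
    | mem x hx => exact Submodule.subset_span hx
    | zero => exact Submodule.zero_mem _
    | add x y _ _ hx hy => exact Submodule.add_mem _ hx hy
    | smul r x _ hx => exact Submodule.smul_mem _ (r : R) hx
  obtain ⟨χ, hχ, h⟩ := exists_monic_aeval_mem_range Λ.A (coinvD ρ N i) (coinvBd ρ N i)
    (coinvBd_coinvD ρ N i) ((Λ.c⁻¹ : Rˣ) • coinvTwist ρ N (SC.action π X i) t)
    ((Λ.c⁻¹ : Rˣ) • coinvTwist ρ N (SC.action π X (i + 1)) t)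
    ((Λ.c⁻¹ : Rˣ) • coinvTwist ρ N (SC.action π X (i - 1)) t)
    (fun x => by simp only [Units.smul_def, LinearMap.smul_apply, map_smul, coinvD_coinvTwist])
    (fun x => by simp only [Units.smul_def, LinearMap.smul_apply, map_smul, coinvBd_coinvTwist]) I' S'
    (coinvMap ρ N K fun g hg c => hKg ⟨g, hg⟩ c) (coinvMap ρ N K' fun g hg c => hKg' ⟨g, hg⟩ c)
    (fun x => by
      refine coinv_induction ρ N (p := fun x => S' (I' x) - x = coinvD ρ N i
        (coinvMap ρ N K (fun g hg c => hKg ⟨g, hg⟩ c) x) + coinvMap ρ N K'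
        (fun g hg c => hKg' ⟨g, hg⟩ c) (coinvBd ρ N i x)) x (by simp) (fun x y hx hy => ?_)
        fun v c => ?_
      · simp only [map_add, add_sub_add_comm, hx, hy]
        abel
      · change Submodule.Quotient.mk (v ⊗ₜ S (I c) - v ⊗ₜ c) =
          Submodule.Quotient.mk (v ⊗ₜ SC.d i (K c) + v ⊗ₜ K' (SC.bd i c))
        rw [← TensorProduct.tmul_sub, hK, TensorProduct.tmul_add]) hB
    (fun x => by
      refine coinv_induction ρ N (p := fun x => I' x ∈ Submodule.span R B) x (by simp)
        (fun x y hx hy => ?_) fun v c => ?_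
      · rw [map_add]; exact Submodule.add_mem _ hx hy
      · have hv : v ∈ Submodule.span R (Set.range Λ.e) := by rw [Λ.span_eq_top]; trivial
        change Submodule.Quotient.mk (v ⊗ₜ I c) ∈ Submodule.span R B
        induction hv using Submodule.span_induction with
        | mem v hv =>
          obtain ⟨j, rfl⟩ := hv
          exact hspan (h2 c j)
        | zero => rw [TensorProduct.zero_tmul]; exact Submodule.zero_mem _
        | add v w _ _ hv hw => rw [TensorProduct.add_tmul]; exact Submodule.add_mem _ hv hw
        | smul r v _ hv => exact Submodule.smul_mem _ r hv)
    (by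
      rintro _ ⟨j, -, l, hl, rfl⟩
      -- The rescaled twist, framed by I and S, takes e_j ⊗ l to c⁻¹(e_j t) ⊗ I(t⁻¹S(l)).
      -- Compatibility of I and S with t is not needed.
      exact h3 _ _ (Λ.twist_mem j))
  -- p(X) = χ(c⁻¹X) undoes the rescaling: p(θ) = χ(c⁻¹θ) and p(1) = χ(c⁻¹).
  refine ⟨(χ.map Λ.A.subtype).comp (Polynomial.C ((Λ.c⁻¹ : Rˣ) : R) * Polynomial.X), ?_,
    fun x hx => ?_⟩
  · simpa using Λ.isUnit χ hχ
  · obtain ⟨y, hy⟩ := h x hx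
    refine ⟨y, hy.trans ?_⟩
    rw [Polynomial.aeval_comp]
    congr 2
    simp [Units.smul_def, Algebra.smul_def]

/-- Exactness of the twisted chain complex of a space whose chains are dominated. -/
theorem exact_of_isDominated [N.Normal] {t : π} (Λ : CoefficientLattice ρ N t)
    (ht : ∀ g : π, ∃ n ∈ N, ∃ m : ℤ, g = n * t ^ m)
    (hdom : ∀ i, SC.IsDominated N X i) (hfree : ∀ g ∈ N, ∀ x : X, g • x = x → g = 1)
    {height : X → ℝ} {c : π → ℝ} (hheight : ∀ g x, height (g • x) = height x + c g)
    (hc : ∀ g ∈ N, c g = 0) (hct : 0 < c t⁻¹) (i : ℕ) (z : V ⊗[ℤ] SC i X)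
    (hz : lT R V (SC.bd i) z ∈ coinvRel ρ (SC.action π X (i - 1)) ⊤) :
    ∃ w, z - lT R V (SC.d i) w ∈ coinvRel ρ (SC.action π X i) ⊤ := by
  -- The height of a singular simplex is that of its vertex 0; this vertex also shows that N acts
  -- freely on simplices.
  have hinj (n : ℕ) (x : Coinv ρ N (SC.action π X n)) (hx : x - coinvTwist ρ N _ t x = 0) :
      x = 0 := by
    obtain ⟨x, rfl⟩ := Submodule.Quotient.mk_surjective _ x
    refine (Submodule.Quotient.mk_eq_zero _).2 ?_
    refine mem_coinvRel_of_sub_twist_mem ρ (β := fun g σ => (smulMap g).comp σ)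
      (fun σ => by ext; simp) (fun g h σ => by ext; simp [mul_smul])
      (fun g σ => SC.map_single _ _ _)
      (fun g hg σ h => hfree g hg (σ (stdSimplex.vertex 0)) (DFunLike.congr_fun h _))
      (ht := fun σ => height (σ (stdSimplex.vertex 0))) (fun g σ => hheight g _) hc hct ?_
    exact (Submodule.Quotient.mk_eq_zero _).1 hx
  have hfin (w : Coinv ρ N (SC.action π X (i + 1))) (v : Coinv ρ N (SC.action π X i))
      (h : Submodule.Quotient.mk z = coinvD ρ N i w + (v - coinvTwist ρ N _ t v)) :
      ∃ w, z - lT R V (SC.d i) w ∈ coinvRel ρ (SC.action π X i) ⊤ := by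
    obtain ⟨w, rfl⟩ := Submodule.Quotient.mk_surjective _ w
    obtain ⟨v, rfl⟩ := Submodule.Quotient.mk_surjective _ v
    refine ⟨w, ?_⟩
    have h1 : z - (lT R V (SC.d i) w + (v - twist ρ (SC.action π X i) t v)) ∈
        coinvRel ρ (SC.action π X i) N := (Submodule.Quotient.eq _).1 h
    have h2 := Submodule.add_mem _ (coinvRel_mono ρ le_top h1)
      (twist_sub_range_le ρ (a := SC.action π X i) t ⟨v, rfl⟩)
    rw [LinearMap.sub_apply, LinearMap.id_apply] at h2
    convert h2 using 1
    abel
  obtain ⟨p₁, hp₁, h₁⟩ := exists_polynomial ρ N Λ (hdom i)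
  cases i with
  | zero =>
    -- In degree 0 every chain is a cycle, and surjectivity of 1 - θ on homology suffices.
    obtain ⟨w, v, h⟩ := exists_eq_add_of_isUnit_eval hp₁ h₁ (z := Submodule.Quotient.mk z) (by
      change Submodule.Quotient.mk (lT R V (0 : SC 0 X →ₗ[ℤ] SC (0 - 1) X) z) = _
      rw [lT_zero]
      rfl)
    exact hfin w v h
  | succ i =>
    obtain ⟨p₀, hp₀, h₀⟩ := exists_polynomial ρ N Λ (hdom i)
    -- A cycle for π is, over N, a chain whose boundary has the form (1 - θ)v.
    obtain ⟨y, hy, x, ⟨v, rfl⟩, hxy⟩ := Submodule.mem_sup.1 (coinvRel_top_le ρ ht hz)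
    obtain ⟨w, v, h⟩ := exact_coinvariants (d₂ := coinvD ρ N (i + 1)) (d₁ := coinvD ρ N i)
      (d₀ := coinvBd ρ N i) (z := Submodule.Quotient.mk z) (coinvBd_coinvD ρ N i)
      (coinvD_coinvTwist ρ N i t) (coinvBd_coinvTwist ρ N i t) (hinj _) hp₁ hp₀ h₁ h₀ ⟨Submodule.Quotient.mk v, by
        change Submodule.Quotient.mk (lT R V (SC.bd (i + 1)) z) = _
        rw [← hxy, Submodule.Quotient.mk_add, (Submodule.Quotient.mk_eq_zero _).2 hy, zero_add]
        rfl⟩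
    exact hfin w v h

end Exactness

/-! ### The Novikov ring: a lattice preserved by the action, and units from monic polynomials. -/

section Coefficients

open scoped Polynomial

variable {π : Type v} [Group π] {Γ : Type u} [AddCommGroup Γ] (ψ : π →* Multiplicative Γ)
  (ξ : π →* Multiplicative ℤ) (ξΓ : Γ →+ ℝ) {S : Type w} [CommRing S] [Nontrivial S] {k : ℕ}
  (α : π →* GL (Fin k) S)

variable (S) in
/-- The subring of `𝓡_ξ S[Γ]` generated by `S` and the kernel of `ξ`. -/
def kernelHom : AddMonoidAlgebra S ξΓ.ker →+* RationalNovikov ξΓ S :=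
  (algebraMap (AddMonoidAlgebra S Γ) (RationalNovikov ξΓ S)).comp
    (AddMonoidAlgebra.mapDomainRingHom S ξΓ.ker.subtype)

theorem scalarHom_mem (s : S) : scalarHom ξΓ s ∈ (kernelHom ξΓ S).range := by
  refine ⟨AddMonoidAlgebra.single 0 s, ?_⟩
  simp [kernelHom, scalarHom]

theorem groupElt_mem {γ : Multiplicative Γ} (h : ξΓ γ.toAdd = 0) :
    (groupElt ξΓ γ : RationalNovikov ξΓ S) ∈ (kernelHom ξΓ S).range := by
  refine ⟨AddMonoidAlgebra.single ⟨γ.toAdd, h⟩ 1, ?_⟩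
  simp [kernelHom, groupElt]

theorem mem_span_single_of_forall_mem {R : Type*} [CommRing R] {A : Subring R} {w : Fin k → R}
    (h : ∀ l, w l ∈ A) :
    w ∈ Submodule.span A (Set.range fun j : Fin k => (Pi.single j 1 : Fin k → R)) := by
  have : w = ∑ l, (⟨w l, h l⟩ : A) • (Pi.single l 1 : Fin k → R) := by
    funext j
    simp [Finset.sum_apply, Pi.single_apply, Subring.smul_def]
  rw [this]
  exact Submodule.sum_mem _ fun l _ => Submodule.smul_mem _ _ (Submodule.subset_span ⟨l, rfl⟩)

theorem coefficientAction_single (g : π) (j : Fin k) :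
    coefficientAction ψ ξΓ α (MulOpposite.op g) (Pi.single j 1) = fun l =>
      groupElt ξΓ (ψ g) * scalarHom ξΓ (S := S) ((α g : Matrix (Fin k) (Fin k) S) j l) := by
  funext l
  change ((groupElt ξΓ (ψ g) : RationalNovikov ξΓ S) • Matrix.vecMul (Pi.single j 1) _) l = _
  rw [Matrix.single_one_vecMul]
  rfl

omit [Nontrivial S] in
-- Multiplying an element of S[ker ξ] by γ puts it on the single level ξ(γ); distinct powers of γ
-- with ξ(γ) > 0 thus occupy distinct levels.
theorem coeff_support_mul_single {x : AddMonoidAlgebra S ξΓ.ker} {γ : Γ} {δ : Γ}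
    (h : δ ∈ (AddMonoidAlgebra.mapDomainRingHom S ξΓ.ker.subtype x *
      AddMonoidAlgebra.single γ 1).coeff.support) : ξΓ δ = ξΓ γ := by
  classical
  obtain ⟨a, ha, b, hb, rfl⟩ := Finset.mem_add.1 (AddMonoidAlgebra.support_coeff_mul_subset _ _ h)
  have ha' : ξΓ a = 0 := by
    obtain ⟨a, -, rfl⟩ := Finset.mem_image.1
      (Finsupp.mapDomain_support (f := ξΓ.ker.subtype) (s := x.coeff) ha)
    exact a.2
  have hb' : b = γ := by
    by_contra hne
    rw [Finsupp.mem_support_iff, AddMonoidAlgebra.coeff_single, Finsupp.single_eq_of_ne hne] at hb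
    exact hb rfl
  rw [map_add, ha', zero_add, hb']

/-- The value is the image of P = Q + γⁿ, where n = deg χ and Q collects the lower terms, all on
levels below nξ(γ). The leading part of P is the monomial γⁿ, so P is among the inverted elements.
-/
theorem isUnit_eval_of_monic {γ : Multiplicative Γ} (hγ : 0 < ξΓ γ.toAdd)
    {χ : (kernelHom ξΓ S).range[X]} (hχ : χ.Monic) :
    IsUnit ((χ.map (kernelHom ξΓ S).range.subtype).eval (groupElt ξΓ γ)) := by
  choose x hx using fun j => (χ.coeff j).2
  let Q : AddMonoidAlgebra S Γ := ∑ j ∈ Finset.range χ.natDegree,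
    AddMonoidAlgebra.mapDomainRingHom S ξΓ.ker.subtype (x j) * AddMonoidAlgebra.single (j • γ.toAdd) 1
  let P : AddMonoidAlgebra S Γ := Q + AddMonoidAlgebra.single (χ.natDegree • γ.toAdd) 1
  have hQ : ∀ δ ∈ Q.coeff.support, ξΓ δ < χ.natDegree * ξΓ γ.toAdd := by
    intro δ hδ
    rw [Finsupp.mem_support_iff] at hδ
    have h1 : Q.coeff δ = ∑ j ∈ Finset.range χ.natDegree,
        (AddMonoidAlgebra.mapDomainRingHom S ξΓ.ker.subtype (x j) *
          AddMonoidAlgebra.single (j • γ.toAdd) 1).coeff δ := by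
      simp [Q, AddMonoidAlgebra.coeff_sum]
    rw [h1] at hδ
    obtain ⟨j, hj, hj'⟩ := Finset.exists_ne_zero_of_sum_ne_zero hδ
    rw [coeff_support_mul_single ξΓ (Finsupp.mem_support_iff.2 hj'), map_nsmul, nsmul_eq_mul]
    exact mul_lt_mul_of_pos_right (by exact_mod_cast Finset.mem_range.1 hj) hγ
  have hP : P ∈ leadingMonomials ξΓ S := by
    refine (leadingPart_isMonomial_iff ξΓ P).2 ⟨χ.natDegree • γ.toAdd, ?_, fun δ hδ hne => ?_⟩
    · have h2 : Q.coeff (χ.natDegree • γ.toAdd) = 0 := by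
        by_contra h
        have := hQ _ (Finsupp.mem_support_iff.2 h)
        rw [map_nsmul, nsmul_eq_mul] at this
        exact lt_irrefl _ this
      simp [P, h2]
    · rw [map_nsmul, nsmul_eq_mul]
      refine hQ δ ?_
      rw [Finsupp.mem_support_iff] at hδ ⊢
      simpa [P, Finsupp.single_eq_of_ne hne] using hδ
  have := IsLocalization.map_units (RationalNovikov ξΓ S) ⟨P, hP⟩
  convert this using 1
  rw [Polynomial.eval_eq_sum_range, Polynomial.natDegree_map_eq_of_injective Subtype.val_injective,
    Finset.sum_range_succ]
  simp only [P, Q, map_add, map_sum, map_mul, Polynomial.coeff_map]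
  have hpow (j : ℕ) : algebraMap (AddMonoidAlgebra S Γ) (RationalNovikov ξΓ S)
      (AddMonoidAlgebra.single (j • γ.toAdd) 1) = groupElt ξΓ γ ^ j := by
    rw [← map_pow]; rfl
  congr 1
  · refine Finset.sum_congr rfl fun j _ => ?_
    rw [hpow]
    congr 1
    exact (hx j).symm
  · rw [hpow, hχ.coeff_natDegree]
    simp

variable {ξ}

/-- The standard lattice in `𝓡_ξ S[Γ]^k`. -/
def coefficientLattice (hξ : ∀ g, ξΓ (Multiplicative.toAdd (ψ g)) = ((ξ g).toAdd : ℝ)) {t : π}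
    (ht : (ξ t).toAdd < 0) : CoefficientLattice (coefficientAction ψ ξΓ α) ξ.ker t where
  A := (kernelHom ξΓ S).range
  -- Dividing the action of t by ψ(t) leaves the matrix α(t), with entries in S and hence in A.
  c := Units.map (groupElt ξΓ) (toUnits (ψ t))
  k := k
  e j := Pi.single j 1
  span_eq_top := by
    refine eq_top_iff.2 fun w _ => ?_
    have : w = ∑ l, w l • (Pi.single l 1 : Fin k → RationalNovikov ξΓ S) := by
      funext j
      simp [Finset.sum_apply, Pi.single_apply]
    rw [this]
    exact Submodule.sum_mem _ fun l _ => Submodule.smul_mem _ _ (Submodule.subset_span ⟨l, rfl⟩)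
  smul_mem g hg j := by
    rw [coefficientAction_single]
    refine mem_span_single_of_forall_mem fun l => Subring.mul_mem _ ?_ (scalarHom_mem ξΓ _)
    refine groupElt_mem ξΓ ?_
    rw [hξ, MonoidHom.mem_ker.1 hg]
    simp
  twist_mem j := by
    rw [coefficientAction_single]
    refine mem_span_single_of_forall_mem fun l => ?_
    rw [Pi.smul_apply, Units.smul_def, smul_eq_mul, ← mul_assoc]
    have : ((Units.map (groupElt ξΓ) (toUnits (ψ t)))⁻¹ : (RationalNovikov ξΓ S)ˣ).1 *
        groupElt ξΓ (ψ t) = 1 := Units.inv_mul _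
    rw [this, one_mul]
    exact scalarHom_mem ξΓ _
  isUnit χ hχ := isUnit_eval_of_monic ξΓ (γ := (ψ t)⁻¹) (by
    rw [toAdd_inv, map_neg, hξ]
    simpa using ht) hχ

end Coefficients

/-! ### From the categorical singular complex to chains of continuous maps. -/

section Transfer

open scoped TensorProduct

/-- The group of singular chains in terms of continuous maps on the standard simplex. -/
def chainEquiv (X : TopCat.{v}) (n : ℕ) : (singularChains.obj X).X n ≃ₗ[ℤ] SC n X :=
  Finsupp.domLCongr (TopCat.toSSetObjEquiv X (Opposite.op (SimplexCategory.mk n)))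

theorem chainEquiv_single (X : TopCat.{v}) (n : ℕ)
    (σ : (TopCat.toSSet.obj X).obj (Opposite.op (SimplexCategory.mk n))) :
    chainEquiv X n (Finsupp.single σ (1 : ℤ)) = Finsupp.single (TopCat.toSSetObjEquiv X _ σ) 1 :=
  Finsupp.domLCongr_single _ _ _

theorem chainEquiv_map {X Y : TopCat.{v}} (f : X ⟶ Y) (n : ℕ) (c : (singularChains.obj X).X n) :
    chainEquiv Y n (((singularChains.map f).f n).hom c) = SC.map f.hom n (chainEquiv X n c) := by
  have : (chainEquiv Y n).toLinearMap ∘ₗ ((singularChains.map f).f n).hom =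
      SC.map f.hom n ∘ₗ (chainEquiv X n).toLinearMap := by
    refine Finsupp.lhom_ext' fun σ => LinearMap.ext_ring ?_
    have h1 : ((singularChains.map f).f n).hom (Finsupp.single σ (1 : ℤ)) =
      Finsupp.single ((TopCat.toSSet.map f).app _ σ) 1 := Finsupp.mapDomain_single
    change chainEquiv Y n (((singularChains.map f).f n).hom (Finsupp.single σ (1 : ℤ))) =
      SC.map f.hom n (chainEquiv X n (Finsupp.single σ (1 : ℤ)))
    rw [h1, chainEquiv_single, chainEquiv_single, SC.map_single]
    rfl
  exact LinearMap.congr_fun this c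

theorem hom_sum_smul_apply {M N : ModuleCat.{v} ℤ} {ι : Type*} [Fintype ι] (m : ι → ℤ)
    (f : ι → (M ⟶ N)) (x : M) : (∑ i, m i • f i).hom x = ∑ i, m i • (f i).hom x := by
  rw [ModuleCat.hom_sum, LinearMap.sum_apply]
  simp

theorem chainEquiv_d (X : TopCat.{v}) (n : ℕ) (c : (singularChains.obj X).X (n + 1)) :
    chainEquiv X n (((singularChains.obj X).d (n + 1) n).hom c) =
      SC.d n (chainEquiv X (n + 1) c) := by
  have : (chainEquiv X n).toLinearMap ∘ₗ ((singularChains.obj X).d (n + 1) n).hom =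
      SC.d n ∘ₗ (chainEquiv X (n + 1)).toLinearMap := by
    refine Finsupp.lhom_ext' fun σ => LinearMap.ext_ring ?_
    change chainEquiv X n (((singularChains.obj X).d (n + 1) n).hom (Finsupp.single σ (1 : ℤ))) =
      SC.d n (chainEquiv X (n + 1) (Finsupp.single σ (1 : ℤ)))
    have h0 : (singularChains.obj X).d (n + 1) n = ∑ i : Fin (n + 2), (-1 : ℤ) ^ (i : ℕ) •
        freeAb.map ((TopCat.toSSet.obj X).δ i) :=
      AlgebraicTopology.AlternatingFaceMapComplex.obj_d_eq _ n
    have h1 : (∑ i : Fin (n + 2), (-1 : ℤ) ^ (i : ℕ) •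
        freeAb.map ((TopCat.toSSet.obj X).δ i)).hom (Finsupp.single σ (1 : ℤ)) =
        (∑ i : Fin (n + 2), (-1 : ℤ) ^ (i : ℕ) •
          Finsupp.single ((TopCat.toSSet.obj X).δ i σ) (1 : ℤ) :
            (TopCat.toSSet.obj X).obj (Opposite.op (SimplexCategory.mk n)) →₀ ℤ) := by
      refine (hom_sum_smul_apply _ _ _).trans (Finset.sum_congr rfl fun i _ => ?_)
      exact congrArg _ Finsupp.mapDomain_single
    have h2 := (congrArg (fun f => f.hom (Finsupp.single σ (1 : ℤ))) h0).trans h1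
    refine (congrArg (chainEquiv X n) h2).trans ?_
    rw [chainEquiv_single, SC.d_single]
    refine (map_sum (Finsupp.domLCongr (R := ℤ) (M := ℤ)
      (TopCat.toSSetObjEquiv X (Opposite.op (SimplexCategory.mk n)))) _ _).trans ?_
    refine Finset.sum_congr rfl fun i _ => ?_
    rw [map_zsmul, Finsupp.domLCongr_single]
    rfl
  exact LinearMap.congr_fun this c

variable {π : Type u} [Group π] {R : Type w} [CommRing R] {V : Type w} [AddCommGroup V] [Module R V]
  (ρ : πᵐᵒᵖ →* Module.End R V)

/-- Exactness of a tensor complex, in terms of elements. -/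
theorem subsingleton_homology_tensorComplex {K : ChainComplex (ModuleCat.{v} ℤ) ℕ} (a : π →* End K)
    (i : ℕ) (h : ∀ z : V ⊗[ℤ] K.X i, lT R V (K.d i (i - 1)).hom z ∈ tensorRelations ρ a (i - 1) →
      ∃ w, z - lT R V (K.d (i + 1) i).hom w ∈ tensorRelations ρ a i) :
    Subsingleton ((tensorComplex ρ a).homology i) := by
  refine ModuleCat.subsingleton_of_isZero ?_
  rw [← HomologicalComplex.exactAt_iff_isZero_homology,
    -- For i = 0 the truncated `i - 1` is 0, and the differential from degree 0 to itself is zero.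
    HomologicalComplex.exactAt_iff' _ (i + 1) i (i - 1) (by simp) (by cases i <;> simp),
    ShortComplex.moduleCat_exact_iff]
  intro z hz
  obtain ⟨z, rfl⟩ := Submodule.Quotient.mk_surjective _ z
  obtain ⟨w, hw⟩ := h z ((Submodule.Quotient.mk_eq_zero _).1 hz)
  refine ⟨Submodule.Quotient.mk w, ?_⟩
  exact ((Submodule.Quotient.eq _).2 hw).symm

theorem lT_comp {C C' C'' : Type*} [AddCommGroup C] [Module ℤ C] [AddCommGroup C'] [Module ℤ C']
    [AddCommGroup C''] [Module ℤ C''] (f : C →ₗ[ℤ] C') (g : C' →ₗ[ℤ] C'') (x : V ⊗[ℤ] C) :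
    lT R V g (lT R V f x) = lT R V (g ∘ₗ f) x := by
  induction x using TensorProduct.induction_on with
  | zero => simp
  | tmul v c => simp
  | add x y hx hy => simp only [map_add, hx, hy]

theorem lT_id {C : Type*} [AddCommGroup C] [Module ℤ C] (x : V ⊗[ℤ] C) :
    lT R V (LinearMap.id : C →ₗ[ℤ] C) x = x := by
  induction x using TensorProduct.induction_on with
  | zero => simp
  | tmul v c => simp
  | add x y hx hy => simp only [map_add, hx, hy]

variable {X : TopCat.{v}} [MulAction π X] [ContinuousConstSMul π X]
  (D : π →* End X) (hD : ∀ g, (D g).hom = smulMap g)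

include hD in
theorem chainEquiv_mapEnd (g : π) (n : ℕ) (c : (singularChains.obj X).X n) :
    chainEquiv X n (((((singularChains.mapEnd X).comp D) g).f n).hom c) =
      SC.action π X n g (chainEquiv X n c) := by
  refine (chainEquiv_map (D g) n c).trans ?_
  rw [hD]
  rfl

include hD in
theorem tensorRelations_le_coinvRel (n : ℕ) :
    tensorRelations ρ ((singularChains.mapEnd X).comp D) n ≤
      (coinvRel ρ (SC.action π X n) ⊤).comap (lT R V (chainEquiv X n).toLinearMap) := by
  refine Submodule.span_le.2 ?_
  rintro _ ⟨g, v, c, rfl⟩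
  have := mem_coinvRel ρ (SC.action π X n) ⊤ (Subgroup.mem_top g) v (chainEquiv X n c)
  rw [← chainEquiv_mapEnd D hD] at this
  exact this

include hD in
theorem coinvRel_le_tensorRelations (n : ℕ) :
    coinvRel ρ (SC.action π X n) ⊤ ≤
      (tensorRelations ρ ((singularChains.mapEnd X).comp D) n).comap
        (lT R V (chainEquiv X n).symm.toLinearMap) := by
  refine Submodule.span_le.2 ?_
  rintro _ ⟨g, -, v, c, rfl⟩
  refine Submodule.subset_span ⟨g, v, (chainEquiv X n).symm c, ?_⟩
  have h : (chainEquiv X n).symm (SC.action π X n g c) =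
      ((((singularChains.mapEnd X).comp D) g).f n).hom ((chainEquiv X n).symm c) := by
    rw [LinearEquiv.symm_apply_eq, chainEquiv_mapEnd D hD, LinearEquiv.apply_symm_apply]
  rw [← h]
  rfl

theorem chainEquiv_bd (n : ℕ) (c : (singularChains.obj X).X n) :
    chainEquiv X (n - 1) (((singularChains.obj X).d n (n - 1)).hom c) =
      SC.bd n (chainEquiv X n c) := by
  cases n with
  | zero =>
    rw [(singularChains.obj X).shape _ _ (by simp)]
    exact map_zero _
  | succ n => exact chainEquiv_d X n c

include hD in
theorem subsingleton_homology_of_exact (i : ℕ)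
    (h : ∀ z : V ⊗[ℤ] SC i X, lT R V (SC.bd i) z ∈ coinvRel ρ (SC.action π X (i - 1)) ⊤ →
      ∃ w, z - lT R V (SC.d i) w ∈ coinvRel ρ (SC.action π X i) ⊤) :
    Subsingleton ((tensorComplex ρ ((singularChains.mapEnd X).comp D)).homology i) := by
  refine subsingleton_homology_tensorComplex ρ _ i fun z hz => ?_
  have h1 : lT R V (SC.bd i) (lT R V (chainEquiv X i).toLinearMap z) =
      lT R V (chainEquiv X (i - 1)).toLinearMap
        (lT R V ((singularChains.obj X).d i (i - 1)).hom z) := by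
    rw [lT_comp, lT_comp]
    congr 2
    exact LinearMap.ext fun c => (chainEquiv_bd i c).symm
  obtain ⟨w, hw⟩ := h (lT R V (chainEquiv X i).toLinearMap z) (by
    rw [h1]
    exact tensorRelations_le_coinvRel ρ D hD (i - 1) hz)
  refine ⟨lT R V (chainEquiv X (i + 1)).symm.toLinearMap w, ?_⟩
  have h2 := coinvRel_le_tensorRelations ρ D hD i hw
  rw [Submodule.mem_comap, map_sub, lT_comp, lT_comp] at h2
  have h3 : (chainEquiv X i).symm.toLinearMap ∘ₗ (chainEquiv X i).toLinearMap = LinearMap.id :=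
    LinearMap.ext fun c => (chainEquiv X i).symm_apply_apply c
  have h4 : (chainEquiv X i).symm.toLinearMap ∘ₗ SC.d i =
      ((singularChains.obj X).d (i + 1) i).hom ∘ₗ (chainEquiv X (i + 1)).symm.toLinearMap := by
    refine LinearMap.ext fun c => ?_
    refine (LinearEquiv.symm_apply_eq _).2 ?_
    refine Eq.trans ?_ (chainEquiv_d X i _).symm
    rw [LinearEquiv.coe_coe, LinearEquiv.apply_symm_apply]
  rw [h3, h4, lT_id, ← lT_comp] at h2
  exact h2

end Transfer

/-! ### The action of the fundamental group on the universal covering -/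

namespace UniversalCover

variable {X : Type u} [TopologicalSpace X] {x₀ : X} (U : UniversalCover.{u, v} X x₀)

theorem exists_loopClass_eq (g : Pi1 X x₀) : ∃ γ : Path x₀ x₀, loopClass γ = g := by
  obtain ⟨γ, hγ⟩ := Quotient.exists_rep (FundamentalGroup.toPath g.unop)
  exact ⟨γ, MulOpposite.unop_injective hγ⟩

theorem endPt_loopClass (γ : Path x₀ x₀) : (U.endPt (loopClass γ)).1 =
    U.isCoveringMap.liftPath γ U.base (γ.source.trans U.proj_base.symm) 1 := rfl

/-- A closed lift is null-homotopic in the simply connected total space, and the null-homotopy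
projects to the base. -/
theorem eq_one_of_endPt {g : Pi1 X x₀} (h : (U.endPt g).1 = U.base) : g = 1 := by
  obtain ⟨γ, rfl⟩ := exists_loopClass_eq g
  rw [endPt_loopClass] at h
  set Γ := U.isCoveringMap.liftPath γ U.base (γ.source.trans U.proj_base.symm) with hΓ
  let Γ' : Path U.base U.base := ⟨Γ, U.isCoveringMap.liftPath_zero _ _ _, h⟩
  have h1 : Γ'.Homotopic (Path.refl U.base) := SimplyConnectedSpace.paths_homotopic _ _
  have h2 : γ.Homotopic (Path.refl x₀) := by
    have h3 := ContinuousMap.HomotopicRel.comp_continuousMap h1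
      ⟨U.proj, U.isCoveringMap.continuous⟩
    have e1 : ContinuousMap.comp ⟨U.proj, U.isCoveringMap.continuous⟩ Γ'.toContinuousMap =
        γ.toContinuousMap :=
      ContinuousMap.ext fun t => congrFun (U.isCoveringMap.liftPath_lifts γ U.base
        (γ.source.trans U.proj_base.symm)) t
    have e2 : ContinuousMap.comp ⟨U.proj, U.isCoveringMap.continuous⟩
        (Path.refl U.base).toContinuousMap = (Path.refl x₀).toContinuousMap :=
      ContinuousMap.ext fun t => U.proj_base
    rw [e1, e2] at h3
    exact h3
  have h3 : Path.Homotopic.Quotient.mk γ = Path.Homotopic.Quotient.mk (Path.refl x₀) :=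
    Path.Homotopic.Quotient.eq.2 h2
  exact congrArg (fun q => MulOpposite.op (FundamentalGroup.fromPath q)) h3

theorem exists_endPt_eq (y : U.Total) (hy : U.proj y = x₀) : ∃ g, (U.endPt g).1 = y := by
  have P : Path U.base y := PathConnectedSpace.somePath _ _
  let γ : Path x₀ x₀ := (P.map U.isCoveringMap.continuous).cast U.proj_base.symm hy.symm
  refine ⟨loopClass γ, ?_⟩
  rw [endPt_loopClass]
  have : P.toContinuousMap = U.isCoveringMap.liftPath γ U.base
      (γ.source.trans U.proj_base.symm) :=
    (U.isCoveringMap.eq_liftPath_iff' _).2 ⟨rfl, P.source⟩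
  rw [← this]
  exact P.target

theorem proj_surjective [PathConnectedSpace X] : Function.Surjective U.proj := by
  intro x
  have P : Path x₀ x := PathConnectedSpace.somePath _ _
  refine ⟨U.isCoveringMap.liftPath P U.base (P.source.trans U.proj_base.symm) 1, ?_⟩
  exact (congrFun (U.isCoveringMap.liftPath_lifts P U.base
    (P.source.trans U.proj_base.symm)) 1).trans P.target

variable [LocallyPathConnectedSpace X]

instance : MulAction (Pi1 X x₀) U.Total where
  smul g := U.deck g
  one_smul x := by change U.deck 1 x = x; rw [deck_one]; rfl
  mul_smul g h x := by change U.deck (g * h) x = U.deck g (U.deck h x); rw [deck_mul]; rfl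

theorem deck_apply (g : Pi1 X x₀) (x : U.Total) : U.deck g x = g • x := rfl

instance : ContinuousConstSMul (Pi1 X x₀) U.Total := ⟨fun g => (U.deck g).continuous⟩

@[simp] theorem proj_smul (g : Pi1 X x₀) (x : U.Total) : U.proj (g • x) = U.proj x :=
  congrFun (U.proj_comp_deck g) x

theorem smul_left_injective (g h : Pi1 X x₀) (x : U.Total) (hx : g • x = h • x) : g = h := by
  have h0 : U.proj ∘ U.deck (h⁻¹ * g) = U.proj ∘ (id : U.Total → U.Total) := U.proj_comp_deck _
  have h1 := U.isCoveringMap.eq_of_comp_eq (U.deck (h⁻¹ * g)).continuous continuous_id h0 x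
    (by rw [deck_apply, mul_smul, hx, inv_smul_smul]; rfl)
  have h2 : (U.endPt (h⁻¹ * g)).1 = U.base := by rw [← deck_base, h1]; rfl
  exact (inv_mul_eq_one.1 (U.eq_one_of_endPt h2)).symm

theorem eq_one_of_smul_eq (g : Pi1 X x₀) (x : U.Total) (hx : g • x = x) : g = 1 :=
  U.smul_left_injective g 1 x (by rw [hx, one_smul])

/-- Some lift of the projection takes x to y; it agrees with a deck transformation of π at the base
point, and so everywhere. -/
theorem exists_smul_eq {x y : U.Total} (h : U.proj x = U.proj y) :
    ∃ g : Pi1 X x₀, g • x = y := by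
  obtain ⟨D, ⟨hD0, hD1⟩, -⟩ := U.isCoveringMap.existsUnique_continuousMap_lifts
    ⟨U.proj, U.isCoveringMap.continuous⟩ x y h.symm
  have hD2 : U.proj ∘ D = U.proj := hD1
  obtain ⟨g, hg⟩ := U.exists_endPt_eq (D U.base)
    ((congrFun hD2 U.base).trans U.proj_base)
  have h1 := U.isCoveringMap.eq_of_comp_eq (U.deck g).continuous D.continuous
    ((U.proj_comp_deck g).trans hD2.symm) U.base (by rw [deck_base, hg])
  exact ⟨g, by rw [← deck_apply, h1, hD0]⟩

/-! ### The lift of a circle-valued map -/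

/-- A lift to `ℝ` of a map to the circle, from the universal covering. -/
theorem exists_height (p : C(X, UnitAddCircle)) (ξ : Pi1 X x₀ →* Multiplicative ℤ)
    (hp : ∀ γ : Path x₀ x₀,
      HasWindingNumber (γ.map p.continuous) (Multiplicative.toAdd (ξ (loopClass γ)))) :
    ∃ h : C(U.Total, ℝ), (∀ x, (h x : UnitAddCircle) = p (U.proj x)) ∧
      ∀ (g : Pi1 X x₀) (x : U.Total), h (g • x) = h x + ((ξ g).toAdd : ℤ) := by
  have cov : IsCoveringMap ((↑) : ℝ → UnitAddCircle) := AddCircle.isCoveringMap_coe 1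
  obtain ⟨a, ha⟩ := QuotientAddGroup.mk_surjective (p (U.proj U.base))
  obtain ⟨h, ⟨hb, hl⟩, -⟩ := cov.existsUnique_continuousMap_lifts
    (p.comp ⟨U.proj, U.isCoveringMap.continuous⟩) U.base a ha
  have hl' (x : U.Total) : (h x : UnitAddCircle) = p (U.proj x) := congrFun hl x
  refine ⟨h, hl', fun g x => ?_⟩
  -- Along the lifted loop, h and the path θ from the winding number lift the same path in the
  -- circle, so they differ by a constant.
  have key : h (g • U.base) = h U.base + ((ξ g).toAdd : ℤ) := by
    obtain ⟨γ, rfl⟩ := exists_loopClass_eq g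
    obtain ⟨θ, hθ, hθ1⟩ := hp γ
    set Γ := U.isCoveringMap.liftPath γ U.base (γ.source.trans U.proj_base.symm) with hΓ
    have hΓ0 : Γ 0 = U.base := U.isCoveringMap.liftPath_zero _ _ _
    have hΓl : U.proj ∘ Γ = γ := U.isCoveringMap.liftPath_lifts _ _ _
    have hΓ1 : Γ 1 = loopClass γ • U.base := by
      rw [← deck_apply, deck_base, endPt_loopClass]
    have hcoe (t : unitInterval) : ((h (Γ t) : ℝ) : UnitAddCircle) = (θ t : ℝ) := by
      rw [hl', hθ]; exact congrArg p (congrFun hΓl t)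
    have h0 : (((h U.base - θ 0 : ℝ)) : UnitAddCircle) = 0 := by
      rw [AddCircle.coe_sub, ← hcoe 0, hΓ0, sub_self]
    have e := cov.eq_of_comp_eq (g₁ := fun t => h (Γ t)) (g₂ := fun t => θ t + (h U.base - θ 0))
      (h.continuous.comp Γ.continuous) (θ.continuous.add continuous_const)
      (funext fun t => by
        change ((h (Γ t) : ℝ) : UnitAddCircle) = ((θ t + (h U.base - θ 0) : ℝ) : UnitAddCircle)
        rw [AddCircle.coe_add, h0, add_zero, hcoe]) 0 (by
        rw [hΓ0]; ring)
    have e1 : h (Γ 1) = θ 1 + (h U.base - θ 0) := congrFun e 1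
    rw [← hΓ1, e1, ← hθ1]; ring
  -- Both functions lift the same circle-valued map, so agreement at the base point propagates by
  -- connectedness.
  have e := cov.eq_of_comp_eq (g₁ := fun x : U.Total => h (g • x))
    (g₂ := fun x => h x + (((ξ g).toAdd : ℤ) : ℝ))
    (h.continuous.comp (continuous_const_smul g)) (h.continuous.add continuous_const)
    (funext fun x => by
      change ((h (g • x) : ℝ) : UnitAddCircle) = ((h x + (((ξ g).toAdd : ℤ) : ℝ) : ℝ) : UnitAddCircle)
      have : ((((ξ g).toAdd : ℤ) : ℝ) : UnitAddCircle) = 0 := by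
        refine (AddCircle.coe_eq_zero_iff 1).2 ⟨(ξ g).toAdd, by simp⟩
      rw [AddCircle.coe_add, this, add_zero, hl', hl', proj_smul]) U.base key
  exact congrFun e x

end UniversalCover

/-! ### Pulling back a bundle over the circle to the line -/

section Bundle

open Bundle

/-- The fibers of a map. -/
abbrev FiberFamily {M : Type*} {B : Type*} (p : M → B) (b : B) : Type _ := {m : M // p m = b}

/-- The disjoint union of the fibers of a map. -/
def fiberFamilyEquiv {M B : Type*} (F : Type*) (p : M → B) : TotalSpace F (FiberFamily p) ≃ M where
  toFun z := z.2.1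
  invFun m := ⟨p m, m, rfl⟩
  left_inv := by rintro ⟨_, m, rfl⟩; rfl
  right_inv _ := rfl

/-- The topology on the disjoint union of the fibers is that of the source. -/
instance fiberFamilyTopology {M B : Type*} [TopologicalSpace M] (F : Type*) (p : M → B) :
    TopologicalSpace (TotalSpace F (FiberFamily p)) :=
  TopologicalSpace.induced (fiberFamilyEquiv F p) inferInstance

/-- The disjoint union of the fibers is the source. -/
def fiberFamilyHomeomorph {M B : Type*} [TopologicalSpace M] (F : Type*) (p : M → B) :
    TotalSpace F (FiberFamily p) ≃ₜ M :=
  (fiberFamilyEquiv F p).toHomeomorphOfIsInducing ⟨rfl⟩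

variable {M : Type u} [TopologicalSpace M] {B : Type w} [TopologicalSpace B]
  {F : Type t} [TopologicalSpace F]

theorem exists_trivialization_fiberFamily {p : C(M, B)} (hp : IsBundleWithFiber F p) (b : B) :
    ∃ e : Trivialization F (π F (FiberFamily p)), b ∈ e.baseSet := by
  obtain ⟨e, he⟩ := hp b
  have h : ⇑p ∘ fiberFamilyHomeomorph F p = π F (FiberFamily p) :=
    funext fun z => z.2.2
  rw [← h]
  exact ⟨e.compHomeomorph (fiberFamilyHomeomorph F p), he⟩

/-- A locally trivial map is a fiber bundle. -/
@[reducible] def fiberBundleOfIsBundleWithFiber {p : C(M, B)} (hp : IsBundleWithFiber F p) :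
    FiberBundle F (FiberFamily p) where
  totalSpaceMk_isInducing' b := by
    have h1 : Topology.IsInducing (fiberFamilyHomeomorph F p) :=
      (fiberFamilyHomeomorph F p).isInducing
    exact h1.of_comp_iff.1 Topology.IsInducing.subtypeVal
  trivializationAtlas' := Set.univ
  trivializationAt' b := (exists_trivialization_fiberFamily hp b).choose
  mem_baseSet_trivializationAt' b := (exists_trivialization_fiberFamily hp b).choose_spec
  trivialization_mem_atlas' _ := trivial

/-- A bundle over the circle is trivial over a fundamental domain of the circle. -/
theorem exists_trivialization_unitInterval {p : C(M, UnitAddCircle)}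
    (hp : IsBundleWithFiber F p) (hF : Nonempty F) :
    ∃ (ε : unitInterval × F → M)
      (δ : {z : M × unitInterval // p z.1 = ((z.2 : ℝ) : UnitAddCircle)} → F),
      Continuous ε ∧ Continuous δ ∧ (∀ s f, p (ε (s, f)) = ((s : ℝ) : UnitAddCircle)) ∧
      (∀ s f h, δ ⟨(ε (s, f), s), h⟩ = f) ∧ ∀ z, ε (z.1.2, δ z) = z.1.1 := by
  let _ := fiberBundleOfIsBundleWithFiber hp
  have hne (b : UnitAddCircle) : Nonempty (FiberFamily p b) := by
    obtain ⟨e, he⟩ := hp b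
    obtain ⟨f⟩ := hF
    refine ⟨e.toPartialEquiv.symm (b, f), e.proj_symm_apply' he⟩
  let c : C(ℝ, UnitAddCircle) := ⟨fun s => (s : UnitAddCircle), AddCircle.continuous_mk' 1⟩
  -- After pulling back to the line the ends 0 and 1 are distinct points, and a bundle is trivial
  -- over a compact interval.
  obtain ⟨e, he⟩ := FiberBundle.exists_trivialization_Icc_subset F
    ((c : ℝ → UnitAddCircle) *ᵖ (FiberFamily p)) 0 1
  let val : TotalSpace F ((c : ℝ → UnitAddCircle) *ᵖ (FiberFamily p)) → M :=
    fun z => fiberFamilyHomeomorph F p (Pullback.lift c z)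
  have hval : Continuous val :=
    (fiberFamilyHomeomorph F p).continuous.comp (Pullback.continuous_lift F (FiberFamily p) c)
  let mk : {z : M × unitInterval // p z.1 = ((z.2 : ℝ) : UnitAddCircle)} →
      TotalSpace F ((c : ℝ → UnitAddCircle) *ᵖ (FiberFamily p)) := fun z => ⟨z.1.2, z.1.1, z.2⟩
  have hvalmk z : val (mk z) = z.1.1 := rfl
  have hmkval z (s : unitInterval) (hs : z.proj = (s : ℝ)) (h) : mk ⟨(val z, s), h⟩ = z := by
    obtain ⟨s', m, hm⟩ := z
    have hs' : s' = (s : ℝ) := hs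
    subst hs'
    rfl
  have hmk : Continuous mk := by
    rw [(inducing_pullbackTotalSpaceEmbedding F (FiberFamily p) c).continuous_iff]
    refine Continuous.prodMk (continuous_subtype_val.comp (continuous_snd.comp continuous_subtype_val)) ?_
    rw [(fiberFamilyHomeomorph F p).isInducing.continuous_iff]
    exact (continuous_fst.comp continuous_subtype_val)
  have hsym (s : unitInterval) (f : F) :
      (e.toPartialEquiv.symm ((s : ℝ), f)).proj = (s : ℝ) := e.proj_symm_apply' (he s.2)
  have hpv z : p (val z) = c z.proj := z.2.2
  refine ⟨fun q => val (e.toPartialEquiv.symm ((q.1 : ℝ), q.2)), fun z => (e (mk z)).2,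
    ?_, ?_, ?_, ?_, ?_⟩
  · refine hval.comp (e.continuousOn_invFun.comp_continuous (by fun_prop) fun q => ?_)
    rw [e.target_eq]
    exact ⟨he q.1.2, trivial⟩
  · refine continuous_snd.comp (e.continuousOn_toFun.comp_continuous hmk fun z => ?_)
    rw [e.source_eq]
    exact he z.1.2.2
  · intro s f
    change p (val _) = _
    rw [hpv, hsym]; rfl
  · intro s f h
    change (e (mk ⟨(val _, s), h⟩)).2 = f
    rw [hmkval _ s (hsym s f)]
    exact congrArg Prod.snd (e.apply_symm_apply' (he s.2))
  · intro z
    change val (e.toPartialEquiv.symm ((z.1.2 : ℝ), (e (mk z)).2)) = z.1.1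
    have : e.toPartialEquiv.symm ((z.1.2 : ℝ), (e (mk z)).2) = mk z :=
      e.symm_apply_mk_proj (x := mk z) (e.mem_source.2 (he z.1.2.2))
    rw [this]; exact hvalmk z

theorem locallyFinite_Icc_int_add_one :
    LocallyFinite fun n : ℤ => Set.Icc (n : ℝ) (n + 1) := by
  intro x
  refine ⟨Set.Ioo (x - 1) (x + 1), Ioo_mem_nhds (by linarith) (by linarith), ?_⟩
  refine (Set.finite_Icc (⌊x⌋ - 3) (⌊x⌋ + 3)).subset ?_
  rintro n ⟨y, ⟨h1, h2⟩, h3, h4⟩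
  have h5 := Int.floor_le x
  have h6 := Int.lt_floor_add_one x
  constructor
  · have : ((⌊x⌋ - 3 : ℤ) : ℝ) ≤ n := by push_cast; linarith
    exact_mod_cast this
  · have : (n : ℝ) ≤ ((⌊x⌋ + 3 : ℤ) : ℝ) := by push_cast; linarith
    exact_mod_cast this

theorem iUnion_Icc_int_add_one : ⋃ n : ℤ, Set.Icc (n : ℝ) (n + 1) = Set.univ :=
  Set.eq_univ_of_forall fun x =>
    Set.mem_iUnion.2 ⟨⌊x⌋, Int.floor_le x, (Int.lt_floor_add_one x).le⟩

theorem UnitAddCircle.coe_sub_intCast (s : ℝ) (n : ℤ) :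
    ((s - n : ℝ) : UnitAddCircle) = (s : UnitAddCircle) := by
  have : ((n : ℝ) : UnitAddCircle) = 0 := (AddCircle.coe_eq_zero_iff 1).2 ⟨n, by simp⟩
  rw [AddCircle.coe_sub, this, sub_zero]

theorem sub_mem_unitInterval {s : ℝ} {n : ℤ} (h : s ∈ Set.Icc (n : ℝ) (n + 1)) :
    s - n ∈ unitInterval := ⟨by linarith [h.1], by linarith [h.2]⟩

/-- The pullback to the line of a bundle over the circle is trivial. -/
theorem exists_trivialization_pullback {p : C(M, UnitAddCircle)}
    (hp : IsBundleWithFiber F p) (hF : Nonempty F) :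
    ∃ (Θ : C(ℝ × F, M)) (D : C({z : M × ℝ // p z.1 = (z.2 : UnitAddCircle)}, F)),
      (∀ s f, p (Θ (s, f)) = (s : UnitAddCircle)) ∧
      (∀ s f h, D ⟨(Θ (s, f), s), h⟩ = f) ∧ ∀ z, Θ (z.1.2, D z) = z.1.1 := by
  obtain ⟨ε, δ, hε, hδ, hpε, hδε, hεδ⟩ := exists_trivialization_unitInterval hp hF
  have h01 : (((1 : unitInterval) : ℝ) : UnitAddCircle) = ((0 : unitInterval) : ℝ) := by simp
  have hc1 f : p (ε (1, f)) = (((0 : unitInterval) : ℝ) : UnitAddCircle) := (hpε 1 f).trans h01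
  have hc0 f : p (ε (0, f)) = (((1 : unitInterval) : ℝ) : UnitAddCircle) :=
    (hpε 0 f).trans h01.symm
  -- The gluing homeomorphism of the two ends, determined by ε(0, k f) = ε(1, f). Its powers match
  -- the trivializations over consecutive intervals.
  let k : F ≃ₜ F :=
    { toFun := fun f => δ ⟨(ε (1, f), 0), hc1 f⟩
      invFun := fun f => δ ⟨(ε (0, f), 1), hc0 f⟩
      left_inv := fun f => by
        have h : ε (0, δ ⟨(ε (1, f), 0), hc1 f⟩) = ε (1, f) := hεδ ⟨(ε (1, f), 0), hc1 f⟩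
        simp only [h]
        exact hδε 1 f _
      right_inv := fun f => by
        have h : ε (1, δ ⟨(ε (0, f), 1), hc0 f⟩) = ε (0, f) := hεδ ⟨(ε (0, f), 1), hc0 f⟩
        simp only [h]
        exact hδε 0 f _
      continuous_toFun := hδ.comp (by fun_prop)
      continuous_invFun := hδ.comp (by fun_prop) }
  have hk f : ε (0, k f) = ε (1, f) := hεδ ⟨(ε (1, f), 0), hc1 f⟩
  have hδk m h0 h1 : k (δ ⟨(m, 1), h1⟩) = δ ⟨(m, 0), h0⟩ := by
    have h : ε (1, δ ⟨(m, 1), h1⟩) = m := hεδ ⟨(m, 1), h1⟩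
    change δ ⟨(ε (1, δ ⟨(m, 1), h1⟩), 0), _⟩ = _
    simp only [h]
  have hfl (s : ℝ) : s ∈ Set.Icc (⌊s⌋ : ℝ) (⌊s⌋ + 1) :=
    ⟨Int.floor_le s, (Int.lt_floor_add_one s).le⟩
  have hcase {s : ℝ} {n : ℤ} (h : s ∈ Set.Icc (n : ℝ) (n + 1)) : n = ⌊s⌋ ∨
      (s = n + 1 ∧ ⌊s⌋ = n + 1) := by
    rcases h.2.lt_or_eq with h' | h'
    · left; exact (Int.floor_eq_iff.2 ⟨h.1, h'⟩).symm
    · right; refine ⟨h', ?_⟩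
      rw [h', Int.floor_add_one, Int.floor_intCast]
  let Θ : ℝ × F → M := fun q => ε (⟨q.1 - ⌊q.1⌋, sub_mem_unitInterval (hfl q.1)⟩, (k ^ ⌊q.1⌋) q.2)
  -- The formula persists at the right end n + 1, where the floor jumps. Continuity then follows on
  -- each set of a locally finite closed cover.
  have hΘ (n : ℤ) (s : ℝ) (f : F) (h : s ∈ Set.Icc (n : ℝ) (n + 1)) :
      Θ (s, f) = ε (⟨s - n, sub_mem_unitInterval h⟩, (k ^ n) f) := by
    rcases hcase h with rfl | ⟨h1, h2⟩
    · rfl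
    · have e1 : (⟨s - ⌊s⌋, sub_mem_unitInterval (hfl s)⟩ : unitInterval) = 0 := by
        refine Subtype.ext ?_
        change s - ⌊s⌋ = 0
        rw [h2, h1]; push_cast; ring
      have e2 : (⟨s - n, sub_mem_unitInterval h⟩ : unitInterval) = 1 := by
        refine Subtype.ext ?_
        change s - n = 1
        rw [h1]; ring
      change ε (⟨s - ⌊s⌋, sub_mem_unitInterval (hfl s)⟩, (k ^ ⌊s⌋) f) = _
      rw [e1, e2, h2, add_comm n 1, zpow_add, zpow_one]
      exact hk _
  have hin {n : ℤ} (z : {z : M × ℝ // p z.1 = (z.2 : UnitAddCircle)}) :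
      p z.1.1 = ((z.1.2 - n : ℝ) : UnitAddCircle) := by
    rw [UnitAddCircle.coe_sub_intCast]; exact z.2
  let D : {z : M × ℝ // p z.1 = (z.2 : UnitAddCircle)} → F := fun z =>
    (k ^ (-⌊z.1.2⌋)) (δ ⟨(z.1.1, ⟨z.1.2 - ⌊z.1.2⌋, sub_mem_unitInterval (hfl z.1.2)⟩), hin z⟩)
  have hD (n : ℤ) (z : {z : M × ℝ // p z.1 = (z.2 : UnitAddCircle)})
      (h : z.1.2 ∈ Set.Icc (n : ℝ) (n + 1)) : D z =
      (k ^ (-n)) (δ ⟨(z.1.1, ⟨z.1.2 - n, sub_mem_unitInterval h⟩), hin z⟩) := by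
    rcases hcase h with rfl | ⟨h1, h2⟩
    · rfl
    · have e1 : (⟨z.1.2 - ⌊z.1.2⌋, sub_mem_unitInterval (hfl z.1.2)⟩ : unitInterval) = 0 := by
        refine Subtype.ext ?_
        change z.1.2 - ⌊z.1.2⌋ = 0
        rw [h2, h1]; push_cast; ring
      have e2 : (⟨z.1.2 - n, sub_mem_unitInterval h⟩ : unitInterval) = 1 := by
        refine Subtype.ext ?_
        change z.1.2 - n = 1
        rw [h1]; ring
      have e3 : p z.1.1 = (((0 : unitInterval) : ℝ) : UnitAddCircle) := by
        have := hin (n := ⌊z.1.2⌋) z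
        rw [this]; exact congrArg (fun a : unitInterval => ((a : ℝ) : UnitAddCircle)) e1
      change (k ^ (-⌊z.1.2⌋)) (δ ⟨(z.1.1, ⟨z.1.2 - ⌊z.1.2⌋, _⟩), _⟩) = _
      simp only [e1, e2]
      rw [← hδk z.1.1 e3 (e3.trans h01.symm), h2, neg_add, zpow_add, zpow_neg_one]
      exact congrArg (k ^ (-n)) (k.symm_apply_apply _)
  have hΘc : Continuous Θ := by
    refine (locallyFinite_Icc_int_add_one.preimage_continuous
      (continuous_fst (X := ℝ) (Y := F))).continuous ?_ ?_ ?_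
    · rw [← Set.preimage_iUnion, iUnion_Icc_int_add_one, Set.preimage_univ]
    · exact fun n => isClosed_Icc.preimage continuous_fst
    · intro n
      rw [continuousOn_iff_continuous_domRestrict]
      have : (Prod.fst ⁻¹' Set.Icc (n : ℝ) (n + 1)).domRestrict Θ =
          fun q => ε (⟨q.1.1 - n, sub_mem_unitInterval q.2⟩, (k ^ n) q.1.2) :=
        funext fun q => hΘ n q.1.1 q.1.2 q.2
      rw [this]
      refine hε.comp (Continuous.prodMk (by fun_prop) ((k ^ n).continuous.comp (by fun_prop)))
  have hDc : Continuous D := by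
    have hs : Continuous fun z : {z : M × ℝ // p z.1 = (z.2 : UnitAddCircle)} => z.1.2 := by
      fun_prop
    refine (locallyFinite_Icc_int_add_one.preimage_continuous hs).continuous ?_ ?_ ?_
    · rw [← Set.preimage_iUnion, iUnion_Icc_int_add_one, Set.preimage_univ]
    · exact fun n => isClosed_Icc.preimage hs
    · intro n
      rw [continuousOn_iff_continuous_domRestrict]
      have : ((fun z : {z : M × ℝ // p z.1 = (z.2 : UnitAddCircle)} => z.1.2) ⁻¹'
          Set.Icc (n : ℝ) (n + 1)).domRestrict D = fun z => (k ^ (-n))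
            (δ ⟨(z.1.1.1, ⟨z.1.1.2 - n, sub_mem_unitInterval z.2⟩), hin z.1⟩) :=
        funext fun z => hD n z.1 z.2
      rw [this]
      refine (k ^ (-n)).continuous.comp (hδ.comp (by fun_prop))
  refine ⟨⟨Θ, hΘc⟩, ⟨D, hDc⟩, fun s f => ?_, fun s f h => ?_, fun z => ?_⟩
  · exact (hpε _ _).trans (UnitAddCircle.coe_sub_intCast s ⌊s⌋)
  · change (k ^ (-⌊s⌋)) (δ ⟨(ε (⟨s - ⌊s⌋, _⟩, (k ^ ⌊s⌋) f), ⟨s - ⌊s⌋, _⟩), _⟩) = f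
    rw [hδε, zpow_neg]
    exact (k ^ ⌊s⌋).symm_apply_apply f
  · change ε (⟨z.1.2 - ⌊z.1.2⌋, _⟩, (k ^ ⌊z.1.2⌋) ((k ^ (-⌊z.1.2⌋)) (δ _))) = z.1.1
    rw [zpow_neg]
    have := (k ^ ⌊z.1.2⌋).apply_symm_apply
      (δ ⟨(z.1.1, ⟨z.1.2 - ⌊z.1.2⌋, sub_mem_unitInterval (hfl z.1.2)⟩), hin z⟩)
    refine (congrArg (fun f => ε (⟨z.1.2 - ⌊z.1.2⌋, sub_mem_unitInterval (hfl z.1.2)⟩, f))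
      this).trans (hεδ ⟨(z.1.1, ⟨z.1.2 - ⌊z.1.2⌋, sub_mem_unitInterval (hfl z.1.2)⟩), hin z⟩)

end Bundle

/-! ### Deforming the universal covering into the preimage of a compact set -/

theorem compactSpace_of_finite_cwComplex {Y : Type*} [TopologicalSpace Y] [T2Space Y]
    [Topology.CWComplex (Set.univ : Set Y)]
    (h : Topology.RelCWComplex.Finite (Set.univ : Set Y)) : CompactSpace Y := by
  have := Topology.RelCWComplex.finite_iff_finite_cells.1 h
  rw [← isCompact_univ_iff]
  have h1 : (⋃ c : Σ n, Topology.RelCWComplex.cell (Set.univ : Set Y) n,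
      Topology.RelCWComplex.closedCell c.1 c.2) = Set.univ := by
    rw [Set.iUnion_sigma]
    exact Topology.CWComplex.union
  rw [← h1]
  exact isCompact_iUnion fun c => Topology.RelCWComplex.isCompact_closedCell

/-- A space of the homotopy type of a finite CW complex is dominated by a compact space. -/
theorem HasFiniteCWType.exists_compact {F : Type v} [TopologicalSpace F] (hF : HasFiniteCWType F) :
    ∃ (Y : Type v) (_ : TopologicalSpace Y) (_ : CompactSpace Y) (a : C(F, Y)) (b : C(Y, F))
      (G : C(unitInterval × F, F)), (∀ f, G (0, f) = f) ∧ ∀ f, G (1, f) = b (a f) := by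
  obtain ⟨Y, _, _, _, hY, ⟨e⟩⟩ := hF
  obtain ⟨G⟩ := e.left_inv.symm
  exact ⟨Y, _, compactSpace_of_finite_cwComplex hY, e.toFun, e.invFun, G.toContinuousMap,
    G.map_zero_left, G.map_one_left⟩

theorem IsBundleWithFiber.nonempty_fiber {M : Type u} [TopologicalSpace M] {B : Type w}
    [TopologicalSpace B] {F : Type t} [TopologicalSpace F] {p : C(M, B)}
    (hp : IsBundleWithFiber F p) [Nonempty M] : Nonempty F := by
  obtain ⟨e, -⟩ := hp (p (Classical.arbitrary M))
  exact ⟨(e (Classical.arbitrary M)).2⟩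

theorem isCoveringMap_coe_unitAddCircle : IsCoveringMap ((↑) : ℝ → UnitAddCircle) :=
  AddCircle.isCoveringMap_coe 1

namespace UniversalCover

variable {M : Type u} [TopologicalSpace M] [LocallyPathConnectedSpace M] {x₀ : M}
  (U : UniversalCover.{u, v} M x₀) {F : Type t} [TopologicalSpace F]
  {p : C(M, UnitAddCircle)} {ξ : Pi1 M x₀ →* Multiplicative ℤ} {h : C(U.Total, ℝ)}

/-- The universal covering deforms, equivariantly under the kernel of `ξ`, into the part at height
`0` of the preimage of a compact set. -/
theorem exists_deformation (hp : IsBundleWithFiber F p) (hF : HasFiniteCWType F)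
    (hh : ∀ x, (h x : UnitAddCircle) = p (U.proj x))
    (hξ : ∀ (g : Pi1 M x₀) (x : U.Total), h (g • x) = h x + ((ξ g).toAdd : ℤ)) :
    ∃ (H : C(U.Total × unitInterval, U.Total)) (K : Set M), IsCompact K ∧ (∀ x, H (x, 0) = x) ∧
      (∀ g ∈ ξ.ker, ∀ x s, H (g • x, s) = g • H (x, s)) ∧ (∀ x, U.proj (H (x, 1)) ∈ K) ∧
      ∀ x, h (H (x, 1)) = 0 := by
  have : Nonempty M := ⟨x₀⟩
  obtain ⟨Θ, D, hΘ, -, hΘD⟩ := exists_trivialization_pullback hp hp.nonempty_fiber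
  obtain ⟨Y, _, _, a, b, G, hG0, hG1⟩ := hF.exists_compact
  have hproj : Continuous U.proj := U.isCoveringMap.continuous
  let d : C(U.Total, F) := ⟨fun x => D ⟨(U.proj x, h x), (hh x).symm⟩, by fun_prop⟩
  have hd (x) : Θ (h x, d x) = U.proj x := hΘD ⟨(U.proj x, h x), (hh x).symm⟩
  -- In the coordinates ℝ × F the height shrinks linearly to 0 while the fiber coordinate follows G
  -- to a point in the image of the compact space; the deformation is the lift of this homotopy.
  let HM : C(unitInterval × U.Total, M) :=
    ⟨fun q => Θ ((1 - (q.1 : ℝ)) * h q.2, G (q.1, d q.2)), by fun_prop⟩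
  have hHM (s x) : HM (s, x) = Θ ((1 - (s : ℝ)) * h x, G (s, d x)) := rfl
  have hHM0 (x) : HM (0, x) = U.proj (ContinuousMap.id _ x) := by
    rw [hHM, hG0]
    simp [hd]
  let H := U.isCoveringMap.liftHomotopy HM (ContinuousMap.id _) hHM0
  have hH0 (x) : H (0, x) = x := U.isCoveringMap.liftHomotopy_zero _ _ _ x
  have hHl (q) : U.proj (H q) = HM q := congrFun (U.isCoveringMap.liftHomotopy_lifts _ _ _) q
  -- Both sides lift the same path in the circle and agree at time 0.
  have hHh (s x) : h (H (s, x)) = (1 - (s : ℝ)) * h x := by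
    refine congrFun (isCoveringMap_coe_unitAddCircle.eq_of_comp_eq
      (g₁ := fun s : unitInterval => h (H (s, x))) (g₂ := fun s => (1 - (s : ℝ)) * h x)
      (by fun_prop) (by fun_prop) (funext fun s => ?_) 0 (by simp [hH0])) s
    change ((h (H (s, x)) : ℝ) : UnitAddCircle) = _
    rw [hh, hHl, hHM, hΘ]
    rfl
  refine ⟨H.comp ⟨Prod.swap, continuous_swap⟩, (fun y => Θ (0, b y)) '' Set.univ,
    isCompact_univ.image (by fun_prop), hH0, fun g hg x s => ?_, fun x => ?_, fun x => ?_⟩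
  · have h1 : h (g • x) = h x := by
      rw [hξ, MonoidHom.mem_ker.1 hg]; simp
    have h2 : d (g • x) = d x := by
      change D _ = D _
      congr 1
      refine Subtype.ext (Prod.ext (U.proj_smul g x) h1)
    -- An element of the kernel fixes both coordinates, height and fiber, so the two paths lie over
    -- the same path in M and start at the same point.
    refine congrFun (U.isCoveringMap.eq_of_comp_eq
      (g₁ := fun s : unitInterval => H (s, g • x)) (g₂ := fun s => g • H (s, x))
      (by fun_prop) (by fun_prop) (funext fun s => ?_) 0 (by simp only [hH0])) s
    change U.proj (H (s, g • x)) = U.proj (g • H (s, x))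
    rw [proj_smul, hHl, hHl, hHM, hHM, h1, h2]
  · refine ⟨a (d x), trivial, ?_⟩
    change _ = U.proj (H (1, x))
    rw [hHl, hHM, hG1]
    simp
  · change h (H (1, x)) = 0
    rw [hHh]
    simp

/-- If ξ were trivial, the height would descend to M, with value s + J(f) at the point of
coordinates (s, f). Since F is dominated by a compact space, J is bounded below; but a fixed point
of M also has coordinates with s arbitrarily large, which forces J to be arbitrarily negative. -/
theorem exists_ne_one_of_fibered [Nonempty M] [PathConnectedSpace M]
    (hp : IsBundleWithFiber F p) (hF : HasFiniteCWType F)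
    (hh : ∀ x, (h x : UnitAddCircle) = p (U.proj x))
    (hξ : ∀ (g : Pi1 M x₀) (x : U.Total), h (g • x) = h x + ((ξ g).toAdd : ℤ)) :
    ∃ g, ξ g ≠ 1 := by
  by_contra! htriv
  obtain ⟨Θ, D, hΘ, -, hΘD⟩ := exists_trivialization_pullback hp hp.nonempty_fiber
  obtain ⟨Y, _, _, a, b, G, hG0, hG1⟩ := hF.exists_compact
  have hinv {x y : U.Total} (hxy : U.proj x = U.proj y) : h x = h y := by
    obtain ⟨g, rfl⟩ := U.exists_smul_eq hxy
    rw [hξ, htriv]; simp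
  have hquot : Topology.IsQuotientMap (⟨U.proj, U.isCoveringMap.continuous⟩ : C(U.Total, M)) :=
    U.isCoveringMap.isLocalHomeomorph.isOpenMap.isQuotientMap U.isCoveringMap.continuous
      U.proj_surjective
  let hM : C(M, ℝ) := hquot.lift h fun _ _ h => hinv h
  have hhM (m) : (hM m : UnitAddCircle) = p m := by
    obtain ⟨x, rfl⟩ := U.proj_surjective m
    rw [← hh]
    exact congrArg _ (congrFun (congrArg DFunLike.coe (hquot.lift_comp h fun _ _ h => hinv h)) x)
  let J : F → ℝ := fun f => hM (Θ (0, f))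
  have hJ (s f) : hM (Θ (s, f)) = s + J f := by
    have := isCoveringMap_coe_unitAddCircle.const_of_comp (g := fun s => hM (Θ (s, f)) - s)
      (by fun_prop) (fun s s' => by
        have h0 (s : ℝ) : ((hM (Θ (s, f)) - s : ℝ) : UnitAddCircle) = 0 := by
          rw [AddCircle.coe_sub, hhM, hΘ, sub_self]
        rw [h0, h0]) s 0
    have e : hM (Θ (s, f)) - s = hM (Θ (0, f)) - 0 := this
    linarith
  -- Along the homotopy G the map to the circle is constant, so its real-valued lift is constant
  -- too.
  have hJG (f) : J (b (a f)) = J f := by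
    have := isCoveringMap_coe_unitAddCircle.const_of_comp
      (g := fun s : unitInterval => hM (Θ (0, G (s, f)))) (by fun_prop)
      (fun s s' => by rw [hhM, hhM, hΘ, hΘ]) 1 0
    simpa only [hG0, hG1] using this
  have hJb : Continuous fun y => J (b y) := by
    change Continuous fun y => hM (Θ (0, b y))
    fun_prop
  obtain ⟨C, hC⟩ := (isCompact_univ.image hJb).bddBelow
  have hC' (f) : C ≤ J f := hJG f ▸ hC ⟨a f, trivial, rfl⟩
  obtain ⟨n, hn⟩ := exists_nat_gt (-C)
  let m : M := Classical.arbitrary M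
  have hm : p m = ((hM m + n : ℝ) : UnitAddCircle) := by
    rw [AddCircle.coe_add, hhM, ← sub_eq_zero]
    have : ((n : ℝ) : UnitAddCircle) = 0 := (AddCircle.coe_eq_zero_iff 1).2 ⟨n, by simp⟩
    rw [this]; simp
  have h1 := hJ (hM m + n) (D ⟨(m, hM m + n), hm⟩)
  rw [hΘD ⟨(m, hM m + n), hm⟩] at h1
  have h2 := hC' (D ⟨(m, hM m + n), hm⟩)
  linarith

end UniversalCover

/-- An element on which a nontrivial class is negative and minimal in absolute value. -/
theorem exists_ker_mul_zpow {π : Type*} [Group π] (ξ : π →* Multiplicative ℤ) (hξ : ∃ g, ξ g ≠ 1) :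
    ∃ t, (ξ t).toAdd < 0 ∧ ∀ g, ∃ n ∈ ξ.ker, ∃ m : ℤ, g = n * t ^ m := by
  obtain ⟨⟨_, t, rfl⟩, ht⟩ := IsCyclic.exists_generator (α := ξ.range)
  have key (g : π) : ∃ m : ℤ, ξ t ^ m = ξ g := by
    obtain ⟨m, hm⟩ := ht ⟨ξ g, g, rfl⟩
    exact ⟨m, congrArg Subtype.val hm⟩
  have hker (t' : π) (ht' : ∀ g, ∃ m : ℤ, ξ t' ^ m = ξ g) (g : π) :
      ∃ n ∈ ξ.ker, ∃ m : ℤ, g = n * t' ^ m := by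
    obtain ⟨m, hm⟩ := ht' g
    exact ⟨g * (t' ^ m)⁻¹, by simp [MonoidHom.mem_ker, hm], m, by simp⟩
  have hne : (ξ t).toAdd ≠ 0 := by
    intro h0
    obtain ⟨g, hg⟩ := hξ
    obtain ⟨m, hm⟩ := key g
    refine hg ?_
    rw [← hm, show ξ t = 1 from Multiplicative.toAdd.injective h0, one_zpow]
  rcases lt_or_gt_of_ne hne with hlt | hgt
  · exact ⟨t, hlt, hker t key⟩
  · refine ⟨t⁻¹, by rw [map_inv, toAdd_inv]; omega, hker t⁻¹ fun g => ?_⟩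
    obtain ⟨m, hm⟩ := key g
    exact ⟨-m, by rw [map_inv, inv_zpow', neg_neg, hm]⟩

/-! ### Local contractibility and metrizability of manifolds -/

/-- Balls in a convex set are convex. This covers both models of charts, Euclidean space and the
half-space. -/
theorem Convex.stronglyLocallyContractibleSpace {E : Type*} [NormedAddCommGroup E]
    [NormedSpace ℝ E] {C : Set E} (hC : Convex ℝ C) : StronglyLocallyContractibleSpace C := by
  refine .of_bases (fun x => Metric.nhds_basis_ball) fun x r hr => ?_
  have h1 : Subtype.val '' Metric.ball x r = C ∩ Metric.ball (x : E) r := by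
    ext y
    constructor
    · rintro ⟨y, hy, rfl⟩
      exact ⟨y.2, hy⟩
    · rintro ⟨hy, hy'⟩
      exact ⟨⟨y, hy⟩, hy', rfl⟩
  have h2 : ContractibleSpace (Subtype.val '' Metric.ball x r : Set E) := by
    rw [h1]
    exact (hC.inter (convex_ball _ _)).contractibleSpace ⟨x, x.2, Metric.mem_ball_self hr⟩
  exact (Topology.IsEmbedding.subtypeVal.homeomorphImage (Metric.ball x r)).contractibleSpace_iff.2 h2

theorem stronglyLocallyContractibleSpace_of_isOpen_cover {X : Type*} [TopologicalSpace X]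
    (h : ∀ x : X, ∃ s : Set X, IsOpen s ∧ x ∈ s ∧ StronglyLocallyContractibleSpace s) :
    StronglyLocallyContractibleSpace X where
  contractible_basis x := by
    rw [Filter.hasBasis_self]
    intro t ht
    obtain ⟨s, hs, hx, hslc⟩ := h x
    obtain ⟨r, ⟨hr, hrc⟩, hrt⟩ := (contractible_basis (⟨x, hx⟩ : s)).mem_iff.1
      (continuous_subtype_val.continuousAt.preimage_mem_nhds ht)
    refine ⟨Subtype.val '' r, hs.isOpenMap_subtype_val.image_mem_nhds hr, ?_, ?_⟩
    · exact (Topology.IsEmbedding.subtypeVal.homeomorphImage r).contractibleSpace_iff.1 hrc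
    · rintro _ ⟨y, hy, rfl⟩
      exact hrt hy

theorem ChartedSpace.stronglyLocallyContractibleSpace (H M : Type*) [TopologicalSpace H]
    [TopologicalSpace M] [ChartedSpace H M] [StronglyLocallyContractibleSpace H] :
    StronglyLocallyContractibleSpace M :=
  stronglyLocallyContractibleSpace_of_isOpen_cover fun x =>
    ⟨(chartAt H x).source, (chartAt H x).open_source, mem_chart_source H x,
      (chartAt H x).isOpenEmbedding_restrict.stronglyLocallyContractibleSpace⟩

instance EuclideanSpace.stronglyLocallyContractibleSpace (n : ℕ) :
    StronglyLocallyContractibleSpace (EuclideanSpace ℝ (Fin n)) :=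
  have := Convex.stronglyLocallyContractibleSpace (convex_univ (E := EuclideanSpace ℝ (Fin n)) (𝕜 := ℝ))
  (Homeomorph.Set.univ (EuclideanSpace ℝ (Fin n))).symm.isOpenEmbedding.stronglyLocallyContractibleSpace

instance EuclideanHalfSpace.stronglyLocallyContractibleSpace (n : ℕ) [NeZero n] :
    StronglyLocallyContractibleSpace (EuclideanHalfSpace n) :=
  Convex.stronglyLocallyContractibleSpace EuclideanHalfSpace.convex

instance EuclideanHalfSpace.locallyCompactSpace (n : ℕ) [NeZero n] :
    LocallyCompactSpace (EuclideanHalfSpace n) := by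
  have h : IsClosed {x : EuclideanSpace ℝ (Fin n) | 0 ≤ x 0} :=
    isClosed_le continuous_const (by fun_prop)
  exact h.isClosedEmbedding_subtypeVal.locallyCompactSpace

theorem TopManifold.stronglyLocallyContractibleSpace (M : Type u) [TopologicalSpace M]
    [h : TopManifold M] : StronglyLocallyContractibleSpace M := by
  obtain ⟨n, ⟨⟨c⟩⟩ | ⟨⟨c⟩⟩⟩ := h.exists_charts
  · exact ChartedSpace.stronglyLocallyContractibleSpace (EuclideanSpace ℝ (Fin n)) M
  · exact ChartedSpace.stronglyLocallyContractibleSpace (EuclideanHalfSpace (n + 1)) M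

theorem TopManifold.locallyCompactSpace (M : Type u) [TopologicalSpace M]
    [h : TopManifold M] : LocallyCompactSpace M := by
  obtain ⟨n, ⟨⟨c⟩⟩ | ⟨⟨c⟩⟩⟩ := h.exists_charts
  · exact ChartedSpace.locallyCompactSpace (EuclideanSpace ℝ (Fin n)) M
  · exact ChartedSpace.locallyCompactSpace (EuclideanHalfSpace (n + 1)) M

theorem TopManifold.metrizableSpace (M : Type u) [TopologicalSpace M]
    [TopManifold M] : TopologicalSpace.MetrizableSpace M :=
  have := TopManifold.locallyCompactSpace M
  inferInstance

/-! ### Small sets in the universal covering -/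

namespace UniversalCover

variable {M : Type u} [MetricSpace M] {x₀ : M} (U : UniversalCover.{u, v} M x₀)

/-- Preconnected sets of small size in the universal covering that meet the preimage of `K`. -/
def smallSets (K : Set M) (ε : ℝ) : Set (Set U.Total) :=
  {A | IsPreconnected A ∧ (∃ x ∈ A, U.proj x ∈ K) ∧
    ∀ x ∈ A, ∀ y ∈ A, dist (U.proj x) (U.proj y) < ε}

theorem smallSets_mono (K : Set M) {ε ε' : ℝ} (h : ε ≤ ε') : U.smallSets K ε ⊆ U.smallSets K ε' :=
  fun _ hA => ⟨hA.1, hA.2.1, fun x hx y hy => (hA.2.2 x hx y hy).trans_le h⟩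

/-- Over a contractible set that is evenly covered, every point lies in a contractible sheet, which
contains the preconnected sets that meet it. -/
theorem exists_sheet {V : Set M} [ContractibleSpace V] {b : M}
    (e : Bundle.Trivialization (U.proj ⁻¹' {b}) U.proj) [DiscreteTopology (U.proj ⁻¹' {b})]
    (hV : V ⊆ e.baseSet) {x : U.Total} (hx : U.proj x ∈ V) :
    ∃ T : Set U.Total, ContractibleSpace T ∧ x ∈ T ∧ (∀ y ∈ T, U.proj y ∈ V) ∧
      (∀ A : Set U.Total, IsPreconnected A → (∀ y ∈ A, U.proj y ∈ V) → (A ∩ T).Nonempty → A ⊆ T) ∧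
      Set.InjOn U.proj T := by
  -- The sheet through x. The sheet coordinate is discrete, hence constant on preconnected sets over
  -- V.
  let T : Set U.Total := {y | U.proj y ∈ V ∧ (e y).2 = (e x).2}
  have hinj : Set.InjOn U.proj T := by
    intro y hy z hz h
    refine e.injOn (e.mem_source.2 (hV hy.1)) (e.mem_source.2 (hV hz.1)) (Prod.ext ?_ ?_)
    · change (e y).1 = (e z).1
      rw [e.coe_fst (e.mem_source.2 (hV hy.1)), e.coe_fst (e.mem_source.2 (hV hz.1)), h]
    · change (e y).2 = (e z).2
      rw [hy.2, hz.2]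
  have hproj : Continuous U.proj := U.isCoveringMap.continuous
  have hs (v : V) : U.proj (e.toPartialEquiv.symm (v.1, (e x).2)) = v :=
    e.proj_symm_apply' (hV v.2)
  have hs2 (v : V) : e (e.toPartialEquiv.symm (v.1, (e x).2)) = (v.1, (e x).2) :=
    e.apply_symm_apply' (hV v.2)
  let φ : T ≃ₜ V :=
    { toFun := fun y => ⟨U.proj y, y.2.1⟩
      invFun := fun v => ⟨e.toPartialEquiv.symm (v.1, (e x).2), by
        refine ⟨?_, ?_⟩
        · rw [hs]; exact v.2
        · rw [hs2]⟩
      left_inv := fun y => Subtype.ext (hinj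
        ⟨by rw [hs ⟨U.proj y, y.2.1⟩]; exact y.2.1, by rw [hs2 ⟨U.proj y, y.2.1⟩]⟩ y.2
        (hs ⟨U.proj y, y.2.1⟩))
      right_inv := fun v => Subtype.ext (hs v)
      continuous_toFun := by fun_prop
      continuous_invFun := by
        refine Continuous.subtype_mk ?_ _
        refine e.continuousOn_invFun.comp_continuous (by fun_prop) fun v => ?_
        rw [e.target_eq]
        exact ⟨hV v.2, trivial⟩ }
  refine ⟨T, φ.contractibleSpace, ⟨hx, rfl⟩, fun y hy => hy.1, ?_, hinj⟩
  rintro A hA hAV ⟨y, hyA, hyT⟩ z hz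
  refine ⟨hAV z hz, ?_⟩
  have hsrc : A ⊆ e.source := fun a ha => e.mem_source.2 (hV (hAV a ha))
  have hc : ContinuousOn (fun a => (e a).2) A :=
    continuous_snd.comp_continuousOn (e.continuousOn_toFun.mono hsrc)
  have := hA.constant hc hz hyA
  exact this.trans hyT.2

variable [PathConnectedSpace M] [StronglyLocallyContractibleSpace M] {K : Set M} (hK : IsCompact K)

include hK in
/-- A Lebesgue number for the contractible evenly covered sets of a given size. -/
theorem exists_lebesgue_number {ε : ℝ} (hε : 0 < ε) :
    ∃ δ > 0, ∀ x : U.Total, U.proj x ∈ K → ∃ T : Set U.Total, ContractibleSpace T ∧ x ∈ T ∧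
      (∀ y ∈ T, ∀ z ∈ T, dist (U.proj y) (U.proj z) < ε) ∧
      (∀ A : Set U.Total, IsPreconnected A → (∀ y ∈ A, dist (U.proj y) (U.proj x) < δ) →
        (A ∩ T).Nonempty → A ⊆ T) ∧ Set.InjOn U.proj T := by
  -- Radius ε/2 keeps distances between projected points of a sheet below ε.
  have hloc (y : M) : ∃ V ∈ nhds y, ContractibleSpace V ∧ V ⊆ Metric.ball y (ε / 2) ∧
      ∃ e : Bundle.Trivialization (U.proj ⁻¹' {y}) U.proj, V ⊆ e.baseSet := by
    have : Nonempty (U.proj ⁻¹' {y}) := (U.proj_surjective y).elim fun x hx => ⟨x, hx⟩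
    have hcov := U.isCoveringMap y
    obtain ⟨V, ⟨hV, hVc⟩, hVs⟩ := (contractible_basis y).mem_iff.1 (Filter.inter_mem
      (Metric.ball_mem_nhds y (half_pos hε)) (hcov.toTrivialization.open_baseSet.mem_nhds
        hcov.mem_toTrivialization_baseSet))
    exact ⟨V, hV, hVc, fun a ha => (hVs ha).1, _, fun a ha => (hVs ha).2⟩
  choose V hV hVc hVε hVe using hloc
  obtain ⟨δ, hδ, hleb⟩ := lebesgue_number_lemma_of_metric hK (c := fun y => interior (V y))
    (fun y => isOpen_interior) fun y _ => Set.mem_iUnion.2 ⟨y, mem_interior_iff_mem_nhds.2 (hV y)⟩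
  refine ⟨δ, hδ, fun x hx => ?_⟩
  obtain ⟨y, hy⟩ := hleb _ hx
  have hy' : Metric.ball (U.proj x) δ ⊆ V y := hy.trans interior_subset
  have hxy : U.proj x ∈ V y := hy' (Metric.mem_ball_self hδ)
  have := hVc y
  have := (U.isCoveringMap y).1
  obtain ⟨e, he⟩ := hVe y
  obtain ⟨T, hTc, hxT, hTV, hTA, hTi⟩ := U.exists_sheet e he hxy
  refine ⟨T, hTc, hxT, fun a ha b hb => ?_, fun A hA hAx hAT => hTA A hA
    (fun a ha => hy' (hAx a ha)) hAT, hTi⟩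
  have h1 := hVε y (hTV a ha)
  have h2 := hVε y (hTV b hb)
  rw [Metric.mem_ball] at h1 h2
  calc _ ≤ dist (U.proj a) y + dist (U.proj b) y := dist_triangle_right _ _ _
    _ < ε := by linarith

end UniversalCover

namespace UniversalCover

/-! ### Star-refining scales of small sets, and finiteness up to ker ξ. -/

section Scales

variable {M : Type u} [MetricSpace M] {x₀ : M} (U : UniversalCover.{u, v} M x₀)
  [PathConnectedSpace M] [StronglyLocallyContractibleSpace M] {K : Set M}

/-- Take the sheet at a point of W over K. Sets of size below δ/2 that meet W project into the
δ-ball at that point, so the sheet contains them; being a contractible sheet of size below ε, it is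
itself a member of the coarser family. -/
theorem exists_starRefines (hK : IsCompact K) {ε : ℝ} (hε : 0 < ε) :
    ∃ δ > 0, δ ≤ ε ∧ SC.StarRefines (U.smallSets K δ) (U.smallSets K ε) ∧
      ∀ A ∈ U.smallSets K δ, Set.InjOn U.proj A := by
  obtain ⟨δ, hδ, hleb⟩ := U.exists_lebesgue_number hK hε
  have hW {W} (hW : W ∈ U.smallSets K (min (δ / 2) ε)) {x y} (hx : x ∈ W) (hy : y ∈ W) :
      dist (U.proj x) (U.proj y) < δ / 2 := (hW.2.2 x hx y hy).trans_le (min_le_left _ _)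
  refine ⟨min (δ / 2) ε, by positivity, min_le_right _ _, fun W hWs 𝒞 h𝒞 hmeet => ?_,
    fun A hA => ?_⟩
  · obtain ⟨x, hxW, hxK⟩ := hWs.2.1
    obtain ⟨T, hTc, hxT, hTε, hTA, -⟩ := hleb x hxK
    refine ⟨T, ⟨?_, ⟨x, hxT, hxK⟩, hTε⟩, hTc, ?_, fun A hA => ?_⟩
    · exact isPreconnected_iff_preconnectedSpace.2 inferInstance
    · exact hTA W hWs.1 (fun y hy => (hW hWs hy hxW).trans (half_lt_self hδ)) ⟨x, hxW, hxT⟩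
    · have hWT := hTA W hWs.1 (fun y hy => (hW hWs hy hxW).trans (half_lt_self hδ)) ⟨x, hxW, hxT⟩
      obtain ⟨a, haA, haW⟩ := hmeet A hA
      refine hTA A (h𝒞 hA).1 (fun y hy => ?_) ⟨a, haA, hWT haW⟩
      have h1 := hW (h𝒞 hA) hy haA
      have h2 := hW hWs haW hxW
      have h3 := dist_triangle (U.proj y) (U.proj a) (U.proj x)
      linarith
  · obtain ⟨x, hxA, hxK⟩ := hA.2.1
    obtain ⟨T, -, hxT, -, hTA, hTi⟩ := hleb x hxK
    exact hTi.mono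
      (hTA A hA.1 (fun y hy => (hW hA hy hxA).trans (half_lt_self hδ)) ⟨x, hxA, hxT⟩)

omit [PathConnectedSpace M] in
theorem smul_mem_smallSets {ε : ℝ} (g : Pi1 M x₀) {A : Set U.Total} (hA : A ∈ U.smallSets K ε) :
    smulMap g '' A ∈ U.smallSets K ε := by
  refine ⟨hA.1.image _ (smulMap g).continuous.continuousOn, ?_, ?_⟩
  · obtain ⟨x, hx, hxK⟩ := hA.2.1
    exact ⟨_, ⟨x, hx, rfl⟩, by rwa [smulMap_apply, proj_smul]⟩
  · rintro _ ⟨x, hx, rfl⟩ _ ⟨y, hy, rfl⟩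
    rw [smulMap_apply, smulMap_apply, proj_smul, proj_smul]
    exact hA.2.2 x hx y hy

omit [PathConnectedSpace M] in
/-- Points over `K` have small neighborhoods on which a function varies little. -/
theorem exists_mem_nhds_smallSets {ε : ℝ} (hε : 0 < ε) (h : C(U.Total, ℝ)) (x : U.Total)
    (hx : U.proj x ∈ K) : ∃ A ∈ nhds x, A ∈ U.smallSets K ε ∧ ∀ y ∈ A, dist (h y) (h x) < 1 / 2 := by
  have h1 : U.proj ⁻¹' Metric.ball (U.proj x) (ε / 2) ∈ nhds x :=
    U.isCoveringMap.continuous.continuousAt (Metric.ball_mem_nhds _ (half_pos hε))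
  have h2 : h ⁻¹' Metric.ball (h x) (1 / 2) ∈ nhds x :=
    h.continuous.continuousAt (Metric.ball_mem_nhds _ (by norm_num))
  obtain ⟨A, ⟨hA, hAc⟩, hAs⟩ := (path_connected_basis x).mem_iff.1 (Filter.inter_mem h1 h2)
  refine ⟨A, hA, ⟨hAc.isConnected.isPreconnected, ⟨x, mem_of_mem_nhds hA, hx⟩, ?_⟩,
    fun y hy => (hAs hy).2⟩
  intro y hy z hz
  have h3 : dist (U.proj y) (U.proj x) < ε / 2 := (hAs hy).1
  have h4 : dist (U.proj z) (U.proj x) < ε / 2 := (hAs hz).1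
  calc _ ≤ dist (U.proj y) (U.proj x) + dist (U.proj z) (U.proj x) := dist_triangle_right _ _ _
    _ < ε := by linarith

variable {ξ : Pi1 M x₀ →* Multiplicative ℤ} {h : C(U.Total, ℝ)}

/-- Up to the kernel of `ξ`, finitely many small sets cover the points over a compact set at
height `0`. -/
theorem exists_finite_near (hK : IsCompact K)
    (hξ : ∀ (g : Pi1 M x₀) (x : U.Total), h (g • x) = h x + ((ξ g).toAdd : ℤ))
    {ε : ℝ} (hε : 0 < ε) : ∃ F : Set U.Total, F.Finite ∧ ∀ x, U.proj x ∈ K → h x = 0 →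
      ∃ A ∈ U.smallSets K ε, ∃ n : ξ.ker, ∃ q ∈ F, x ∈ A ∧ n • q ∈ A := by
  classical
  choose A hA hAs hAh using fun x hx => U.exists_mem_nhds_smallSets (K := K) hε h x hx
  choose s hs using U.proj_surjective
  have hsK {y : M} (hy : y ∈ K) : U.proj (s y) ∈ K := (hs y).symm ▸ hy
  obtain ⟨I, hI⟩ := hK.elim_nhds_subcover' (fun y hy => U.proj '' A (s y) (hsK hy)) fun y hy => by
    have := U.isCoveringMap.isLocalHomeomorph.isOpenMap.image_mem_nhds (hA (s y) (hsK hy))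
    rwa [hs] at this
  -- Finitely many small sets cover K only up to π. One point of height 0 is kept for each of them,
  -- and the height then reduces the ambiguity to ker ξ.
  let S (y : K) : Set U.Total :=
    {z | U.proj z ∈ K ∧ h z = 0 ∧ ∃ g : Pi1 M x₀, g • z ∈ A (s y) (hsK y.2)}
  let q (y : K) : U.Total := if hy : (S y).Nonempty then hy.some else U.base
  refine ⟨q '' I, I.finite_toSet.image q, fun x hxK hx0 => ?_⟩
  obtain ⟨y, hyI, z, hz, hzx⟩ := Set.mem_iUnion₂.1 (hI hxK)
  obtain ⟨g, rfl⟩ := U.exists_smul_eq hzx.symm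
  have hne : (S y).Nonempty := ⟨x, hxK, hx0, g, hz⟩
  have hq : q y ∈ S y := by
    change (if hy : (S y).Nonempty then hy.some else U.base) ∈ S y
    rw [dif_pos hne]
    exact hne.some_mem
  obtain ⟨-, hq0, g', hg'⟩ := hq
  -- x and q(y) have height 0, so ξ(g) and ξ(g') are heights of points of one small set. Both are
  -- within 1/2 of its central height, and integers at distance less than 1 coincide.
  have hgg : ξ g = ξ g' := by
    have h1 := hAh _ _ _ hz
    have h2 := hAh _ _ _ hg'
    rw [hξ, hx0, zero_add, Real.dist_eq, abs_lt] at h1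
    rw [hξ, hq0, zero_add, Real.dist_eq, abs_lt] at h2
    refine Multiplicative.toAdd.injective ?_
    have h3 : (((ξ g).toAdd - (ξ g').toAdd : ℤ) : ℝ) < 1 := by push_cast; linarith
    have h4 : (((ξ g').toAdd - (ξ g).toAdd : ℤ) : ℝ) < 1 := by push_cast; linarith
    have h3' : (ξ g).toAdd - (ξ g').toAdd < 1 := by exact_mod_cast h3
    have h4' : (ξ g').toAdd - (ξ g).toAdd < 1 := by exact_mod_cast h4
    omega
  refine ⟨smulMap g⁻¹ '' A (s y) (hsK y.2), U.smul_mem_smallSets _ (hAs _ _),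
    ⟨g⁻¹ * g', by rw [MonoidHom.mem_ker, map_mul, map_inv, hgg, inv_mul_cancel]⟩, q y, ⟨y, hyI, rfl⟩,
    ⟨g • x, hz, by simp⟩, ⟨g' • q y, hg', ?_⟩⟩
  rw [smulMap_apply, smul_smul]
  rfl

/-- An equivariant deformation into a compact part of the infinite cyclic covering shows that its
singular chains are dominated, in each degree. -/
theorem isDominated_of_deformation (hK : IsCompact K)
    (hξ : ∀ (g : Pi1 M x₀) (x : U.Total), h (g • x) = h x + ((ξ g).toAdd : ℤ))
    (H : C(U.Total × unitInterval, U.Total)) (H_zero : ∀ x, H (x, 0) = x)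
    (H_smul : ∀ g ∈ ξ.ker, ∀ x s, H (g • x, s) = g • H (x, s))
    (hHK : ∀ x, U.proj (H (x, 1)) ∈ K) (hHh : ∀ x, h (H (x, 1)) = 0) (i : ℕ) :
    SC.IsDominated ξ.ker U.Total i := by
  choose! δ hδ hδε hstar hinj using fun ε (hε : (0 : ℝ) < ε) => U.exists_starRefines hK hε
  -- Starting at δ(1) rather than at 1 makes every scale at most δ(1), so the projection is
  -- injective on all the small sets.
  let E : ℕ → ℝ := fun n => δ^[n + 1] 1
  have hE1 (n) : E (n + 1) = δ (E n) := Function.iterate_succ_apply' δ (n + 1) 1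
  have hE (n) : 0 < E n := by
    induction n with
    | zero => exact hδ 1 one_pos
    | succ n ih => rw [hE1]; exact hδ _ ih
  have hEle (n) : E n ≤ δ 1 := by
    induction n with
    | zero => exact le_rfl
    | succ n ih => rw [hE1]; exact (hδε _ (hE n)).trans ih
  obtain ⟨F, hF, hnear⟩ := U.exists_finite_near hK hξ (hE (i + 2))
  refine SC.exists_domination (fun g x hx => Subtype.ext (U.eq_one_of_smul_eq g.1 x hx))
    -- The index is reversed: the families must grow coarser with n, starting at the finest scale
    -- E(i + 2).
    (fun n => U.smallSets K (E (i + 2 - n))) i (fun n g A hA => U.smul_mem_smallSets g.1 hA)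
    (fun n hn => ?_) (fun A hA g x hx hgx => ?_) H H_zero (fun g x s => H_smul g.1 g.2 x s)
    (fun x => ?_) hF fun x => hnear _ (hHK x) (hHh x)
  · have : i + 2 - n = (i + 2 - (n + 1)) + 1 := by omega
    change SC.StarRefines (U.smallSets K (E (i + 2 - n))) (U.smallSets K (E (i + 2 - (n + 1))))
    rw [this, hE1]
    exact hstar _ (hE _)
  · have h1 := hinj 1 one_pos A (U.smallSets_mono K (hEle _) hA)
    refine Subtype.ext (U.eq_one_of_smul_eq g.1 x (h1 hgx hx (U.proj_smul g.1 x)))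
  · obtain ⟨A, hA, hAs, -⟩ := U.exists_mem_nhds_smallSets (hE (i + 2)) h (H (x, 1)) (hHK x)
    have hc : Continuous fun y => H (y, 1) := by fun_prop
    exact ⟨(fun y => H (y, 1)) ⁻¹' A, hc.continuousAt.preimage_mem_nhds hA, A, hAs, fun y hy => hy⟩

end Scales

end UniversalCover

/-- The twisted Novikov homology of a fibered class vanishes. -/
theorem subsingleton_twistedHomology_of_isFibered
    {M : Type u} [TopologicalSpace M] [TopManifold M] [ConnectedSpace M] {x₀ : M}
    (U : UniversalCover.{u, v} M x₀)
    {Γ : Type w} [AddCommGroup Γ]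
    (ψ : Pi1 M x₀ →* Multiplicative Γ)
    (ξ : Pi1 M x₀ →* Multiplicative ℤ) (ξΓ : Γ →+ ℝ)
    (hξ : ∀ g, ξΓ (Multiplicative.toAdd (ψ g)) = ((Multiplicative.toAdd (ξ g) : ℤ) : ℝ))
    {S : Type z} [CommRing S] [Nontrivial S] {k : ℕ} (α : Pi1 M x₀ →* GL (Fin k) S)
    (F : Type t) [TopologicalSpace F] (hF : HasFiniteCWType F)
    (hfib : IsFibered F ξ) (i : ℕ) :
    Subsingleton (twistedHomology U ψ ξΓ α i) := by
  have : PathConnectedSpace M := pathConnectedSpace_iff_connectedSpace.2 inferInstance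
  have hdom : ∃ t : Pi1 M x₀, (ξ t).toAdd < 0 ∧ (∀ g, ∃ n ∈ ξ.ker, ∃ m : ℤ, g = n * t ^ m) ∧
      (∃ h : C(U.Total, ℝ),
        ∀ (g : Pi1 M x₀) (x : U.Total), h (g • x) = h x + ((ξ g).toAdd : ℤ)) ∧
      ∀ i, SC.IsDominated ξ.ker U.Total i := by
    obtain ⟨p, hp, hw⟩ := hfib
    obtain ⟨h, hh, hξh⟩ := U.exists_height p ξ hw
    obtain ⟨t, ht, htg⟩ := exists_ker_mul_zpow ξ (U.exists_ne_one_of_fibered hp hF hh hξh)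
    obtain ⟨H, K, hK, H_zero, H_smul, hHK, hHh⟩ := U.exists_deformation hp hF hh hξh
    have := TopManifold.stronglyLocallyContractibleSpace M
    refine ⟨t, ht, htg, ⟨h, hξh⟩, fun i => ?_⟩
    have hmet := TopManifold.metrizableSpace M
    let _ := TopologicalSpace.metrizableSpaceMetric M
    exact U.isDominated_of_deformation hK hξh H H_zero H_smul hHK hHh i
  obtain ⟨t, ht, htg, ⟨h, hξh⟩, hdom⟩ := hdom
  refine subsingleton_homology_of_exact (coefficientAction ψ ξΓ α) U.deckHom (fun g => rfl) i
    (exact_of_isDominated _ ξ.ker (coefficientLattice ψ ξΓ α hξ ht) htg hdom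
      (fun g _ x hx => U.eq_one_of_smul_eq g x hx) (height := h)
      (c := fun g => (((ξ g).toAdd : ℤ) : ℝ)) (fun g x => hξh g x) (fun g hg => ?_) ?_ i)
  · rw [MonoidHom.mem_ker.1 hg]; simp
  · change (0 : ℝ) < (((ξ t⁻¹).toAdd : ℤ) : ℝ)
    rw [map_inv, toAdd_inv]
    exact_mod_cast neg_pos.2 ht

end Novikov

end

theorem proposition3p3
    -- a connected manifold `M`, with its universal covering
    {M : Type u} [TopologicalSpace M] [Novikov.TopManifold M] [ConnectedSpace M] {x₀ : M}
    (U : Novikov.UniversalCover.{u, v} M x₀)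
    -- an admissible pair `(ψ, ξ)`, with `ξ` integral, and the induced homomorphism `Γ → ℝ`
    {Γ : Type w} [AddCommGroup Γ] [Module.Free ℤ Γ]
    (ψ : Novikov.Pi1 M x₀ →* Multiplicative Γ) (hψ : Function.Surjective ψ)
    (ξ : Novikov.Pi1 M x₀ →* Multiplicative ℤ) (ξΓ : Γ →+ ℝ)
    (hξ : ∀ g, ξΓ (Multiplicative.toAdd (ψ g)) = ((Multiplicative.toAdd (ξ g) : ℤ) : ℝ))
    -- a representation over a domain `S`
    {S : Type z} [CommRing S] [IsDomain S] {k : ℕ} (α : Novikov.Pi1 M x₀ →* GL (Fin k) S)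
    -- `ξ` is fibered, with a fiber of the homotopy type of a finite CW complex
    (F : Type t) [TopologicalSpace F] (hF : Novikov.HasFiniteCWType F)
    (hfib : Novikov.IsFibered F ξ) (i : ℕ) :
    Subsingleton (Novikov.twistedHomology U ψ ξΓ α i) := by
  exact Novikov.subsingleton_twistedHomology_of_isFibered U ψ ξ ξΓ hξ α F hF hfib i
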